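/- Let $n\ge 2$, $c>0$, $\alpha\in(0,1]$, and let $\beta^l_0,\beta^l_1,\beta^l_2,\beta^s_1,\beta^s_2,\beta^s_3>0$. Let $V^l,V^s\in C^2(\mathbb R^n,\mathbb R)$, and let $B^l,B^s$ be $C^1$ maps from $\mathbb R^n$ to the real antisymmetric $n\times n$ matrices such that, for $x\in\mathbb R^n$, $|j_1|\le 2$, $|j_2|\le 1$ and all $i,k$, $$|\partial^{j_1}V^l(x)|\le\beta^l_{|j_1|}(1+|x|)^{-(\alpha+|j_1|)},\quad |\partial^{j_2}B^l_{i,k}(x)|\le\beta^l_{|j_2|+1}(1+|x|)^{-(\alpha+|j_2|+1)},$$ $$|\partial^{j_1}V^s(x)|\le\beta^s_{|j_1|+1}(1+|x|)^{-(\alpha+1+|j_1|)},\quad |\partial^{j_2}B^s_{i,k}(x)|\le\beta^s_{|j_2|+2}(1+|x|)^{-(\alpha+|j_2|+2)},$$ and such that $B=B^l+B^s$ satisfies $\partial_iB_{k,m}+\partial_mB_{i,k}+\partial_kB_{m,i}=0$ for all $i,k,m$. Put $F^l(x,v)=-\nabla V^l(x)+\frac1cB^l(x)v$, $F^s(x,v)=-\nabla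 V^s(x)+\frac1cB^s(x)v$, $F=F^l+F^s$, $\beta_2=\max(\beta^l_2,\beta^s_2)$ and $\beta=\max(\beta^l_1,\beta_2,\beta^s_3)$. Write $g(p)=p/\sqrt{1+|p|^2/c^2}$ for $p\in\mathbb R^n$ and $g^{-1}(w)=w/\sqrt{1-|w|^2/c^2}$ for $|w|<c$. For $H\in\{F,F^l,F^s\}$ and a differentiable curve $f$, write $H(f)(\tau)=H(f(\tau),\dot f(\tau))$. A solution for the force $H$ is a curve $x:\mathbb R\to\mathbb R^n$ with $|\dot x|<c$ and $\frac{d}{dt}g^{-1}(\dot x)=H(x)$. Let $0<r<\min(\frac12,2^{-3/2}c)$, and let $v,x\in\mathbb R^n$ with $|v|<c$ and $v\cdot x=0$. Assume $|v|\ge\tilde\rho_0$, where $\tilde\rho_0=\tilde\rho_0(|x|,r,\beta,\alpha)$ is the unique root in $(2^{3/2}r,c)$ of $$1=\frac{72n^2(c^{-1}+1)\beta\sqrt{1-\frac{\tilde\rho_0^2}{c^2}}\Big(1+\frac1{\tilde\rho_0/2^{3/2}-r}\Big)}{\alpha r\big(\frac{\tilde\rho_0}{2^{3/2}}-r\big)\big(\frac12+\frac{|x|}{\sqrt2}\big)^\alpha}.$$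 Put $s=\sqrt{1-|v|^2/c^2}$, $u=|v|/(2\sqrt2)$, $d=u-r$ (so $d>0$) and $X=|x|/\sqrt2$. Then the following holds; in particular all integrals below converge absolutely. **(A) The modified scattering data are well defined.** For $\kappa\in[0,\frac12]$ put $C_\kappa=\dfrac{2^{9/2}n^{3/2}\beta^l_1s}{\alpha|v|(1+X-\kappa)^\alpha}$. 1. There is a unique solution $z_-$ for the force $F^l$ with $z_-(0)=x$, $\dot z_-(t)\to v$ as $t\to-\infty$ and $\sup_{\mathbb R}|\dot z_--v|\le C_0$. 2. Let $M$ be the set of $f\in C^1(\mathbb R,\mathbb R^n)$ with $\sup_{\mathbb R}|\dot z_-+\dot f|\le c$ and $$\max\Big(\sup_{t<0}\max\big(1,1-r+X+d|t|\big)|\dot f(t)|,\ \sup_{t>0}|\dot f(t)|,\ \sup_{t<0}|f(t)|\Big)\le r.$$ The map $$\mathcal A(f)(t)=\int_{-\infty}^t\Big(g\big(g^{-1}(v)+\int_{-\infty}^\sigma F(z_-+f)(\tau)d\tau\big)-g\big(g^{-1}(v)+\int_{-\infty}^\sigma F^l(z_-)(\tau)d\tau\big)\Big)d\sigma$$ has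 a unique fixed point $y_-$ in $M$. The curve $z_-+y_-$ is a solution for the force $F$, and $y_-(t)\to0$, $\dot y_-(t)\to0$ as $t\to-\infty$. Put $\tilde a=g\big(g^{-1}(v)+\int_{\mathbb R}F(z_-+y_-)(\tau)d\tau\big)$ and $\tilde a_{sc}=\tilde a-v$. 3. For every $|q|\le\frac12$ there is a unique solution $z_+(q,\cdot)$ for the force $F^l$ with $z_+(q,0)=x+q$, $\dot z_+(q,t)\to\tilde a$ as $t\to+\infty$ and $\sup_{\mathbb R}|\dot z_+(q,\cdot)-\tilde a|\le C_{|q|}$. Put $$h(q,t)=-\int_t^{+\infty}\Big(g\big(g^{-1}(\tilde a)-\int_\sigma^{+\infty}F(z_-+y_-)(\tau)d\tau\big)-g\big(g^{-1}(\tilde a)-\int_\sigma^{+\infty}F^l(z_+(q,\cdot))(\tau)d\tau\big)\Big)d\sigma$$ and $\mathcal G(q)=\mathcal A(y_-)(0)-h(q,0)$. Then $\mathcal G$ maps the closed ball of radius $\frac12$ centred at $0$ into itself, and $|\mathcal G(q)-\mathcal G(q')|\le\frac16|q-q'|$ there. Let $\tilde b_{sc}$ be its unique fixed point in that ball, and let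 $y_+=h(\tilde b_{sc},\cdot)$. Then $z_-(t)+y_-(t)=z_+(\tilde b_{sc},t)+y_+(t)$ for $t\ge0$, and $y_+(t)\to0$, $\dot y_+(t)\to0$ as $t\to+\infty$. **(B) Decay estimates.** $$|\dot y_-(t)|\le\frac{2n^{3/2}s\big(\frac{r\beta^l_1}c+2\beta_2(n^{1/2}r+1)\big)}{(\alpha+1)\,d\,(1-r+X-d\,t)^{\alpha+1}}\quad(t\le0),$$ $$|\tilde a_{sc}|\le\frac{24n^{3/2}s\max(\beta^l_1,\beta_2)}{\alpha\,d\,(\frac12+X)^\alpha},\qquad |\tilde b_{sc}|\le\frac{24n^2s\max(\beta^l_1,\beta_2)(\frac1c+1)}{\alpha(\alpha+1)d^2(\frac12+X)^\alpha},$$ $$|\dot y_+(t)|\le\frac{20n^4s\max(\beta^l_1,\beta_2)(\frac1c+1)}{(\alpha+1)\,d\,(\frac12+X+t\,u)^{\alpha+1}}\quad(t\ge0).$$ **(C) Quadratic error estimates.** With $$\tilde W=g\Big(g^{-1}(v)+\int_{-\infty}^0F^l(z_-)(\tau)d\tau+\int_0^{+\infty}F^l(z_+(0,\cdot))(\tau)d\tau\Big)-v,$$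 one has $$\Big|\tilde a_{sc}-\tilde W-s\int_{-\infty}^{+\infty}F^s(\tau v+x,v)d\tau\Big|\le\frac{944n^4\beta^2s^2(\frac rc+1)(1+\frac1c)(1+\frac1d)^2}{\alpha^2d^2(\frac12+X)^{2\alpha+1}},$$ $$\Big|\tilde b_{sc}-s\Big(\int_{-\infty}^0\int_{-\infty}^\sigma F^s(\tau v+x,v)d\tau d\sigma-\int_0^{+\infty}\int_\sigma^{+\infty}F^s(\tau v+x,v)d\tau d\sigma+\int_{-\infty}^{+\infty}V^s(\tau v+x)d\tau\,\frac v{c^2}\Big)\Big|\le\frac{808n^4\beta^2s^2(\frac1c+1)^2(1+\frac1d)^2}{\alpha^2(\alpha+1)d^3(\frac12+X)^{2\alpha}}.$$ -/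

import Mathlib

open MeasureTheory Filter Set Topology

noncomputable section

namespace RelNewton

/-- `ℝⁿ` with the Euclidean norm. -/
abbrev E (n : ℕ) : Type := EuclideanSpace ℝ (Fin n)

/-- The partial derivative `∂f/∂xᵢ`. -/
def pd {n : ℕ} (i : Fin n) (f : E n → ℝ) (x : E n) : ℝ :=
  fderiv ℝ f x (EuclideanSpace.single i 1)

/-- The electromagnetic force `(x, v) ↦ -∇V(x) + (1/c) B(x) v`. -/
def force {n : ℕ} (c : ℝ) (V : E n → ℝ) (B : E n → Matrix (Fin n) (Fin n) ℝ) (x v : E n) : E n :=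
  -gradient V x + (1 / c) • WithLp.toLp 2 ((B x).mulVec v.ofLp)

/-- Regularity and decay of an electric potential `V` and of an antisymmetric matrix field `B`:
`V` is `C²`, `B` is `C¹`, `|∂ʲV(x)| ≤ b_{|j|} (1+|x|)^{-(γ+|j|)}` for `|j| ≤ 2` and
`|∂ʲB_{i,k}(x)| ≤ b_{|j|+1} (1+|x|)^{-(γ+|j|+1)}` for `|j| ≤ 1`.
The long range case is `γ = α`, `b_j = β^l_j`; the short range case is `γ = α + 1`,
`b_j = β^s_{j+1}`. -/
structure FieldBounds {n : ℕ} (γ b₀ b₁ b₂ : ℝ) (V : E n → ℝ)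
    (B : E n → Matrix (Fin n) (Fin n) ℝ) : Prop where
  contDiff_V : ContDiff ℝ 2 V
  contDiff_B : ∀ i k, ContDiff ℝ 1 fun x => B x i k
  antisymm : ∀ x i k, B x k i = -B x i k
  V_zero : ∀ x, |V x| ≤ b₀ * (1 + ‖x‖) ^ (-γ)
  V_one : ∀ i x, |pd i V x| ≤ b₁ * (1 + ‖x‖) ^ (-(γ + 1))
  V_two : ∀ i k x, |pd i (pd k V) x| ≤ b₂ * (1 + ‖x‖) ^ (-(γ + 2))
  B_zero : ∀ i k x, |B x i k| ≤ b₁ * (1 + ‖x‖) ^ (-(γ + 1))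
  B_one : ∀ m i k x, |pd m (fun y => B y i k) x| ≤ b₂ * (1 + ‖x‖) ^ (-(γ + 2))

/-- The closure condition `∂ᵢB_{k,m} + ∂ₘB_{i,k} + ∂ₖB_{m,i} = 0`. -/
def ClosedField {n : ℕ} (B : E n → Matrix (Fin n) (Fin n) ℝ) : Prop :=
  ∀ x i k m, pd i (fun y => B y k m) x + pd m (fun y => B y i k) x
    + pd k (fun y => B y m i) x = 0

/-- `√(1 - |v|²/c²)`. -/
def lor {n : ℕ} (c : ℝ) (v : E n) : ℝ := √(1 - ‖v‖ ^ 2 / c ^ 2)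

/-- The velocity `g(p) = p / √(1 + |p|²/c²)` of momentum `p`. -/
def g {n : ℕ} (c : ℝ) (p : E n) : E n := (1 / √(1 + ‖p‖ ^ 2 / c ^ 2)) • p

/-- The momentum `g⁻¹(v) = v / √(1 - |v|²/c²)` of a velocity `v`, `|v| < c`. -/
def gInv {n : ℕ} (c : ℝ) (v : E n) : E n := (1 / lor c v) • v

/-- `H(f)(τ) = H(f(τ), f'(τ))`. -/
def along {n : ℕ} (H : E n → E n → E n) (f : ℝ → E n) (τ : ℝ) : E n := H (f τ) (deriv f τ)

/-- `x` is a solution on `ℝ` of `p' = H(x, x')`, `p = x' / √(1 - |x'|²/c²)`. -/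
structure IsNewtonSolution {n : ℕ} (c : ℝ) (H : E n → E n → E n) (x : ℝ → E n) : Prop where
  differentiable : Differentiable ℝ x
  speed_lt : ∀ t, ‖deriv x t‖ < c
  momentum : ∀ t, HasDerivAt (fun s => gInv c (deriv x s)) (along H x t) t

/-- `z` is a solution for the force `Fl` with `z(0) = y`, with `z'(t) → w` along `l`
(`l = atTop` for `z₊(w, y, ·)`, `l = atBot` for `z₋(w, y, ·)`), and with `sup |z' - w| ≤ C`. -/
structure IsFreeSolution {n : ℕ} (c : ℝ) (Fl : E n → E n → E n) (l : Filter ℝ) (w y : E n)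
    (C : ℝ) (z : ℝ → E n) : Prop where
  solution : IsNewtonSolution c Fl z
  tendsto_deriv : Tendsto (deriv z) l (𝓝 w)
  initial : z 0 = y
  deriv_sub_le : ∀ t, ‖deriv z t - w‖ ≤ C

/-- The bound on `|z_±'(w, x+q, ·) - w|` that singles out the free solutions, where `κ = |q|`. -/
def freeBound {n : ℕ} (c α b₁ : ℝ) (v x : E n) (κ : ℝ) : ℝ :=
  2 ^ (9 / 2 : ℝ) * (n : ℝ) ^ (3 / 2 : ℝ) * b₁ * lor c v
    / (α * ‖v‖ * (1 + ‖x‖ / √2 - κ) ^ α)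

/-- The set `M_{r,v,x}` of `C¹` deflections `f` with `sup |z' + f'| ≤ c` and `‖f‖_* ≤ r`, the
inequality `‖f‖_* ≤ r` being written out for each of the three suprema whose maximum is
`‖f‖_*`. -/
def deflectionSpace {n : ℕ} (c r : ℝ) (v x : E n) (z : ℝ → E n) : Set (ℝ → E n) :=
  {f | ContDiff ℝ 1 f ∧ (∀ t, ‖deriv z t + deriv f t‖ ≤ c) ∧
    (∀ t < 0, max 1 (1 - r + ‖x‖ / √2 + (‖v‖ / (2 * √2) - r) * |t|) * ‖deriv f t‖ ≤ r) ∧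
    (∀ t > 0, ‖deriv f t‖ ≤ r) ∧ (∀ t < 0, ‖f t‖ ≤ r)}

/-- The derivative of `𝒜(f)`, for the free solution `z = z₋(v, x, ·)`. -/
def dotA {n : ℕ} (c : ℝ) (F Fl : E n → E n → E n) (v : E n) (z f : ℝ → E n) (t : ℝ) : E n :=
  g c (gInv c v + ∫ τ in Iic t, along F (z + f) τ)
    - g c (gInv c v + ∫ τ in Iic t, along Fl z τ)

/-- The map `𝒜`, whose fixed point is the deflection `y₋`. -/
def opA {n : ℕ} (c : ℝ) (F Fl : E n → E n → E n) (v : E n) (z f : ℝ → E n) (t : ℝ) : E n :=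
  ∫ σ in Iic t, dotA c F Fl v z f σ

/-- The outgoing velocity `g(g⁻¹(v) + ∫_ℝ F(x(τ), x'(τ)) dτ)` of the trajectory `x`. -/
def outVel {n : ℕ} (c : ℝ) (F : E n → E n → E n) (v : E n) (x : ℝ → E n) : E n :=
  g c (gInv c v + ∫ τ, along F x τ)

/-- The integrand of `h`, for the trajectory `x`, the outgoing velocity `a` and the
free solution `zp = z₊(a, x₋ + q, ·)`. -/
def hIntegrand {n : ℕ} (c : ℝ) (F Fl : E n → E n → E n) (a : E n) (x zp : ℝ → E n) (σ : ℝ) :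
    E n :=
  g c (gInv c a - ∫ τ in Ioi σ, along F x τ)
    - g c (gInv c a - ∫ τ in Ioi σ, along Fl zp τ)

/-- The function `h(v₋, x₋, q, ·)`. -/
def hFun {n : ℕ} (c : ℝ) (F Fl : E n → E n → E n) (a : E n) (x zp : ℝ → E n) (t : ℝ) : E n :=
  -∫ σ in Ioi t, hIntegrand c F Fl a x zp σ

/-- The map `𝒢_{v₋,x₋}`, for `z = z₋(v₋, x₋, ·)`, the deflection `y = y₋`, and
`zp q = z₊(ã, x₋ + q, ·)`, where `ã` is the outgoing velocity of `z + y`. -/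
def mapG {n : ℕ} (c : ℝ) (F Fl : E n → E n → E n) (v : E n) (z y : ℝ → E n)
    (zp : E n → ℝ → E n) (q : E n) : E n :=
  opA c F Fl v z y 0 - hFun c F Fl (outVel c F v (z + y)) (z + y) (zp q) 0

/-- The vector `W̃`, for `z = z₋(v, x, ·)` and `zp = z₊(ã, x, ·)`. -/
def tildeW {n : ℕ} (c : ℝ) (Fl : E n → E n → E n) (v : E n) (z zp : ℝ → E n) : E n :=
  g c (gInv c v + (∫ τ in Iic 0, along Fl z τ) + ∫ τ in Ioi 0, along Fl zp τ) - v

/-- The function of `ρ` that takes the value `1` at the threshold. -/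
def thresholdFun (n : ℕ) (c α r β s ρ : ℝ) : ℝ :=
  72 * (n : ℝ) ^ 2 * (c⁻¹ + 1) * β * √(1 - ρ ^ 2 / c ^ 2) * (1 + 1 / (ρ / (2 * √2) - r))
    / (α * r * (ρ / (2 * √2) - r) * (1 / 2 + s / √2) ^ α)

/-- The threshold `ρ̃₀(s, r, β, α)`: the root in `(2√2 r, c)` of `thresholdFun = 1`
(see `rhoTilde_spec` for existence and uniqueness). -/
def rhoTilde (n : ℕ) (c α r β s : ℝ) : ℝ :=
  sInf {ρ | ρ ∈ Ioo (2 * √2 * r) c ∧ thresholdFun n c α r β s ρ = 1}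

theorem thresholdFun_strictAntiOn {n : ℕ} {c α r β s : ℝ} (hn : 2 ≤ n) (hc : 0 < c) (hα : 0 < α)
    (hr : 0 < r) (hβ : 0 < β) (hs : 0 ≤ s) :
    StrictAntiOn (thresholdFun n c α r β s) (Ioo (2 * √2 * r) c) := by
  intro a ha b hb hab
  have h2 : 0 < 2 * √2 := by positivity
  have hda : 0 < a / (2 * √2) - r := by
    rw [sub_pos, lt_div_iff₀ h2]; linarith [ha.1]
  have hdab : a / (2 * √2) - r < b / (2 * √2) - r := by gcongr
  have ha0 : 0 < a := lt_trans (by positivity) ha.1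
  have hb1 : 0 < 1 - b ^ 2 / c ^ 2 := by
    rw [sub_pos, div_lt_one (by positivity)]
    exact pow_lt_pow_left₀ hb.2 (by linarith) (by norm_num)
  have hb2 : 0 ≤ 1 - b ^ 2 / c ^ 2 := hb1.le
  have hsb : 0 < √(1 - b ^ 2 / c ^ 2) := Real.sqrt_pos.2 hb1
  have hn0 : (0 : ℝ) < n := by exact_mod_cast (by omega : 0 < n)
  have hdb : 0 < b / (2 * √2) - r := hda.trans hdab
  unfold thresholdFun
  gcongr

theorem thresholdFun_exists {n : ℕ} {c α r β s : ℝ} (hn : 2 ≤ n) (hc : 0 < c) (hα : 0 < α)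
    (hr : 0 < r) (hrc : r < c / (2 * √2)) (hβ : 0 < β) (hs : 0 ≤ s) :
    ∃ ρ ∈ Ioo (2 * √2 * r) c, thresholdFun n c α r β s ρ = 1 := by
  have h2 : 0 < 2 * √2 := by positivity
  have hlt : 2 * √2 * r < c := by
    rw [lt_div_iff₀ h2] at hrc; linarith
  have hn0 : (0 : ℝ) < n := by exact_mod_cast (by omega : 0 < n)
  set K : ℝ := 72 * (n : ℝ) ^ 2 * (c⁻¹ + 1) * β with hK
  set D : ℝ := α * r * (1 / 2 + s / √2) ^ α with hD
  have hK0 : 0 < K := by positivity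
  have hD0 : 0 < D := by positivity
  let ψ : ℝ → ℝ := fun ρ => D * (ρ / (2 * √2) - r) ^ 2
    - K * √(1 - ρ ^ 2 / c ^ 2) * ((ρ / (2 * √2) - r) + 1)
  have hψ : ContinuousOn ψ (Icc (2 * √2 * r) c) := by
    apply Continuous.continuousOn
    fun_prop
  have hl : ψ (2 * √2 * r) < 0 := by
    have h1 : 2 * √2 * r / (2 * √2) - r = 0 := by field_simp; ring
    have h3 : 0 < √(1 - (2 * √2 * r) ^ 2 / c ^ 2) := by
      apply Real.sqrt_pos.2
      rw [sub_pos, div_lt_one (by positivity)]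
      exact pow_lt_pow_left₀ hlt (by positivity) (by norm_num)
    simp only [ψ, h1]
    have := mul_pos hK0 h3
    linarith
  have hrt : 0 < ψ c := by
    have h1 : √(1 - c ^ 2 / c ^ 2) = 0 := by
      rw [div_self (by positivity)]; simp
    simp only [ψ, h1]
    have : 0 < c / (2 * √2) - r := by linarith
    have := mul_pos hD0 (pow_pos this 2)
    linarith
  obtain ⟨ρ, hρ, h0⟩ := intermediate_value_Ioo hlt.le hψ ⟨hl, hrt⟩
  refine ⟨ρ, hρ, ?_⟩
  have hd : 0 < ρ / (2 * √2) - r := by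
    rw [sub_pos, lt_div_iff₀ h2]; linarith [hρ.1]
  have key : thresholdFun n c α r β s ρ
      = K * √(1 - ρ ^ 2 / c ^ 2) * ((ρ / (2 * √2) - r) + 1)
        / (D * (ρ / (2 * √2) - r) ^ 2) := by
    unfold thresholdFun
    rw [← hK]
    generalize ρ / (2 * √2) - r = d at hd ⊢
    rw [hD]
    have h5 : (1 / 2 + s / √2) ^ α ≠ 0 := by positivity
    generalize (1 / 2 + s / √2) ^ α = P at h5 ⊢
    field_simp
  rw [key, div_eq_one_iff_eq (by positivity)]
  simp only [ψ] at h0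
  linarith

/-- `rhoTilde` is the unique root in `(2√2 r, c)` of `thresholdFun = 1`. -/
theorem rhoTilde_spec {n : ℕ} {c α r β s : ℝ} (hn : 2 ≤ n) (hc : 0 < c) (hα : 0 < α)
    (hr : 0 < r) (hrc : r < c / (2 * √2)) (hβ : 0 < β) (hs : 0 ≤ s) (ρ : ℝ) :
    (ρ ∈ Ioo (2 * √2 * r) c ∧ thresholdFun n c α r β s ρ = 1) ↔ ρ = rhoTilde n c α r β s := by
  obtain ⟨ρ₀, h0, h1⟩ := thresholdFun_exists hn hc hα hr hrc hβ hs
  have hset : {ρ | ρ ∈ Ioo (2 * √2 * r) c ∧ thresholdFun n c α r β s ρ = 1} = {ρ₀} := by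
    ext ρ'
    simp only [mem_ofPred_eq, mem_singleton_iff]
    constructor
    · rintro ⟨h2, h3⟩
      exact (thresholdFun_strictAntiOn hn hc hα hr hβ hs).injOn h2 h0 (h3.trans h1.symm)
    · rintro rfl
      exact ⟨h0, h1⟩
  have : rhoTilde n c α r β s = ρ₀ := by
    unfold rhoTilde
    rw [hset, csInf_singleton]
  rw [this]
  have := Set.ext_iff.1 hset ρ
  simpa using this

end RelNewton

end

open RelNewton

/-! The equation is read in momentum form: a velocity is g of g⁻¹(v) plus an integral of the force.
Near p = g⁻¹(v) the map g is 2s-Lipschitz, because its derivative at q is 1/√(1+|q|²/c²) times a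
contraction. Since v·x = 0, the line escapes: |x + tv| ≥ X + 2u|t|. A curve in the tube of radius
1/2 + u|t| around it therefore satisfies 1 + |curve| ≥ N₀ + u|t| with N₀ = 1/2 + X, and the force
along it transfers a momentum of at most a small multiple of M = Aβ N₀^(-α)/(αu), where A = n^(3/2).
The threshold on |v| makes sM(1+1/c)(1+1/u) at most r/100, even with d in place of u, so everything
is a perturbation of the line.

Three tools carry the proof. (1) `ForceBound.exists_unique_free`: a contraction on velocities in the
sup norm gives the solution with given initial position and given asymptotic velocity. Positions
then differ by O(|t|), which is paid for by the extra power of decay of the derivatives of the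
force. (2) `tail_bound` and `Ctx.Good.compare`: if two solutions have the same asymptotic velocity
and their forces differ by a source O(N^(-α-2)), where N = N₀ + ut, then their velocities differ by
O(N^(-α-1)). This is integrable, so their positions differ by a quantity that has a limit. (3)
`Ctx.exists_wave`: let Y_q solve the full equation with Y_q(0) = x + q and asymptotic velocity v. By
(2), Y_q - Z tends to q - Γ(q) for a contraction Γ, whose fixed point yields the unique full
solution asymptotic to the free solution Z.

All of this is done at +∞; the time reversal `Ctx.rev` transfers it to -∞. Reversing the wave and
subtracting z₋ gives y₋. Fixed points of 𝒜 in M correspond to full solutions asymptotic to z₋, so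
existence and uniqueness of y₋ follow from (3) and no contraction estimate for 𝒜 is needed. On the
outgoing side 𝒢(q) equals y₋(0) plus the integral over (0,∞) of the velocity difference between the
trajectory and z₊(q,·), so (2) applied to z₊(q,·) and z₊(q',·) shows that 𝒢 contracts. At its fixed
point the trajectory is asymptotic to z₊, and h is their difference.

For the quadratic estimates, the difference between F along the trajectory and F^l along the free
solution is F^s along the straight line, up to an error carrying a further factor sM
(`Ctx.Pair.diff_le`). Then g is linearized at p with a remainder of order s²
(`norm_g_sub_sub_dg_le`), where dg(p)h = s(h - (v·h)v/c²). The magnetic force does no work, so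
v·F^s(τv+x,v) = -(d/dτ)V^s(τv+x). Hence the full line integral is orthogonal to v, while the
difference of the double integrals has inner product -∫V^s with v, which produces the potential
term. -/

namespace RelNewton

variable {n : ℕ}

/-! ### The velocity map g, its inverse and its derivative -/

theorem lor_pos {c : ℝ} {v : E n} (hv : ‖v‖ < c) : 0 < lor c v := by
  have hc : 0 < c := (norm_nonneg v).trans_lt hv
  unfold lor
  apply Real.sqrt_pos.2
  rw [sub_pos, div_lt_one (by positivity)]
  exact pow_lt_pow_left₀ hv (norm_nonneg v) two_ne_zero

theorem lor_sq {c : ℝ} {v : E n} (hv : ‖v‖ < c) : lor c v ^ 2 = 1 - ‖v‖ ^ 2 / c ^ 2 := by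
  have hc : 0 < c := (norm_nonneg v).trans_lt hv
  unfold lor
  apply Real.sq_sqrt
  rw [sub_nonneg, div_le_one (by positivity)]
  exact pow_le_pow_left₀ (norm_nonneg v) hv.le 2

/-- `1 / √(1 + |p|²/c²)`, the factor `√(1 - |v|²/c²)` expressed through the momentum. -/
noncomputable def glor (c : ℝ) (p : E n) : ℝ := 1 / √(1 + ‖p‖ ^ 2 / c ^ 2)

theorem glor_pos {c : ℝ} (p : E n) : 0 < glor c p := by
  unfold glor; positivity

theorem glor_sq {c : ℝ} (p : E n) : glor c p ^ 2 = (1 + ‖p‖ ^ 2 / c ^ 2)⁻¹ := by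
  unfold glor
  rw [div_pow, Real.sq_sqrt (by positivity), one_pow, one_div]

theorem g_eq {c : ℝ} (p : E n) : g c p = glor c p • p := rfl

theorem g_neg {c : ℝ} (p : E n) : g c (-p) = -g c p := by
  simp [g]

theorem lor_neg {c : ℝ} (v : E n) : lor c (-v) = lor c v := by
  simp [lor]

theorem gInv_neg {c : ℝ} (v : E n) : gInv c (-v) = -gInv c v := by
  simp [gInv, lor_neg]

theorem norm_g_sq {c : ℝ} (p : E n) : ‖g c p‖ ^ 2 = ‖p‖ ^ 2 * (1 + ‖p‖ ^ 2 / c ^ 2)⁻¹ := by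
  rw [g_eq, norm_smul, mul_pow, Real.norm_eq_abs, sq_abs, glor_sq, mul_comm]

theorem norm_g_lt {c : ℝ} (hc : 0 < c) (p : E n) : ‖g c p‖ < c := by
  apply lt_of_pow_lt_pow_left₀ 2 hc.le
  rw [norm_g_sq, ← div_eq_mul_inv, div_lt_iff₀ (by positivity)]
  have : c ^ 2 * (1 + ‖p‖ ^ 2 / c ^ 2) = c ^ 2 + ‖p‖ ^ 2 := by field_simp
  rw [this]
  nlinarith [sq_pos_of_pos hc]

theorem lor_g {c : ℝ} (hc : 0 < c) (p : E n) : lor c (g c p) = glor c p := by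
  have h := lor_sq (norm_g_lt hc p)
  have h2 := glor_sq (c := c) p
  rw [norm_g_sq] at h
  have h3 : lor c (g c p) ^ 2 = glor c p ^ 2 := by
    rw [h, h2]
    field_simp
    ring
  exact (pow_left_inj₀ (lor_pos (norm_g_lt hc p)).le (glor_pos p).le two_ne_zero).1 h3

theorem gInv_g {c : ℝ} (hc : 0 < c) (p : E n) : gInv c (g c p) = p := by
  rw [gInv, lor_g hc, g_eq, smul_smul, one_div, inv_mul_cancel₀ (glor_pos p).ne', one_smul]

theorem glor_gInv {c : ℝ} {v : E n} (hv : ‖v‖ < c) : glor c (gInv c v) = lor c v := by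
  have hc : 0 < c := (norm_nonneg v).trans_lt hv
  have h1 := lor_sq hv
  have h0 := lor_pos hv
  have h : glor c (gInv c v) ^ 2 = lor c v ^ 2 := by
    rw [glor_sq, gInv, norm_smul, mul_pow, Real.norm_eq_abs, sq_abs, div_pow, one_pow]
    have h3 : ‖v‖ ^ 2 = (1 - lor c v ^ 2) * c ^ 2 := by rw [h1]; field_simp; ring
    rw [h3]
    have : (1 + 1 / lor c v ^ 2 * ((1 - lor c v ^ 2) * c ^ 2) / c ^ 2) = (lor c v ^ 2)⁻¹ := by
      field_simp; ring
    rw [this, inv_inv]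
  exact (pow_left_inj₀ (glor_pos _).le h0.le two_ne_zero).1 h

theorem g_gInv {c : ℝ} {v : E n} (hv : ‖v‖ < c) : g c (gInv c v) = v := by
  rw [g_eq, glor_gInv hv, gInv, smul_smul, one_div, mul_inv_cancel₀ (lor_pos hv).ne', one_smul]

theorem continuous_g {c : ℝ} : Continuous (g c : E n → E n) := by
  unfold g
  have h : Continuous fun p : E n => √(1 + ‖p‖ ^ 2 / c ^ 2) := by fun_prop
  exact (continuous_const.div h fun p => by positivity).smul continuous_id

theorem continuousAt_gInv {c : ℝ} {v : E n} (hv : ‖v‖ < c) : ContinuousAt (gInv c) v := by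
  unfold gInv
  refine ContinuousAt.smul (ContinuousAt.div continuousAt_const ?_ (lor_pos hv).ne') continuousAt_id
  unfold lor
  fun_prop

theorem norm_gInv {c : ℝ} {v : E n} (hv : ‖v‖ < c) : ‖gInv c v‖ = ‖v‖ / lor c v := by
  rw [gInv, norm_smul, Real.norm_eq_abs, abs_of_pos (one_div_pos.2 (lor_pos hv))]
  ring

/-- The derivative of `g` at `p`. -/
noncomputable def dg (c : ℝ) (p : E n) : E n →L[ℝ] E n :=
  glor c p • (ContinuousLinearMap.id ℝ (E n) - (1 / c ^ 2) • (innerSL ℝ (g c p)).smulRight (g c p))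

theorem dg_apply {c : ℝ} (p h : E n) :
    dg c p h = glor c p • (h - ((1 / c ^ 2) * inner ℝ (g c p) h) • g c p) := by
  simp [dg, smul_smul]

theorem dg_neg {c : ℝ} (p : E n) : dg c (-p) = dg c p := by
  ext1 h
  simp [dg_apply, g_neg, glor]

theorem hasFDerivAt_g {c : ℝ} (hc : 0 < c) (p : E n) : HasFDerivAt (g c) (dg c p) p := by
  have h1 : HasFDerivAt (fun q : E n => 1 + ‖q‖ ^ 2 / c ^ 2) ((1 / c ^ 2) • (2 • innerSL ℝ p)) p := by
    have := ((hasStrictFDerivAt_norm_sq p).hasFDerivAt.const_mul (1 / c ^ 2)).const_add 1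
    have e : (fun q : E n => 1 + ‖q‖ ^ 2 / c ^ 2) = fun q => 1 + 1 / c ^ 2 * ‖q‖ ^ 2 := by
      ext q
      ring
    rw [e]
    exact this
  have h0 : 0 < 1 + ‖p‖ ^ 2 / c ^ 2 := by positivity
  have h2 := h1.sqrt h0.ne'
  have h3 := (hasDerivAt_inv (Real.sqrt_pos.2 h0).ne').comp_hasFDerivAt p h2
  have h4 := h3.smul (hasFDerivAt_id p)
  have h5 : (g c : E n → E n) = fun q => ((fun y : ℝ => y⁻¹) ∘ fun y : E n => √(1 + ‖y‖ ^ 2 / c ^ 2)) q • id q := by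
    ext1 q
    simp [g]
  rw [h5]
  refine h4.congr_fderiv ?_
  ext1 h
  symm
  rw [dg_apply, g_eq, glor]
  set S := √(1 + ‖p‖ ^ 2 / c ^ 2) with hS
  have hS0 : 0 < S := Real.sqrt_pos.2 h0
  simp only [add_apply, smul_apply,
    ContinuousLinearMap.smulRight_apply, id, Function.comp, innerSL_apply_apply, real_inner_smul_left,
    ContinuousLinearMap.id_apply, smul_eq_mul, ← hS]
  rw [smul_sub, smul_smul, smul_smul, sub_eq_add_neg, ← neg_smul]
  congr 1
  · rw [one_div]
  · congr 1
    simp only [nsmul_eq_mul]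
    push_cast
    field_simp

/-- The symmetric map h ↦ h - (w·h)w/c² has eigenvalues 1 and 1 - |w|²/c², which lie in [0,1]. -/
theorem norm_sub_proj_le {c : ℝ} (hc : 0 < c) {w : E n} (hw : ‖w‖ ≤ c) (h : E n) :
    ‖h - ((1 / c ^ 2) * inner ℝ w h) • w‖ ≤ ‖h‖ := by
  apply le_of_sq_le_sq _ (norm_nonneg h)
  rw [norm_sub_sq_real, norm_smul, real_inner_smul_right, mul_pow, Real.norm_eq_abs, sq_abs,
    real_inner_comm w h]
  have h1 : ‖w‖ ^ 2 ≤ c ^ 2 := pow_le_pow_left₀ (norm_nonneg w) hw 2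
  have h2 : (1 / c ^ 2 * inner ℝ w h) ^ 2 * ‖w‖ ^ 2 ≤ (1 / c ^ 2 * inner ℝ w h) ^ 2 * c ^ 2 := by
    gcongr
  have h3 : (1 / c ^ 2 * inner ℝ w h) ^ 2 * c ^ 2 = 1 / c ^ 2 * inner ℝ w h ^ 2 := by
    field_simp
  have h4 : 0 ≤ 1 / c ^ 2 * (inner ℝ w h) ^ 2 := by positivity
  nlinarith

theorem norm_dg_apply_le {c : ℝ} (hc : 0 < c) (p h : E n) : ‖dg c p h‖ ≤ glor c p * ‖h‖ := by
  rw [dg_apply, norm_smul, Real.norm_eq_abs, abs_of_pos (glor_pos p)]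
  exact mul_le_mul_of_nonneg_left (norm_sub_proj_le hc (norm_g_lt hc p).le h) (glor_pos p).le

theorem norm_dg_le {c : ℝ} (hc : 0 < c) (p : E n) : ‖dg c p‖ ≤ glor c p :=
  ContinuousLinearMap.opNorm_le_bound _ (glor_pos p).le (norm_dg_apply_le hc p)

/-- Such a q has |q| ≥ |p|/2, so 1 + |p|²/c² ≤ 4(1 + |q|²/c²). -/
theorem glor_le_two_mul {c : ℝ} {p q : E n} (h : ‖q - p‖ ≤ ‖p‖ / 2) :
    glor c q ≤ 2 * glor c p := by
  apply le_of_sq_le_sq _ (by have := glor_pos (c := c) p; positivity)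
  rw [mul_pow, glor_sq, glor_sq]
  have h1 : ‖p‖ / 2 ≤ ‖q‖ := by
    have := norm_sub_norm_le p q
    rw [norm_sub_rev] at this
    linarith
  have h2 : ‖p‖ ^ 2 ≤ 4 * ‖q‖ ^ 2 := by nlinarith [norm_nonneg p]
  have h3 : ‖p‖ ^ 2 / c ^ 2 ≤ 4 * (‖q‖ ^ 2 / c ^ 2) := by
    rw [← mul_div_assoc]; gcongr
  rw [← div_eq_mul_inv, inv_eq_one_div, div_le_div_iff₀ (by positivity) (by positivity)]
  linarith

/-- Mean value inequality on the ball of radius |p|/2. At p = g⁻¹(v) the constant is 2s, the source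
of every factor s in the linear estimates. -/
theorem norm_g_sub_le {c : ℝ} (hc : 0 < c) {p q q' : E n} (hq : ‖q - p‖ ≤ ‖p‖ / 2)
    (hq' : ‖q' - p‖ ≤ ‖p‖ / 2) : ‖g c q - g c q'‖ ≤ 2 * glor c p * ‖q - q'‖ := by
  have := (convex_closedBall p (‖p‖ / 2)).norm_image_sub_le_of_norm_hasFDerivWithin_le
    (f := g c) (f' := dg c) (C := 2 * glor c p)
    (fun ξ _ => (hasFDerivAt_g hc ξ).hasFDerivWithinAt)
    (fun ξ hξ => (norm_dg_le hc ξ).trans (glor_le_two_mul (mem_closedBall_iff_norm.1 hξ)))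
    (mem_closedBall_iff_norm.2 hq') (mem_closedBall_iff_norm.2 hq)
  exact this

/-- A difference of reciprocals of square roots, combined with the fact that a ↦ √(1+a²) is
1-Lipschitz. Both `glor` factors are kept: they become the s² of the quadratic remainder. -/
theorem abs_glor_sub_le {c : ℝ} (hc : 0 < c) (p q : E n) :
    |glor c q - glor c p| ≤ glor c q * glor c p * (‖q - p‖ / c) := by
  have key : ∀ a b : ℝ, |√(1 + a ^ 2) - √(1 + b ^ 2)| ≤ |a - b| := by
    intro a b
    have ha : 0 < √(1 + a ^ 2) := Real.sqrt_pos.2 (by positivity)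
    have hb : 0 < √(1 + b ^ 2) := Real.sqrt_pos.2 (by positivity)
    have ha2 := Real.sq_sqrt (show 0 ≤ 1 + a ^ 2 by positivity)
    have hb2 := Real.sq_sqrt (show 0 ≤ 1 + b ^ 2 by positivity)
    rw [← sq_le_sq]
    have : 1 + a * b ≤ √(1 + a ^ 2) * √(1 + b ^ 2) := by
      rw [← Real.sqrt_mul (by positivity)]
      apply Real.le_sqrt_of_sq_le
      nlinarith [sq_nonneg (a - b)]
    nlinarith
  have h := key (‖p‖ / c) (‖q‖ / c)
  simp only [div_pow] at h
  have hp : 0 < √(1 + ‖p‖ ^ 2 / c ^ 2) := Real.sqrt_pos.2 (by positivity)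
  have hq : 0 < √(1 + ‖q‖ ^ 2 / c ^ 2) := Real.sqrt_pos.2 (by positivity)
  have e : glor c q - glor c p
      = glor c q * glor c p * (√(1 + ‖p‖ ^ 2 / c ^ 2) - √(1 + ‖q‖ ^ 2 / c ^ 2)) := by
    unfold glor
    field_simp
  rw [e, abs_mul, abs_of_pos (mul_pos (glor_pos q) (glor_pos p))]
  refine mul_le_mul_of_nonneg_left (h.trans ?_) (mul_pos (glor_pos q) (glor_pos p)).le
  rw [← sub_div, abs_div, abs_of_pos hc, norm_sub_rev q p]
  gcongr
  exact abs_norm_sub_norm_le p q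

/-- The constant is 6 = 2 + 4: 2 from the variation of the scalar factor, and 4 from that of the
rank-one part, whose two slots each move by at most 2 `glor` |q - p|. -/
theorem norm_dg_sub_le {c : ℝ} (hc : 0 < c) {p q : E n} (hq : ‖q - p‖ ≤ ‖p‖ / 2) :
    ‖dg c q - dg c p‖ ≤ 6 * glor c p ^ 2 / c * ‖q - p‖ := by
  have hp0 := glor_pos (c := c) p
  have hq0 := glor_pos (c := c) q
  apply ContinuousLinearMap.opNorm_le_bound _ (by positivity)
  intro h
  set w := g c q with hw
  set v := g c p with hv
  have hwc : ‖w‖ ≤ c := (norm_g_lt hc q).le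
  have hvc : ‖v‖ ≤ c := (norm_g_lt hc p).le
  have e : (dg c q - dg c p) h = (glor c q - glor c p) • (h - ((1 / c ^ 2) * inner ℝ w h) • w)
      - (glor c p * (1 / c ^ 2)) • (inner ℝ w h • (w - v) + inner ℝ (w - v) h • v) := by
    rw [sub_apply, dg_apply, dg_apply, ← hw, ← hv, inner_sub_left]
    module
  have hL : ‖w - v‖ ≤ 2 * glor c p * ‖q - p‖ :=
    norm_g_sub_le hc hq (by simpa using by positivity)
  rw [e]
  refine (norm_sub_le _ _).trans ?_
  rw [norm_smul, norm_smul, Real.norm_eq_abs, Real.norm_eq_abs, abs_of_pos (a := glor c p * _) (by positivity)]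
  have h1 : |glor c q - glor c p| * ‖h - ((1 / c ^ 2) * inner ℝ w h) • w‖
      ≤ (2 * glor c p * glor c p * (‖q - p‖ / c)) * ‖h‖ := by
    gcongr
    · refine (abs_glor_sub_le hc p q).trans ?_
      gcongr
      exact glor_le_two_mul hq
    · exact norm_sub_proj_le hc hwc h
  have h2 : ‖inner ℝ w h • (w - v) + inner ℝ (w - v) h • v‖ ≤ 2 * c * ‖h‖ * ‖w - v‖ := by
    refine (norm_add_le _ _).trans ?_
    rw [norm_smul, norm_smul]
    have i1 : ‖(inner ℝ w h : ℝ)‖ ≤ c * ‖h‖ :=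
      (norm_inner_le_norm w h).trans (by gcongr)
    have i2 : ‖(inner ℝ (w - v) h : ℝ)‖ ≤ ‖w - v‖ * ‖h‖ := norm_inner_le_norm _ h
    calc _ ≤ c * ‖h‖ * ‖w - v‖ + ‖w - v‖ * ‖h‖ * c := by gcongr
      _ = _ := by ring
  calc _ ≤ (2 * glor c p * glor c p * (‖q - p‖ / c)) * ‖h‖
        + glor c p * (1 / c ^ 2) * (2 * c * ‖h‖ * (2 * glor c p * ‖q - p‖)) := by
        refine add_le_add h1 (mul_le_mul_of_nonneg_left (h2.trans ?_) (by positivity))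
        gcongr
    _ = _ := by field_simp; ring

/-- Mean value inequality for g - dg(p) on the ball of radius ρ; it controls the linearization error
of a difference of two velocities. -/
theorem norm_g_sub_sub_dg_le {c : ℝ} (hc : 0 < c) {p q q' : E n} {ρ : ℝ} (hρ : ρ ≤ ‖p‖ / 2)
    (hq : ‖q - p‖ ≤ ρ) (hq' : ‖q' - p‖ ≤ ρ) :
    ‖g c q - g c q' - dg c p (q - q')‖ ≤ 6 * glor c p ^ 2 / c * ρ * ‖q - q'‖ := by
  have hp0 := glor_pos (c := c) p
  exact (convex_closedBall p ρ).norm_image_sub_le_of_norm_hasFDerivWithin_le'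
    (f := g c) (f' := dg c) (φ := dg c p)
    (fun ξ _ => (hasFDerivAt_g hc ξ).hasFDerivWithinAt)
    (fun ξ hξ => by
      have h1 := mem_closedBall_iff_norm.1 hξ
      refine (norm_dg_sub_le hc (h1.trans hρ)).trans ?_
      gcongr)
    (mem_closedBall_iff_norm.2 hq') (mem_closedBall_iff_norm.2 hq)

/-! ### Force bounds deduced from the decay of the fields -/

/-- Size and Lipschitz bounds of a force `H` at velocities `‖w‖ ≤ c`; the weight `N` is any lower
bound of `1 + ‖y‖`. -/
structure ForceBound (c A γ b₁ b₂ : ℝ) (H : E n → E n → E n) : Prop where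
  cont : Continuous fun z : E n × E n => H z.1 z.2
  bound : ∀ (y w : E n) (N : ℝ), 1 / 2 ≤ N → ‖w‖ ≤ c → N ≤ 1 + ‖y‖ →
    ‖H y w‖ ≤ 2 * A * b₁ * N ^ (-(γ + 1))
  lip : ∀ (y y' w w' : E n) (N : ℝ), 1 / 2 ≤ N → ‖w‖ ≤ c → ‖w'‖ ≤ c →
    (∀ ξ ∈ segment ℝ y y', N ≤ 1 + ‖ξ‖) →
    ‖H y' w' - H y w‖ ≤ 2 * A * b₂ * N ^ (-(γ + 2)) * ‖y' - y‖
      + A * b₁ / c * N ^ (-(γ + 1)) * ‖w' - w‖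

theorem norm_le_sqrt_mul {K : ℝ} (hK : 0 ≤ K) {y : E n} (h : ∀ i, |y i| ≤ K) : ‖y‖ ≤ √n * K := by
  apply le_of_sq_le_sq _ (by positivity)
  rw [EuclideanSpace.norm_sq_eq, mul_pow, Real.sq_sqrt (by positivity)]
  calc ∑ i, ‖y i‖ ^ 2 ≤ ∑ _i : Fin n, K ^ 2 := by
        refine Finset.sum_le_sum fun i _ => ?_
        exact pow_le_pow_left₀ (norm_nonneg _) (h i) 2
    _ = n * K ^ 2 := by simp

theorem gradient_apply (f : E n → ℝ) (y : E n) (i : Fin n) : gradient f y i = pd i f y := by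
  have h : inner ℝ (gradient f y) (EuclideanSpace.single i (1 : ℝ)) = pd i f y := by
    simp [gradient, pd]
  rw [← h, EuclideanSpace.inner_single_right]
  simp

theorem norm_gradient_le {f : E n → ℝ} {y : E n} {K : ℝ} (hK : 0 ≤ K) (h : ∀ i, |pd i f y| ≤ K) :
    ‖gradient f y‖ ≤ √n * K :=
  norm_le_sqrt_mul hK fun i => by rw [gradient_apply]; exact h i

theorem norm_fderiv_le_of_pd {f : E n → ℝ} {y : E n} {K : ℝ} (hK : 0 ≤ K)
    (h : ∀ i, |pd i f y| ≤ K) : ‖fderiv ℝ f y‖ ≤ √n * K := by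
  have : ‖gradient f y‖ = ‖fderiv ℝ f y‖ := by simp [gradient]
  rw [← this]
  exact norm_gradient_le hK h

theorem norm_mulVec_le {M : Matrix (Fin n) (Fin n) ℝ} {K : ℝ} (hK : 0 ≤ K)
    (h : ∀ i k, |M i k| ≤ K) (w : E n) : ‖WithLp.toLp 2 (M.mulVec w.ofLp)‖ ≤ n * K * ‖w‖ := by
  have h1 : ∀ i, |(WithLp.toLp 2 (M.mulVec w.ofLp) : E n) i| ≤ √n * K * ‖w‖ := by
    intro i
    have : (WithLp.toLp 2 (M.mulVec w.ofLp) : E n) i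
        = inner ℝ (WithLp.toLp 2 (M i) : E n) w := by
      simp [Matrix.mulVec, dotProduct, PiLp.inner_apply, mul_comm]
    rw [this]
    refine (abs_real_inner_le_norm _ _).trans ?_
    gcongr
    exact norm_le_sqrt_mul hK (h i)
  refine (norm_le_sqrt_mul (by positivity) h1).trans (le_of_eq ?_)
  have := Real.mul_self_sqrt (Nat.cast_nonneg (α := ℝ) n)
  linear_combination K * ‖w‖ * this

theorem contDiff_pd {f : E n → ℝ} (hf : ContDiff ℝ 2 f) (i : Fin n) : ContDiff ℝ 1 (pd i f) := by
  have := hf.fderiv_right (m := 1) (by norm_num)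
  exact this.clm_apply contDiff_const

theorem abs_sub_le_of_pd {f : E n → ℝ} (hf : ContDiff ℝ 1 f) {y y' : E n} {K : ℝ} (hK : 0 ≤ K)
    (h : ∀ ξ ∈ segment ℝ y y', ∀ i, |pd i f ξ| ≤ K) : |f y' - f y| ≤ √n * K * ‖y' - y‖ := by
  exact (convex_segment y y').norm_image_sub_le_of_norm_fderiv_le (𝕜 := ℝ)
    (fun ξ _ => (hf.differentiable (by norm_num)) ξ)
    (fun ξ hξ => norm_fderiv_le_of_pd hK (h ξ hξ)) (left_mem_segment ℝ y y')
    (right_mem_segment ℝ y y')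

theorem rpow_weight_le {N M p : ℝ} (hN : 0 < N) (h : N ≤ M) (hp : 0 ≤ p) : M ^ (-p) ≤ N ^ (-p) :=
  Real.rpow_le_rpow_of_nonpos hN h (by linarith)

theorem mulVec_sub_sub (M M' : Matrix (Fin n) (Fin n) ℝ) (w w' : E n) :
    (WithLp.toLp 2 (M'.mulVec w'.ofLp) : E n) - WithLp.toLp 2 (M.mulVec w.ofLp)
      = WithLp.toLp 2 ((M' - M).mulVec w'.ofLp) + WithLp.toLp 2 (M.mulVec (w' - w).ofLp) := by
  ext i
  simp [Matrix.sub_mulVec, Matrix.mulVec_sub]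

/-- The gradient costs √n, the matrix n, and one more derivative another √n; all sums stay below
2n^(3/2). In the magnetic part the speed bound c cancels 1/c, except in the velocity-Lipschitz term.
-/
theorem FieldBounds.forceBound {c γ b₀ b₁ b₂ : ℝ} {V : E n → ℝ}
    {B : E n → Matrix (Fin n) (Fin n) ℝ} (h : FieldBounds γ b₀ b₁ b₂ V B) (hn : 1 ≤ n)
    (hc : 0 < c) (hγ : 0 < γ) (hb₁ : 0 ≤ b₁) (hb₂ : 0 ≤ b₂) :
    ForceBound c ((n : ℝ) ^ (3 / 2 : ℝ)) γ b₁ b₂ (force c V B) := by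
  have hn1 : (1 : ℝ) ≤ n := by exact_mod_cast hn
  have hs1 : 1 ≤ √(n : ℝ) := Real.one_le_sqrt.2 hn1
  have hA : (n : ℝ) ^ (3 / 2 : ℝ) = n * √n := by
    rw [Real.sqrt_eq_rpow, show (3 / 2 : ℝ) = 1 + 1 / 2 by norm_num,
      Real.rpow_add (by linarith), Real.rpow_one]
  have hsn : √(n : ℝ) ≤ n * √n := by nlinarith
  have hnn : (n : ℝ) ≤ n * √n := by nlinarith
  rw [hA]
  refine ⟨?_, ?_, ?_⟩
  · have h1 : Continuous (gradient V) := by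
      unfold gradient
      exact (LinearIsometryEquiv.continuous _).comp (h.contDiff_V.continuous_fderiv (by norm_num))
    have h2 : Continuous fun y => B y :=
      continuous_matrix fun i k => (h.contDiff_B i k).continuous
    unfold force
    have h3 : Continuous fun z : E n × E n => (B z.1).mulVec z.2.ofLp :=
      (h2.comp continuous_fst).matrix_mulVec ((PiLp.continuous_ofLp 2 _).comp continuous_snd)
    have h4 : Continuous fun z : E n × E n => (WithLp.toLp 2 ((B z.1).mulVec z.2.ofLp) : E n) :=
      (PiLp.continuous_toLp 2 _).comp h3
    exact (h1.comp continuous_fst).neg.add (h4.const_smul (1 / c))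
  · intro y w N hN hw hNy
    have hN0 : 0 < N := by linarith
    have hW : (1 + ‖y‖) ^ (-(γ + 1)) ≤ N ^ (-(γ + 1)) := rpow_weight_le hN0 hNy (by linarith)
    set W := N ^ (-(γ + 1)) with hWd
    have hW0 : 0 < W := by positivity
    have h1 : ‖gradient V y‖ ≤ √n * (b₁ * W) :=
      norm_gradient_le (by positivity) fun i => (h.V_one i y).trans (by gcongr)
    have h2 : ‖WithLp.toLp 2 ((B y).mulVec w.ofLp)‖ ≤ n * (b₁ * W) * ‖w‖ :=
      norm_mulVec_le (by positivity) (fun i k => (h.B_zero i k y).trans (by gcongr)) w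
    unfold force
    refine (norm_add_le _ _).trans ?_
    rw [norm_neg, norm_smul, Real.norm_eq_abs, abs_of_pos (by positivity)]
    calc _ ≤ √n * (b₁ * W) + 1 / c * (n * (b₁ * W) * c) := by
          gcongr
          exact h2.trans (by gcongr)
      _ = (√n + n) * (b₁ * W) := by field_simp
      _ ≤ (2 * (n * √n)) * (b₁ * W) := by gcongr; linarith
      _ = _ := by ring
  · intro y y' w w' N hN hw hw' hseg
    have hN0 : 0 < N := by linarith
    have hW : ∀ p : ℝ, 0 ≤ p → ∀ ξ ∈ segment ℝ y y', (1 + ‖ξ‖) ^ (-p) ≤ N ^ (-p) :=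
      fun p hp ξ hξ => rpow_weight_le hN0 (hseg ξ hξ) hp
    set W := N ^ (-(γ + 1)) with hWd
    set W' := N ^ (-(γ + 2)) with hWd'
    have hW0 : 0 < W := by positivity
    have hW0' : 0 < W' := by positivity
    have h1 : ‖gradient V y' - gradient V y‖ ≤ √n * (√n * (b₂ * W') * ‖y' - y‖) := by
      refine norm_le_sqrt_mul (by positivity) fun i => ?_
      rw [PiLp.sub_apply, gradient_apply, gradient_apply]
      refine abs_sub_le_of_pd (contDiff_pd h.contDiff_V i) (by positivity) fun ξ hξ k => ?_
      exact (h.V_two k i ξ).trans (by gcongr; exact hW _ (by linarith) ξ hξ)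
    have h2 : ‖WithLp.toLp 2 ((B y' - B y).mulVec w'.ofLp)‖
        ≤ n * (√n * (b₂ * W') * ‖y' - y‖) * ‖w'‖ := by
      refine norm_mulVec_le (by positivity) (fun i k => ?_) w'
      rw [Matrix.sub_apply]
      refine abs_sub_le_of_pd (h.contDiff_B i k) (by positivity) fun ξ hξ m => ?_
      exact (h.B_one m i k ξ).trans (by gcongr; exact hW _ (by linarith) ξ hξ)
    have h3 : ‖WithLp.toLp 2 ((B y).mulVec (w' - w).ofLp)‖ ≤ n * (b₁ * W) * ‖w' - w‖ := by
      refine norm_mulVec_le (by positivity) (fun i k => (h.B_zero i k y).trans ?_) _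
      gcongr
      exact hW _ (by linarith) y (left_mem_segment ℝ y y')
    have e : force c V B y' w' - force c V B y w = -(gradient V y' - gradient V y)
        + (1 / c) • (WithLp.toLp 2 ((B y' - B y).mulVec w'.ofLp)
          + WithLp.toLp 2 ((B y).mulVec (w' - w).ofLp)) := by
      rw [← mulVec_sub_sub]
      unfold force
      module
    rw [e]
    refine (norm_add_le _ _).trans ?_
    rw [norm_neg, norm_smul, Real.norm_eq_abs, abs_of_pos (by positivity)]
    have hss := Real.mul_self_sqrt (Nat.cast_nonneg (α := ℝ) n)
    calc _ ≤ √n * (√n * (b₂ * W') * ‖y' - y‖) + 1 / c * (n * (√n * (b₂ * W') * ‖y' - y‖) * c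
          + n * (b₁ * W) * ‖w' - w‖) := by
          gcongr
          refine (norm_add_le _ _).trans (add_le_add (h2.trans (by gcongr)) h3)
      _ = (√n * √n + n * √n) * (b₂ * W') * ‖y' - y‖ + n * b₁ / c * W * ‖w' - w‖ := by
          field_simp
          ring
      _ ≤ (2 * (n * √n)) * (b₂ * W') * ‖y' - y‖ + (n * √n) * b₁ / c * W * ‖w' - w‖ := by
          rw [hss]
          gcongr
          linarith
      _ = _ := by ring

/-- The force of the time-reversed equation. -/
def revForce (H : E n → E n → E n) (y w : E n) : E n := H y (-w)

theorem ForceBound.rev {c A γ b₁ b₂ : ℝ} {H : E n → E n → E n} (h : ForceBound c A γ b₁ b₂ H) :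
    ForceBound c A γ b₁ b₂ (revForce H) where
  cont := h.cont.comp (continuous_fst.prodMk continuous_snd.neg)
  bound y w N hN hw hNy := h.bound y (-w) N hN (by simpa using hw) hNy
  lip y y' w w' N hN hw hw' hs := by
    have := h.lip y y' (-w) (-w') N hN (by simpa using hw) (by simpa using hw') hs
    rwa [show -w' - -w = -(w' - w) by abel, norm_neg] at this

/-- The weights in `ForceBound` are kept above 1/2 for this: a spare power of N⁻¹ can be traded for
a factor 2. -/
theorem rpow_weight_succ_le {N p : ℝ} (hN : 1 / 2 ≤ N) : N ^ (-(p + 1)) ≤ 2 * N ^ (-p) := by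
  have hN0 : 0 < N := by linarith
  rw [show -(p + 1) = -1 + -p by ring, Real.rpow_add hN0, Real.rpow_neg_one]
  gcongr
  rw [inv_le_comm₀ hN0 two_pos]
  linarith

/-- The short range force has one spare power of N⁻¹, worth at most 2, so the sum costs 1 + 2 = 3.
-/
theorem ForceBound.add {c A α b₁ b₂ b₃ m β : ℝ} {Fl Fs : E n → E n → E n} (hc : 0 < c) (hA : 0 ≤ A)
    (hl : ForceBound c A α b₁ b₂ Fl) (hs : ForceBound c A (α + 1) b₂ b₃ Fs)
    (h₁ : b₁ ≤ m) (h₂ : b₂ ≤ m) (h₀ : 0 ≤ b₂) (h₂' : b₂ ≤ β) (h₃' : b₃ ≤ β) :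
    ForceBound c A α (3 * m) (3 * β) (Fl + Fs) where
  cont := hl.cont.add hs.cont
  bound y w N hN hw hNy := by
    have hN0 : 0 < N := by linarith
    have hm : 0 ≤ m := h₀.trans h₂
    have hβ : 0 ≤ β := h₀.trans h₂'
    have hW := rpow_weight_succ_le (p := α + 1) hN
    have hW0 : 0 < N ^ (-(α + 1)) := by positivity
    calc _ ≤ _ := norm_add_le _ _
      _ ≤ 2 * A * b₁ * N ^ (-(α + 1)) + 2 * A * b₂ * N ^ (-(α + 1 + 1)) :=
        add_le_add (hl.bound y w N hN hw hNy) (hs.bound y w N hN hw hNy)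
      _ ≤ 2 * A * m * N ^ (-(α + 1)) + 2 * A * m * (2 * N ^ (-(α + 1))) := by gcongr
      _ = _ := by ring
  lip y y' w w' N hN hw hw' hseg := by
    have hN0 : 0 < N := by linarith
    have hm : 0 ≤ m := h₀.trans h₂
    have hβ : 0 ≤ β := h₀.trans h₂'
    have hW := rpow_weight_succ_le (p := α + 1) hN
    have hW' := rpow_weight_succ_le (p := α + 2) hN
    have hW0 : 0 < N ^ (-(α + 1)) := by positivity
    have hW0' : 0 < N ^ (-(α + 2)) := by positivity
    have e : (Fl + Fs) y' w' - (Fl + Fs) y w = (Fl y' w' - Fl y w) + (Fs y' w' - Fs y w) := by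
      simp only [Pi.add_apply]; abel
    rw [e]
    calc _ ≤ _ := norm_add_le _ _
      _ ≤ _ := add_le_add (hl.lip y y' w w' N hN hw hw' hseg) (hs.lip y y' w w' N hN hw hw' hseg)
      _ ≤ (2 * A * β * N ^ (-(α + 2)) * ‖y' - y‖ + A * m / c * N ^ (-(α + 1)) * ‖w' - w‖)
          + (2 * A * β * (2 * N ^ (-(α + 2))) * ‖y' - y‖
            + A * m / c * (2 * N ^ (-(α + 1))) * ‖w' - w‖) := by
          rw [show α + 1 + 2 = α + 2 + 1 by ring]
          gcongr
      _ = _ := by ring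

/-! ### Integrals of the weights (m + u|t|)^(-γ-1) -/

theorem hasDerivAt_weight {γ m u t : ℝ} (hγ : 0 < γ) (hu : 0 < u) (ht : 0 < m + u * t) :
    HasDerivAt (fun τ => -(m + u * τ) ^ (-γ) / (γ * u)) ((m + u * t) ^ (-(γ + 1))) t := by
  have h1 : HasDerivAt (fun τ => m + u * τ) u t := by
    simpa using ((hasDerivAt_id t).const_mul u).const_add m
  have h2 := ((h1.rpow_const (p := -γ) (Or.inl ht.ne')).neg).div_const (γ * u)
  refine h2.congr_deriv ?_
  rw [show -(γ + 1) = -γ - 1 by ring]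
  field_simp

theorem tendsto_weight {γ m u : ℝ} (hγ : 0 < γ) (hu : 0 < u) :
    Tendsto (fun τ => (m + u * τ) ^ (-γ)) atTop (𝓝 0) :=
  (tendsto_rpow_neg_atTop hγ).comp
    (tendsto_atTop_add_const_left _ m (tendsto_id.const_mul_atTop hu))

theorem integrableOn_weight {γ m u t : ℝ} (hγ : 0 < γ) (hu : 0 < u) (ht : 0 < m + u * t) :
    IntegrableOn (fun τ => (m + u * τ) ^ (-(γ + 1))) (Ioi t) := by
  have hpos : ∀ τ ∈ Ici t, 0 < m + u * τ := fun τ hτ => by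
    have : u * t ≤ u * τ := mul_le_mul_of_nonneg_left hτ hu.le
    linarith
  have h0 : Tendsto (fun τ => -(m + u * τ) ^ (-γ) / (γ * u)) atTop (𝓝 (-0 / (γ * u))) :=
    ((tendsto_weight hγ hu).neg).div_const _
  exact integrableOn_Ioi_deriv_of_nonneg' (fun τ hτ => hasDerivAt_weight hγ hu (hpos τ hτ))
    (fun τ hτ => Real.rpow_nonneg (hpos τ (mem_Ici.2 (le_of_lt hτ))).le _) h0

theorem integral_weight {γ m u t : ℝ} (hγ : 0 < γ) (hu : 0 < u) (ht : 0 < m + u * t) :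
    ∫ τ in Ioi t, (m + u * τ) ^ (-(γ + 1)) = (m + u * t) ^ (-γ) / (γ * u) := by
  have hpos : ∀ τ ∈ Ici t, 0 < m + u * τ := fun τ hτ => by
    have : u * t ≤ u * τ := mul_le_mul_of_nonneg_left hτ hu.le
    linarith
  have h0 : Tendsto (fun τ => -(m + u * τ) ^ (-γ) / (γ * u)) atTop (𝓝 (-0 / (γ * u))) :=
    ((tendsto_weight hγ hu).neg).div_const _
  rw [integral_Ioi_of_hasDerivAt_of_tendsto' (fun τ hτ => hasDerivAt_weight hγ hu (hpos τ hτ))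
    (integrableOn_weight hγ hu ht) h0]
  ring

theorem integrableOn_Iic_of_comp_neg {F : Type*} [NormedAddCommGroup F] {f : ℝ → F} {t : ℝ}
    (h : IntegrableOn (fun t => f (-t)) (Ioi (-t))) : IntegrableOn f (Iic t) := by
  have := (integrable_indicator_iff measurableSet_Ici).2
    ((integrableOn_Ici_iff_integrableOn_Ioi (μ := volume)).2 h)
  rw [← integrable_indicator_iff measurableSet_Iic]
  refine this.comp_neg.congr (Eventually.of_forall fun t => ?_)
  simp [indicator]

theorem integrable_of_comp_neg {F : Type*} [NormedAddCommGroup F] {f : ℝ → F}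
    (h : IntegrableOn f (Ioi 0)) (h' : IntegrableOn (fun t => f (-t)) (Ioi 0)) : Integrable f := by
  rw [← integrableOn_univ, ← Iic_union_Ioi (a := (0 : ℝ))]
  exact (integrableOn_Iic_of_comp_neg (by simpa using h')).union h

theorem integrable_weight_abs {γ m u : ℝ} (hγ : 0 < γ) (hu : 0 < u) (hm : 0 < m) :
    Integrable (fun τ : ℝ => (m + u * |τ|) ^ (-(γ + 1))) := by
  have h : IntegrableOn (fun τ : ℝ => (m + u * |τ|) ^ (-(γ + 1))) (Ioi 0) :=
    (integrableOn_weight hγ hu (t := 0) (by simpa using hm)).congr_fun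
      (fun τ hτ => by simp only [abs_of_pos (mem_Ioi.1 hτ)]) measurableSet_Ioi
  exact integrable_of_comp_neg h (by simpa only [abs_neg] using h)

theorem integral_weight_abs {γ m u : ℝ} (hγ : 0 < γ) (hu : 0 < u) (hm : 0 < m) :
    ∫ τ : ℝ, (m + u * |τ|) ^ (-(γ + 1)) = 2 * m ^ (-γ) / (γ * u) := by
  rw [integral_comp_abs (f := fun τ => (m + u * τ) ^ (-(γ + 1))),
    integral_weight hγ hu (by simpa using hm)]
  simp
  ring

/-- Since ut ≤ m + ut, a factor t costs one power of the weight and 1/u. This absorbs the linear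
growth of position differences. -/
theorem mul_weight_le {p m u t : ℝ} (hu : 0 < u) (hm : 0 < m) (ht : 0 ≤ t) :
    t * (m + u * t) ^ (-(p + 1)) ≤ (m + u * t) ^ (-p) / u := by
  have h : 0 < m + u * t := by positivity
  rw [show -(p + 1) = -1 + -p by ring, Real.rpow_add h, Real.rpow_neg_one, ← mul_assoc, div_eq_inv_mul]
  gcongr
  rw [← div_eq_mul_inv, div_le_iff₀ h, ← div_eq_inv_mul, le_div_iff₀ hu]
  linarith

/-! ### Decay from infinity by absorption -/

/-- Apply `h` to the best constant H = sup f/w, which is finite by `hB`: then H ≤ S + H/2, so H ≤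
2S. -/
theorem le_two_mul_of_le_half {ι : Type*} {f w : ι → ℝ} {S B : ℝ} (hw : ∀ t, 0 < w t)
    (hB : ∀ t, f t ≤ B * w t)
    (h : ∀ H, (∀ t, f t ≤ H * w t) → ∀ t, f t ≤ (S + H / 2) * w t) (t : ι) :
    f t ≤ 2 * S * w t := by
  have hbdd : BddAbove (range fun t => f t / w t) := by
    refine ⟨B, ?_⟩
    rintro _ ⟨t, rfl⟩
    exact (div_le_iff₀ (hw t)).2 (hB t)
  have : Nonempty ι := ⟨t⟩
  have h1 := h (⨆ t, f t / w t) fun t => (div_le_iff₀ (hw t)).1 (le_ciSup hbdd t)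
  have h2 : (⨆ t, f t / w t) ≤ S + (⨆ t, f t / w t) / 2 :=
    ciSup_le fun t => (div_le_iff₀ (hw t)).2 (h1 t)
  refine (h1 t).trans (mul_le_mul_of_nonneg_right ?_ (hw t).le)
  linarith

/-- A linear integral inequality from infinity: the forcing decays like `N^{-(α+2)}`, hence so does
the solution, like `N^{-(α+1)}`, where `N(t) = m + u t`. -/
theorem tail_bound {α m u a b S δ₀ L : ℝ} {η δ φ : ℝ → ℝ} (hα : 0 < α) (hm : 0 < m) (hu : 0 < u)
    (ha : 0 ≤ a) (hb : 0 ≤ b) (hS : 0 ≤ S) (hδ₀ : 0 ≤ δ₀) (hL : 0 < L)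
    (hηc : Continuous η) (hφi : IntegrableOn φ (Ioi 0)) (hφ0 : ∀ t, 0 ≤ φ t)
    (hδ : ∀ t, 0 ≤ t → δ t ≤ δ₀ + ∫ τ in (0 : ℝ)..t, η τ)
    (hφ : ∀ t, 0 < t → φ t ≤ a * (m + u * t) ^ (-(α + 2)) * δ t
      + b * (m + u * t) ^ (-(α + 1)) * η t + S * (m + u * t) ^ (-(α + 2)))
    (hη : ∀ t, 0 ≤ t → η t ≤ L * ∫ τ in Ioi t, φ τ)
    (hk : L * ((a / u + a / u + b) * m ^ (-α) / (α * u)) ≤ 1 / 2) (t : ℝ) (ht : 0 ≤ t) :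
    ∫ τ in Ioi t, φ τ ≤ 2 * ((a * δ₀ + S) / ((α + 1) * u)) * (m + u * t) ^ (-(α + 1)) := by
  set B := ∫ τ in Ioi (0 : ℝ), φ τ with hB
  have hφB : ∀ t, 0 ≤ t → ∫ τ in Ioi t, φ τ ≤ B := fun t ht =>
    setIntegral_mono_set hφi (Eventually.of_forall hφ0) (Ioi_subset_Ioi ht).eventuallyLE
  have hN : ∀ t, 0 ≤ t → 0 < m + u * t := fun t ht => by positivity
  have hNm : ∀ t, 0 ≤ t → (m + u * t) ^ (-α) ≤ m ^ (-α) := fun t ht =>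
    Real.rpow_le_rpow_of_nonpos hm (by nlinarith) (by linarith)
  set S' := (a * δ₀ + S) / ((α + 1) * u) with hS'
  have hS'0 : 0 ≤ S' := by positivity
  -- Decay of the tail is not known in advance. Adding ε to the weight makes the ratio bounded by
  -- B/ε, which starts the absorption; the resulting constant does not depend on ε, and ε tends to 0
  -- at the end.
  have key : ∀ ε > 0, ∀ t : Ici (0 : ℝ), ∫ τ in Ioi (t : ℝ), φ τ
      ≤ 2 * S' * ((m + u * t) ^ (-(α + 1)) + ε) := by
    intro ε hε
    have hw : ∀ t : Ici (0 : ℝ), 0 < (m + u * t) ^ (-(α + 1)) + ε := fun t => by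
      have := hN t t.2
      positivity
    have hB0 : 0 ≤ B := (setIntegral_nonneg measurableSet_Ioi fun τ _ => hφ0 τ).trans (hφB 0 le_rfl)
    refine le_two_mul_of_le_half (B := B / ε) hw ?_ ?_
    · intro t
      refine (hφB t t.2).trans ?_
      rw [div_mul_eq_mul_div, le_div_iff₀ hε]
      gcongr
      have := hN t t.2
      have : 0 < (m + u * t) ^ (-(α + 1)) := by positivity
      linarith
    · intro H hH
      have hH0 : 0 ≤ H := by
        by_contra hlt
        have h1 := hH ⟨0, mem_Ici.2 le_rfl⟩
        have h2 := hw ⟨0, mem_Ici.2 le_rfl⟩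
        have h3 : 0 ≤ ∫ τ in Ioi (0 : ℝ), φ τ := setIntegral_nonneg measurableSet_Ioi fun τ _ => hφ0 τ
        have := mul_neg_of_neg_of_pos (not_le.1 hlt) h2
        simp only at h1
        linarith
      have hηH : ∀ t, 0 ≤ t → η t ≤ L * (H * ((m + u * t) ^ (-(α + 1)) + ε)) := fun t ht =>
        (hη t ht).trans (mul_le_mul_of_nonneg_left (hH ⟨t, ht⟩) hL.le)
      have hδH : ∀ t, 0 ≤ t → δ t ≤ δ₀ + L * H * (m ^ (-α) / (α * u) + ε * t) := by
        intro t ht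
        refine (hδ t ht).trans ?_
        gcongr
        have hi : IntegrableOn (fun τ => (m + u * τ) ^ (-(α + 1))) (Ioi 0) :=
          integrableOn_weight hα hu (by simpa using hm)
        have hi' : IntervalIntegrable (fun τ => (m + u * τ) ^ (-(α + 1))) volume 0 t :=
          (intervalIntegrable_iff_integrableOn_Ioc_of_le ht).2 (hi.mono_set Ioc_subset_Ioi_self)
        have h1 : ∫ τ in (0 : ℝ)..t, η τ ≤ ∫ τ in (0 : ℝ)..t, L * H * ((m + u * τ) ^ (-(α + 1)) + ε) := by
          refine intervalIntegral.integral_mono_on ht (hηc.intervalIntegrable _ _)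
            ((hi'.add intervalIntegrable_const).const_mul _) fun τ hτ => ?_
          rw [mul_assoc]
          exact hηH τ hτ.1
        refine h1.trans ?_
        rw [intervalIntegral.integral_const_mul, intervalIntegral.integral_add hi'
          intervalIntegrable_const, intervalIntegral.integral_const]
        have h2 : ∫ τ in (0 : ℝ)..t, (m + u * τ) ^ (-(α + 1)) ≤ m ^ (-α) / (α * u) := by
          rw [intervalIntegral.integral_of_le ht]
          refine (setIntegral_mono_set hi ?_ Ioc_subset_Ioi_self.eventuallyLE).trans ?_
          · filter_upwards [ae_restrict_mem measurableSet_Ioi] with τ hτ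
            exact Real.rpow_nonneg (hN τ (le_of_lt hτ)).le _
          · rw [integral_weight hα hu (by simpa using hm)]
            simp
        have h3 : 0 ≤ L * H := by positivity
        refine mul_le_mul_of_nonneg_left ?_ h3
        simp only [smul_eq_mul, sub_zero]
        linarith
      rintro ⟨t, ht⟩
      have ht' : (0 : ℝ) ≤ t := ht
      simp only
      set Q := m ^ (-α) / (α * u) with hQ
      have hQ0 : 0 ≤ Q := by positivity
      -- majorant of the integrand
      have hmaj : ∀ τ ∈ Ioi t, φ τ ≤ (a * δ₀ + S + a * (L * H * Q) + b * (L * H) * m ^ (-α))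
            * (m + u * τ) ^ (-(α + 1 + 1))
          + (a / u + b) * (L * H * ε) * (m + u * τ) ^ (-(α + 1)) := by
        intro τ hτ
        have hτ0 : 0 < τ := ht'.trans_lt hτ
        have hNτ := hN τ hτ0.le
        refine (hφ τ hτ0).trans ?_
        rw [show α + 2 = α + 1 + 1 by ring]
        set W1 := (m + u * τ) ^ (-(α + 1)) with hW1
        set W2 := (m + u * τ) ^ (-(α + 1 + 1)) with hW2
        have hW10 : 0 < W1 := by positivity
        have hW20 : 0 < W2 := by positivity
        have h1 : a * W2 * δ τ ≤ a * W2 * (δ₀ + L * H * (Q + ε * τ)) :=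
          mul_le_mul_of_nonneg_left (hδH τ hτ0.le) (by positivity)
        have h2 : b * W1 * η τ ≤ b * W1 * (L * (H * (W1 + ε))) :=
          mul_le_mul_of_nonneg_left (hηH τ hτ0.le) (by positivity)
        -- The unbounded term ετ in the position bound is absorbed by one power of the weight.
        have h3 : τ * W2 ≤ W1 / u := mul_weight_le hu hm hτ0.le
        have h4 : W1 * W1 ≤ m ^ (-α) * W2 := by
          have : W1 * W1 = (m + u * τ) ^ (-α) * W2 := by
            rw [hW1, hW2, ← Real.rpow_add hNτ, ← Real.rpow_add hNτ]
            ring_nf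
          rw [this]
          exact mul_le_mul_of_nonneg_right (hNm τ hτ0.le) hW20.le
        have h5 : a * (L * H * ε) * (τ * W2) ≤ a * (L * H * ε) * (W1 / u) := by gcongr
        have h6 : b * (L * H) * (W1 * W1) ≤ b * (L * H) * (m ^ (-α) * W2) := by gcongr
        calc _ ≤ a * W2 * (δ₀ + L * H * (Q + ε * τ)) + b * W1 * (L * (H * (W1 + ε))) + S * W2 := by
              gcongr
          _ = (a * δ₀ + S + a * (L * H * Q)) * W2 + a * (L * H * ε) * (τ * W2)
              + b * (L * H) * (W1 * W1) + b * (L * H * ε) * W1 := by ring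
          _ ≤ (a * δ₀ + S + a * (L * H * Q)) * W2 + a * (L * H * ε) * (W1 / u)
              + b * (L * H) * (m ^ (-α) * W2) + b * (L * H * ε) * W1 := by linarith
          _ = _ := by ring
      have i1 := integrableOn_weight (γ := α + 1) (by linarith) hu (hN t ht)
      have i2 := integrableOn_weight hα hu (hN t ht)
      have hint : ∫ τ in Ioi t, φ τ ≤ (a * δ₀ + S + a * (L * H * Q) + b * (L * H) * m ^ (-α))
            * ((m + u * t) ^ (-(α + 1)) / ((α + 1) * u))
          + (a / u + b) * (L * H * ε) * ((m + u * t) ^ (-α) / (α * u)) := by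
        rw [← integral_weight (by linarith) hu (hN t ht), ← integral_weight hα hu (hN t ht),
          ← integral_const_mul, ← integral_const_mul, ← integral_add (i1.const_mul _) (i2.const_mul _)]
        exact setIntegral_mono_on (hφi.mono_set (Ioi_subset_Ioi ht))
          ((i1.const_mul _).add (i2.const_mul _)) measurableSet_Ioi hmaj
      refine hint.trans ?_
      set W := (m + u * t) ^ (-(α + 1)) with hW
      have hW0 : 0 < W := Real.rpow_pos_of_pos (hN t ht) _
      set k := L * ((a / u + a / u + b) * m ^ (-α) / (α * u)) with hkd
      have e1 : (m + u * t) ^ (-α) / (α * u) ≤ Q := by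
        exact div_le_div_of_nonneg_right (hNm t ht) (by positivity)
      have hα1 : α * u ≤ (α + 1) * u := by gcongr; linarith
      have hα2 : u ≤ (α + 1) * u := by nlinarith
      have e2 : (a * (L * H * Q) + b * (L * H) * m ^ (-α)) / ((α + 1) * u) ≤ H * k := by
        have : H * k = a * (L * H * Q) / u + a * (L * H * Q) / u + b * (L * H) * m ^ (-α) / (α * u) := by
          rw [hkd, hQ]; field_simp
        rw [this, add_div]
        have p1 : a * (L * H * Q) / ((α + 1) * u) ≤ a * (L * H * Q) / u := by gcongr
        have p2 : b * (L * H) * m ^ (-α) / ((α + 1) * u) ≤ b * (L * H) * m ^ (-α) / (α * u) := by gcongr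
        have p3 : 0 ≤ a * (L * H * Q) / u := by positivity
        linarith
      have e3 : (a / u + b) * (L * H * ε) * Q ≤ H * k * ε := by
        have : H * k * ε = (a / u + b) * (L * H * ε) * Q + a / u * (L * H * ε) * Q := by
          rw [hkd, hQ]; ring
        rw [this]
        have : 0 ≤ a / u * (L * H * ε) * Q := by positivity
        linarith
      -- One pass through the three inequalities multiplies H by at most k, and k ≤ 1/2 by
      -- hypothesis.
      have hHk : H * k ≤ H / 2 := by nlinarith
      calc _ ≤ (a * δ₀ + S + a * (L * H * Q) + b * (L * H) * m ^ (-α)) * (W / ((α + 1) * u))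
            + (a / u + b) * (L * H * ε) * Q := by gcongr
        _ = S' * W + (a * (L * H * Q) + b * (L * H) * m ^ (-α)) / ((α + 1) * u) * W
            + (a / u + b) * (L * H * ε) * Q := by rw [hS']; ring
        _ ≤ S' * W + H / 2 * W + H / 2 * ε := by
            have q1 := mul_le_mul_of_nonneg_right (e2.trans hHk) hW0.le
            have q2 := e3.trans (mul_le_mul_of_nonneg_right hHk hε.le)
            linarith
        _ ≤ (S' + H / 2) * (W + ε) := by nlinarith
  have hlim : Tendsto (fun ε : ℝ => 2 * S' * ((m + u * t) ^ (-(α + 1)) + ε)) (𝓝[>] 0)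
      (𝓝 (2 * S' * ((m + u * t) ^ (-(α + 1)) + 0))) := by
    apply Tendsto.mono_left _ nhdsWithin_le_nhds
    exact (Continuous.tendsto (by fun_prop) 0)
  have := ge_of_tendsto hlim (eventually_mem_nhdsWithin.mono fun ε hε => key ε hε ⟨t, ht⟩)
  simpa using this

/-! ### Momentum equation integrated from infinity, and time reversal -/

theorem hasDerivAt_integral_Ioi {f : ℝ → E n} (hf : Continuous f) {t₀ : ℝ}
    (hi : IntegrableOn f (Ioi t₀)) (t : ℝ) : HasDerivAt (fun t => ∫ τ in Ioi t, f τ) (-f t) t := by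
  have hi' : ∀ s, IntegrableOn f (Ioi s) := fun s =>
    ((hf.integrableOn_Icc (a := s) (b := t₀)).union hi).mono_set fun τ hτ => by
      by_cases h : τ ≤ t₀
      · exact Or.inl ⟨le_of_lt hτ, h⟩
      · exact Or.inr (not_le.1 h)
  have e : (fun t => ∫ τ in Ioi t, f τ) = fun t => (∫ τ in Ioi 0, f τ) - ∫ τ in (0 : ℝ)..t, f τ := by
    ext1 s
    rw [← intervalIntegral.integral_interval_add_Ioi (hi' 0) (hi' s)]
    abel
  rw [e]
  exact (hf.integral_hasStrictDerivAt 0 t).hasDerivAt.const_sub _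

theorem tendsto_integral_Ioi {f : ℝ → E n} {t₀ : ℝ} (hi : IntegrableOn f (Ioi t₀)) :
    Tendsto (fun t => ∫ τ in Ioi t, f τ) atTop (𝓝 0) := by
  have h := intervalIntegral_tendsto_integral_Ioi t₀ hi tendsto_id
  have h2 : Tendsto (fun t => (∫ τ in Ioi t₀, f τ) - ∫ τ in t₀..t, f τ) atTop
      (𝓝 ((∫ τ in Ioi t₀, f τ) - ∫ τ in Ioi t₀, f τ)) := tendsto_const_nhds.sub h
  rw [sub_self] at h2
  refine h2.congr' ?_
  filter_upwards [eventually_ge_atTop t₀] with t ht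
  rw [← intervalIntegral.integral_interval_add_Ioi hi (hi.mono_set (Ioi_subset_Ioi ht))]
  abel

/-- Only the momentum is assumed differentiable; the velocity is continuous because it is g of the
momentum. -/
theorem IsNewtonSolution.continuous_deriv {c : ℝ} {H : E n → E n → E n} {x : ℝ → E n}
    (h : IsNewtonSolution c H x) : Continuous (deriv x) := by
  have h1 : Continuous fun s => gInv c (deriv x s) :=
    continuous_iff_continuousAt.2 fun t => (h.momentum t).continuousAt
  have h2 : deriv x = fun s => g c (gInv c (deriv x s)) := by
    ext1 s
    rw [g_gInv (h.speed_lt s)]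
  rw [h2]
  exact continuous_g.comp h1

theorem IsNewtonSolution.continuous_along {c : ℝ} {H : E n → E n → E n} {x : ℝ → E n}
    (h : IsNewtonSolution c H x) (hH : Continuous fun z : E n × E n => H z.1 z.2) :
    Continuous (along H x) :=
  hH.comp (h.differentiable.continuous.prodMk h.continuous_deriv)

theorem IsNewtonSolution.gInv_deriv_Ioi {c : ℝ} {H : E n → E n → E n} {x : ℝ → E n} {a : E n}
    (h : IsNewtonSolution c H x) (ha : ‖a‖ < c) (hx : Tendsto (deriv x) atTop (𝓝 a)) {t : ℝ}
    (hi : IntegrableOn (along H x) (Ioi t)) :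
    gInv c (deriv x t) = gInv c a - ∫ τ in Ioi t, along H x τ := by
  rw [integral_Ioi_of_hasDerivAt_of_tendsto' (fun τ _ => h.momentum τ) hi
    ((continuousAt_gInv ha).tendsto.comp hx)]
  abel

theorem IsNewtonSolution.deriv_Ioi {c : ℝ} {H : E n → E n → E n} {x : ℝ → E n} {a : E n}
    (h : IsNewtonSolution c H x) (ha : ‖a‖ < c) (hx : Tendsto (deriv x) atTop (𝓝 a)) {t : ℝ}
    (hi : IntegrableOn (along H x) (Ioi t)) :
    deriv x t = g c (gInv c a - ∫ τ in Ioi t, along H x τ) := by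
  rw [← h.gInv_deriv_Ioi ha hx hi, g_gInv (h.speed_lt t)]

theorem IsNewtonSolution.gInv_deriv_Iic {c : ℝ} {H : E n → E n → E n} {x : ℝ → E n} {a : E n}
    (h : IsNewtonSolution c H x) (ha : ‖a‖ < c) (hx : Tendsto (deriv x) atBot (𝓝 a)) {t : ℝ}
    (hi : IntegrableOn (along H x) (Iic t)) :
    gInv c (deriv x t) = gInv c a + ∫ τ in Iic t, along H x τ := by
  rw [integral_Iic_of_hasDerivAt_of_tendsto' (fun τ _ => h.momentum τ) hi
    ((continuousAt_gInv ha).tendsto.comp hx)]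
  abel

theorem IsNewtonSolution.deriv_Iic {c : ℝ} {H : E n → E n → E n} {x : ℝ → E n} {a : E n}
    (h : IsNewtonSolution c H x) (ha : ‖a‖ < c) (hx : Tendsto (deriv x) atBot (𝓝 a)) {t : ℝ}
    (hi : IntegrableOn (along H x) (Iic t)) :
    deriv x t = g c (gInv c a + ∫ τ in Iic t, along H x τ) := by
  rw [← h.gInv_deriv_Iic ha hx hi, g_gInv (h.speed_lt t)]

theorem deriv_comp_neg' (x : ℝ → E n) : deriv (fun t => x (-t)) = fun t => -deriv x (-t) := by
  ext1 t
  exact deriv_comp_neg x t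

theorem along_rev (H : E n → E n → E n) (x : ℝ → E n) (t : ℝ) :
    along (revForce H) (fun t => x (-t)) t = along H x (-t) := by
  simp [along, revForce, deriv_comp_neg]

theorem revForce_revForce (H : E n → E n → E n) : revForce (revForce H) = H := by
  ext1 y; ext1 w
  simp [revForce]

/-- Reversal changes the sign of velocity and momentum but not of the derivative of the momentum, so
the reversed force is the old one at the opposite velocity. -/
theorem IsNewtonSolution.rev {c : ℝ} {H : E n → E n → E n} {x : ℝ → E n}
    (h : IsNewtonSolution c H x) : IsNewtonSolution c (revForce H) fun t => x (-t) where
  differentiable := h.differentiable.comp differentiable_neg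
  speed_lt t := by
    rw [deriv_comp_neg', norm_neg]
    exact h.speed_lt _
  momentum t := by
    rw [along_rev]
    have h1 : HasDerivAt (fun s => gInv c (deriv x (-s))) (-along H x (-t)) t := by
      have := (h.momentum (-t)).scomp t (hasDerivAt_neg t)
      simpa [Function.comp_def] using this
    have h2 := h1.neg
    rw [neg_neg] at h2
    refine h2.congr_of_eventuallyEq (Eventually.of_forall fun s => ?_)
    simp [deriv_comp_neg, gInv_neg]

theorem IsFreeSolution.rev_atTop {c C : ℝ} {H : E n → E n → E n} {w y : E n} {z : ℝ → E n}
    (h : IsFreeSolution c H atTop w y C z) :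
    IsFreeSolution c (revForce H) atBot (-w) y C fun t => z (-t) where
  solution := h.solution.rev
  tendsto_deriv := by
    rw [deriv_comp_neg']
    exact (h.tendsto_deriv.comp tendsto_neg_atBot_atTop).neg
  initial := by simpa using h.initial
  deriv_sub_le t := by
    rw [deriv_comp_neg', show -deriv z (-t) - -w = -(deriv z (-t) - w) by abel, norm_neg]
    exact h.deriv_sub_le _

theorem IsFreeSolution.rev_atBot {c C : ℝ} {H : E n → E n → E n} {w y : E n} {z : ℝ → E n}
    (h : IsFreeSolution c H atBot w y C z) :
    IsFreeSolution c (revForce H) atTop (-w) y C fun t => z (-t) where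
  solution := h.solution.rev
  tendsto_deriv := by
    rw [deriv_comp_neg']
    exact (h.tendsto_deriv.comp tendsto_neg_atTop_atBot).neg
  initial := by simpa using h.initial
  deriv_sub_le t := by
    rw [deriv_comp_neg', show -deriv z (-t) - -w = -(deriv z (-t) - w) by abel, norm_neg]
    exact h.deriv_sub_le _

/-! ### Solutions with prescribed position and asymptotic velocity -/

/-- A force along a curve that escapes linearly is integrable. -/
theorem ForceBound.integrable {c A α b₁ b₂ m u : ℝ} {H : E n → E n → E n}
    (hH : ForceBound c A α b₁ b₂ H) (hα : 0 < α) (hm : 1 / 2 ≤ m) (hu : 0 < u)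
    {γ w : ℝ → E n} (hγ : Continuous γ) (hw : Continuous w) (hwc : ∀ t, ‖w t‖ ≤ c)
    (hγm : ∀ t, m + u * |t| ≤ 1 + ‖γ t‖) :
    Integrable (fun τ => H (γ τ) (w τ)) ∧
      ∫ τ, ‖H (γ τ) (w τ)‖ ≤ 4 * A * b₁ * (m ^ (-α) / (α * u)) := by
  have hm0 : 0 < m := by linarith
  have hcont : Continuous fun τ => H (γ τ) (w τ) := hH.cont.comp (hγ.prodMk hw)
  have hb : ∀ τ, ‖H (γ τ) (w τ)‖ ≤ 2 * A * b₁ * (m + u * |τ|) ^ (-(α + 1)) := fun τ =>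
    hH.bound _ _ _ (by have := abs_nonneg τ; nlinarith) (hwc τ) (hγm τ)
  have hi := (integrable_weight_abs hα hu hm0).const_mul (2 * A * b₁)
  have hi2 : Integrable (fun τ => H (γ τ) (w τ)) :=
    hi.mono' hcont.aestronglyMeasurable (Eventually.of_forall hb)
  refine ⟨hi2, (integral_mono hi2.norm hi hb).trans (le_of_eq ?_)⟩
  rw [integral_const_mul, integral_weight_abs hα hu hm0]
  ring

theorem norm_setIntegral_le_integral {f : ℝ → E n} (hf : Integrable f) (s : Set ℝ) :
    ‖∫ τ in s, f τ‖ ≤ ∫ τ, ‖f τ‖ :=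
  (norm_integral_le_integral_norm _).trans
    (setIntegral_le_integral hf.norm (Eventually.of_forall fun _ => norm_nonneg _))

theorem norm_integral_sub_smul_le {w : ℝ → E n} {a : E n} {C : ℝ} (hw : Continuous w)
    (h : ∀ t, ‖w t - a‖ ≤ C) (t : ℝ) : ‖(∫ τ in (0 : ℝ)..t, w τ) - t • a‖ ≤ C * |t| := by
  have e : (∫ τ in (0 : ℝ)..t, w τ) - t • a = ∫ τ in (0 : ℝ)..t, (w τ - a) := by
    rw [intervalIntegral.integral_sub (hw.intervalIntegrable _ _) intervalIntegrable_const]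
    simp
  rw [e]
  simpa using intervalIntegral.norm_integral_le_of_norm_le_const (a := 0) (b := t)
    (f := fun τ => w τ - a) fun τ _ => h τ

theorem segment_sub_smul_le {y y' a : E n} {C : ℝ} (hy : ‖y - a‖ ≤ C) (hy' : ‖y' - a‖ ≤ C)
    {ξ : E n} (hξ : ξ ∈ segment ℝ y y') : ‖ξ - a‖ ≤ C :=
  mem_closedBall_iff_norm.1 ((convex_closedBall a C).segment_subset
    (mem_closedBall_iff_norm.2 hy) (mem_closedBall_iff_norm.2 hy') hξ)

theorem eq_integral_deriv {z : ℝ → E n} (hd : Differentiable ℝ z) (hc : Continuous (deriv z))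
    (t : ℝ) : z t = z 0 + ∫ τ in (0 : ℝ)..t, deriv z τ := by
  rw [intervalIntegral.integral_eq_sub_of_hasDerivAt (fun τ _ => (hd τ).hasDerivAt)
    (hc.intervalIntegrable _ _)]
  abel

/-- Existence and uniqueness of the solution with prescribed initial position and prescribed
asymptotic velocity. -/
theorem ForceBound.exists_unique_free {c A α b₁ b₂ m u L C : ℝ} {H : E n → E n → E n}
    (hH : ForceBound c A α b₁ b₂ H) (hc : 0 < c) (hA : 0 ≤ A) (hα : 0 < α) (hb₁ : 0 ≤ b₁)
    (hb₂ : 0 ≤ b₂) (hm : 1 / 2 ≤ m) (hu : 0 < u) (hL : 0 ≤ L) (hC : 0 ≤ C) {P y : E n}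
    (htube : ∀ (t : ℝ) (ξ : E n), ‖ξ - (y + t • g c P)‖ ≤ C * |t| → m + u * |t| ≤ 1 + ‖ξ‖)
    (hLip : ∀ π π' : E n, ‖π - P‖ ≤ 4 * A * b₁ * (m ^ (-α) / (α * u)) →
      ‖π' - P‖ ≤ 4 * A * b₁ * (m ^ (-α) / (α * u)) → ‖g c π - g c π'‖ ≤ L * ‖π - π'‖)
    (hLC : L * (4 * A * b₁ * (m ^ (-α) / (α * u))) ≤ C)
    (hk : L * ((4 * A * b₂ / u + 2 * A * b₁ / c) * (m ^ (-α) / (α * u))) ≤ 1 / 2) :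
    ∃ z, IsFreeSolution c H atTop (g c P) y C z ∧
      (∀ z', IsFreeSolution c H atTop (g c P) y C z' → z' = z) := by
  have hm0 : 0 < m := by linarith
  set a := g c P with ha
  have hac : ‖a‖ < c := norm_g_lt hc P
  set R := 4 * A * b₁ * (m ^ (-α) / (α * u)) with hR
  have hR0 : 0 ≤ R := by positivity
  -- The unknown is the velocity. The first constraint keeps the position inside the escaping cone
  -- of `htube`, the second keeps the force bounds available; both are closed in the sup norm.
  let S : Set (BoundedContinuousFunction ℝ (E n)) := {w | ∀ t, ‖w t - a‖ ≤ C ∧ ‖w t‖ ≤ c}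
  have hSc : IsClosed S := by
    have : S = ⋂ t, ({w | ‖w t - a‖ ≤ C} ∩ {w | ‖w t‖ ≤ c}) := by
      ext w; simp [S]
    rw [this]
    have hev : ∀ t : ℝ, Continuous fun w : BoundedContinuousFunction ℝ (E n) => w t :=
      fun t => continuous_eval_const t
    exact isClosed_iInter fun t => (isClosed_le ((hev t).sub continuous_const).norm continuous_const).inter
      (isClosed_le (hev t).norm continuous_const)
  have : CompleteSpace S := hSc.completeSpace_coe
  have : Nonempty S := ⟨⟨BoundedContinuousFunction.const ℝ a, fun t => by simpa using ⟨hC, hac.le⟩⟩⟩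
  let pos : (ℝ → E n) → ℝ → E n := fun w t => y + ∫ τ in (0 : ℝ)..t, w τ
  have hposc : ∀ w : ℝ → E n, Continuous w → Continuous (pos w) := fun w hw =>
    continuous_const.add (intervalIntegral.continuous_primitive (fun _ _ => hw.intervalIntegrable _ _) 0)
  have hpos : ∀ w : ℝ → E n, Continuous w → (∀ t, ‖w t - a‖ ≤ C) → ∀ t, ‖pos w t - (y + t • a)‖ ≤ C * |t| := by
    intro w hw h t
    have := norm_integral_sub_smul_le hw h t
    rwa [show pos w t - (y + t • a) = (∫ τ in (0 : ℝ)..t, w τ) - t • a by simp only [pos]; abel]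
  let Fw : (ℝ → E n) → ℝ → E n := fun w τ => H (pos w τ) (w τ)
  have hint : ∀ w : ℝ → E n, Continuous w → (∀ t, ‖w t - a‖ ≤ C) → (∀ t, ‖w t‖ ≤ c) →
      Integrable (Fw w) ∧ ∫ τ, ‖Fw w τ‖ ≤ R := fun w hw h h' =>
    hH.integrable hα hm hu (hposc w hw) hw h' fun t => htube t _ (hpos w hw h t)
  have hFc : ∀ w : ℝ → E n, Continuous w → Continuous (Fw w) := fun w hw =>
    hH.cont.comp ((hposc w hw).prodMk hw)
  have hcontI : ∀ w : S, Continuous fun t => g c (P - ∫ τ in Ioi t, Fw w.1 τ) := fun w => by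
    have hw := hint w.1 w.1.continuous (fun t => (w.2 t).1) fun t => (w.2 t).2
    refine continuous_g.comp (continuous_const.sub ?_)
    exact continuous_iff_continuousAt.2 fun t =>
      (hasDerivAt_integral_Ioi (hFc _ w.1.continuous) (t₀ := 0) hw.1.integrableOn t).continuousAt
  have hball : ∀ w : S, ∀ t, ‖(P - ∫ τ in Ioi t, Fw w.1 τ) - P‖ ≤ R := fun w t => by
    have hw := hint w.1 w.1.continuous (fun t => (w.2 t).1) fun t => (w.2 t).2
    rw [show (P - ∫ τ in Ioi t, Fw w.1 τ) - P = -∫ τ in Ioi t, Fw w.1 τ by abel, norm_neg]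
    exact (norm_setIntegral_le_integral hw.1 _).trans hw.2
  -- The momentum is prescribed at +∞ and integrated backwards. `hLC` says that the total momentum
  -- transfer, times the Lipschitz constant of g, is at most C, so `S` is preserved.
  let Φ : S → S := fun w => ⟨BoundedContinuousFunction.ofNormedAddCommGroup
    (fun t => g c (P - ∫ τ in Ioi t, Fw w.1 τ)) (hcontI w) c (fun t => (norm_g_lt hc _).le), fun t => by
      refine ⟨?_, (norm_g_lt hc _).le⟩
      refine (hLip _ P (hball w t) (by simpa using hR0)).trans (le_trans ?_ hLC)
      exact mul_le_mul_of_nonneg_left (hball w t) hL⟩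
  have hΦ : ∀ w t, (Φ w).1 t = g c (P - ∫ τ in Ioi t, Fw w.1 τ) := fun w t => rfl
  have hcontr : ContractingWith (1 / 2) Φ := by
    refine ⟨by rw [← NNReal.coe_lt_coe]; norm_num, LipschitzWith.of_dist_le_mul fun w w' => ?_⟩
    rw [Subtype.dist_eq, Subtype.dist_eq, BoundedContinuousFunction.dist_le (by positivity)]
    intro t
    set D := dist w.1 w'.1 with hD
    have hD0 : 0 ≤ D := dist_nonneg
    have hDt : ∀ t, ‖w'.1 t - w.1 t‖ ≤ D := fun t => by
      rw [← dist_eq_norm, dist_comm]; exact BoundedContinuousFunction.dist_coe_le_dist t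
    have hw := hint w.1 w.1.continuous (fun t => (w.2 t).1) fun t => (w.2 t).2
    have hw' := hint w'.1 w'.1.continuous (fun t => (w'.2 t).1) fun t => (w'.2 t).2
    have hposD : ∀ t, ‖pos w'.1 t - pos w.1 t‖ ≤ D * |t| := fun t => by
      have := norm_integral_sub_smul_le (w := fun τ => w'.1 τ - w.1 τ) (a := 0) (C := D)
        (w'.1.continuous.sub w.1.continuous) (fun t => by simpa using hDt t) t
      rw [smul_zero, sub_zero, intervalIntegral.integral_sub (w'.1.continuous.intervalIntegrable _ _)
        (w.1.continuous.intervalIntegrable _ _)] at this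
      simpa [pos] using this
    have hdiff : ∀ τ, ‖Fw w'.1 τ - Fw w.1 τ‖
        ≤ D * (2 * A * b₂ / u + A * b₁ / c) * (m + u * |τ|) ^ (-(α + 1)) := by
      intro τ
      have hτ := abs_nonneg τ
      have hmu : 1 / 2 ≤ m + u * |τ| := by nlinarith
      have h1 := hH.lip (pos w.1 τ) (pos w'.1 τ) (w.1 τ) (w'.1 τ) (m + u * |τ|) hmu (w.2 τ).2 (w'.2 τ).2
        fun ξ hξ => htube τ ξ (segment_sub_smul_le (hpos _ w.1.continuous (fun t => (w.2 t).1) τ)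
          (hpos _ w'.1.continuous (fun t => (w'.2 t).1) τ) hξ)
      refine h1.trans ?_
      have h2 := mul_weight_le (p := α + 1) hu hm0 hτ
      rw [show α + 1 + 1 = α + 2 by ring] at h2
      have hW : 0 < (m + u * |τ|) ^ (-(α + 2)) := by positivity
      have hW' : 0 < (m + u * |τ|) ^ (-(α + 1)) := by positivity
      calc _ ≤ 2 * A * b₂ * (m + u * |τ|) ^ (-(α + 2)) * (D * |τ|)
            + A * b₁ / c * (m + u * |τ|) ^ (-(α + 1)) * D := by
            gcongr
            · exact hposD τ
            · exact hDt τ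
        _ = 2 * A * b₂ * D * (|τ| * (m + u * |τ|) ^ (-(α + 2)))
            + A * b₁ / c * (m + u * |τ|) ^ (-(α + 1)) * D := by ring
        _ ≤ 2 * A * b₂ * D * ((m + u * |τ|) ^ (-(α + 1)) / u)
            + A * b₁ / c * (m + u * |τ|) ^ (-(α + 1)) * D := by gcongr
        _ = _ := by ring
    have hdi := (hw'.1.sub hw.1)
    have hIle : ∫ τ, ‖Fw w'.1 τ - Fw w.1 τ‖
        ≤ D * ((4 * A * b₂ / u + 2 * A * b₁ / c) * (m ^ (-α) / (α * u))) := by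
      refine (integral_mono hdi.norm ((integrable_weight_abs hα hu hm0).const_mul _) hdiff).trans ?_
      rw [integral_const_mul, integral_weight_abs hα hu hm0]
      apply le_of_eq
      ring
    rw [hΦ, hΦ, dist_eq_norm]
    refine (hLip _ _ (hball w t) (hball w' t)).trans ?_
    rw [show (P - ∫ τ in Ioi t, Fw w.1 τ) - (P - ∫ τ in Ioi t, Fw w'.1 τ)
      = (∫ τ in Ioi t, Fw w'.1 τ) - ∫ τ in Ioi t, Fw w.1 τ by abel,
      ← integral_sub hw'.1.integrableOn hw.1.integrableOn]
    have h3 := (norm_setIntegral_le_integral hdi (Ioi t)).trans hIle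
    simp only [Pi.sub_apply] at h3
    calc _ ≤ L * (D * ((4 * A * b₂ / u + 2 * A * b₁ / c) * (m ^ (-α) / (α * u)))) := by gcongr
      _ = L * ((4 * A * b₂ / u + 2 * A * b₁ / c) * (m ^ (-α) / (α * u))) * D := by ring
      _ ≤ 1 / 2 * D := by gcongr
      _ = _ := by simp
  set w := ContractingWith.fixedPoint Φ hcontr with hwdef
  have hfix : Φ w = w := hcontr.fixedPoint_isFixedPt
  have hw := hint w.1 w.1.continuous (fun t => (w.2 t).1) fun t => (w.2 t).2
  have hz : ∀ t, HasDerivAt (pos w.1) (w.1 t) t := fun t =>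
    (w.1.continuous.integral_hasStrictDerivAt 0 t).hasDerivAt.const_add y
  have hdz : deriv (pos w.1) = w.1 := funext fun t => (hz t).deriv
  have hal : along H (pos w.1) = Fw w.1 := by
    ext1 t
    simp only [along, hdz, Fw]
  have hwt : ∀ t, w.1 t = g c (P - ∫ τ in Ioi t, Fw w.1 τ) := fun t => by
    rw [← hΦ, hfix]
  refine ⟨pos w.1, ⟨⟨fun t => (hz t).differentiableAt, fun t => ?_, fun t => ?_⟩, ?_, ?_, fun t => ?_⟩, ?_⟩
  · rw [hdz, hwt]; exact norm_g_lt hc _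
  · rw [hal, hdz]
    have : (fun s => gInv c (w.1 s)) = fun s => P - ∫ τ in Ioi s, Fw w.1 τ := by
      ext1 s; rw [hwt, gInv_g hc]
    rw [this]
    simpa using (hasDerivAt_integral_Ioi (hFc _ w.1.continuous) (t₀ := 0) hw.1.integrableOn t).const_sub P
  · rw [hdz]
    have h1 : Tendsto (fun t => P - ∫ τ in Ioi t, Fw w.1 τ) atTop (𝓝 (P - 0)) :=
      tendsto_const_nhds.sub (tendsto_integral_Ioi (t₀ := 0) hw.1.integrableOn)
    rw [sub_zero] at h1
    exact ((continuous_g.tendsto P).comp h1).congr fun t => (hwt t).symm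
  · simp [pos]
  · rw [hdz]; exact (w.2 t).1
  · intro z' hz'
    have hcd := hz'.solution.continuous_deriv
    have hp' : ∀ t, z' t = pos (deriv z') t := fun t => by
      rw [eq_integral_deriv hz'.solution.differentiable hcd t, hz'.initial]
    have hi' := hint (deriv z') hcd hz'.deriv_sub_le fun t => (hz'.solution.speed_lt t).le
    have hal' : along H z' = Fw (deriv z') := by
      ext1 t
      simp only [along, Fw, hp' t]
    -- Any competitor has its velocity in `S`, and by the momentum equation that velocity is again a
    -- fixed point of Φ.
    let w' : S := ⟨BoundedContinuousFunction.ofNormedAddCommGroup (deriv z') hcd c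
      fun t => (hz'.solution.speed_lt t).le, fun t => ⟨hz'.deriv_sub_le t, (hz'.solution.speed_lt t).le⟩⟩
    have hfix' : Φ w' = w' := by
      apply Subtype.ext
      ext1 t
      rw [hΦ]
      have := hz'.solution.deriv_Ioi hac hz'.tendsto_deriv (t := t) (by rw [hal']; exact hi'.1.integrableOn)
      rw [hal', ha, gInv_g hc] at this
      exact this.symm
    have hww : w' = w := hcontr.fixedPoint_unique hfix'
    ext1 t
    rw [hp' t]
    have : (w.1 : ℝ → E n) = deriv z' := by rw [← hww]; rfl
    rw [this]

theorem ForceBound.mono {c A γ b₁ b₂ b₁' b₂' : ℝ} {H : E n → E n → E n} (hc : 0 < c) (hA : 0 ≤ A)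
    (h : ForceBound c A γ b₁ b₂ H) (h₁ : b₁ ≤ b₁') (h₂ : b₂ ≤ b₂') :
    ForceBound c A γ b₁' b₂' H where
  cont := h.cont
  bound y w N hN hw hNy := by
    have hN0 : 0 < N := by linarith
    refine (h.bound y w N hN hw hNy).trans ?_
    gcongr
  lip y y' w w' N hN hw hw' hs := by
    have hN0 : 0 < N := by linarith
    refine (h.lip y y' w w' N hN hw hw' hs).trans ?_
    gcongr

/-! ### Standing data, smallness and tubes around the asymptotic line -/

/-- A long range force `Fl`, a short range force `Fs` and an asymptotic line `t ↦ x + t v` of large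
velocity. -/
structure Ctx (n : ℕ) where
  c : ℝ
  α : ℝ
  A : ℝ
  β₁ : ℝ
  β₂ : ℝ
  m : ℝ
  β : ℝ
  r : ℝ
  v : E n
  x : E n
  Fl : E n → E n → E n
  Fs : E n → E n → E n
  hc : 0 < c
  hα : 0 < α
  hα1 : α ≤ 1
  hA : 0 < A
  hβ₁ : 0 < β₁
  hβ₂ : 0 < β₂
  hβ₁m : β₁ ≤ m
  hβ₂m : β₂ ≤ m
  hmβ : m ≤ β
  hr : 0 < r
  hr2 : r < 1 / 2
  hv : ‖v‖ < c
  hvx : inner ℝ v x = 0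
  hd : r < ‖v‖ / (2 * √2)
  hl : ForceBound c A α β₁ β₂ Fl
  hs : ForceBound c A (α + 1) β₂ β Fs
  small : lor c v * (A * β * ((1 / 2 + ‖x‖ / √2) ^ (-α) / (α * (‖v‖ / (2 * √2) - r))))
    * ((1 + 1 / c) * (1 + 1 / (‖v‖ / (2 * √2) - r))) ≤ r / 100

namespace Ctx

variable (K : Ctx n)

/-- The time-reversed data. -/
@[simps] def rev : Ctx n where
  c := K.c
  α := K.α
  A := K.A
  β₁ := K.β₁
  β₂ := K.β₂
  m := K.m
  β := K.β
  r := K.r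
  v := -K.v
  x := K.x
  Fl := revForce K.Fl
  Fs := revForce K.Fs
  hc := K.hc
  hα := K.hα
  hα1 := K.hα1
  hA := K.hA
  hβ₁ := K.hβ₁
  hβ₂ := K.hβ₂
  hβ₁m := K.hβ₁m
  hβ₂m := K.hβ₂m
  hmβ := K.hmβ
  hr := K.hr
  hr2 := K.hr2
  hv := by rw [norm_neg]; exact K.hv
  hvx := by rw [inner_neg_left, K.hvx, neg_zero]
  hd := by rw [norm_neg]; exact K.hd
  hl := K.hl.rev
  hs := K.hs.rev
  small := by rw [norm_neg, lor_neg]; exact K.small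

/-- The full force. -/
def F : E n → E n → E n := K.Fl + K.Fs

noncomputable def s : ℝ := lor K.c K.v

noncomputable def p : E n := gInv K.c K.v

noncomputable def u : ℝ := ‖K.v‖ / (2 * √2)

noncomputable def d : ℝ := ‖K.v‖ / (2 * √2) - K.r

noncomputable def X : ℝ := ‖K.x‖ / √2

noncomputable def N₀ : ℝ := 1 / 2 + K.X

/-- The unit of momentum transfer. -/
noncomputable def M : ℝ := K.A * K.β * (K.N₀ ^ (-K.α) / (K.α * K.u))

theorem rev_s : K.rev.s = K.s := by simp [s, lor_neg]

theorem rev_p : K.rev.p = -K.p := by simp [p, gInv_neg]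

theorem rev_u : K.rev.u = K.u := by simp [u]

theorem rev_X : K.rev.X = K.X := by simp [X]

theorem rev_N₀ : K.rev.N₀ = K.N₀ := by simp [N₀, rev_X]

theorem rev_M : K.rev.M = K.M := by simp [M, rev_N₀, rev_u]

theorem m_pos : 0 < K.m := K.hβ₁.trans_le K.hβ₁m

theorem β_pos : 0 < K.β := K.m_pos.trans_le K.hmβ

theorem s_pos : 0 < K.s := lor_pos K.hv

theorem r_lt_u : K.r < K.u := K.hd

theorem u_pos : 0 < K.u := K.hr.trans K.hd

theorem d_pos : 0 < K.d := sub_pos.2 K.hd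

theorem d_eq : K.d = K.u - K.r := rfl

theorem d_le_u : K.d ≤ K.u := by rw [d_eq]; linarith [K.hr]

theorem X_nonneg : 0 ≤ K.X := by unfold X; positivity

theorem N₀_half : 1 / 2 ≤ K.N₀ := by unfold N₀; linarith [K.X_nonneg]

theorem N₀_pos : 0 < K.N₀ := by linarith [K.N₀_half]

theorem M_pos : 0 < K.M := by
  have := K.N₀_pos
  have := K.u_pos
  have := K.hα
  have := K.hA
  have := K.β_pos
  unfold M
  positivity

theorem norm_v_eq : ‖K.v‖ = 2 * √2 * K.u := by
  unfold u; field_simp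

theorem u_le_norm_v : K.u ≤ ‖K.v‖ := by
  have h : 1 ≤ √2 := Real.one_le_sqrt.2 (by norm_num)
  rw [norm_v_eq]
  nlinarith [K.u_pos]

theorem g_p : g K.c K.p = K.v := g_gInv K.hv

theorem glor_p : glor K.c K.p = K.s := glor_gInv K.hv

theorem small_d : K.s * (K.A * K.β * (K.N₀ ^ (-K.α) / (K.α * K.d))) * ((1 + 1 / K.c) * (1 + 1 / K.d))
    ≤ K.r / 100 := K.small

theorem small_u : K.s * K.M * ((1 + 1 / K.c) * (1 + 1 / K.u)) ≤ K.r / 100 := by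
  refine le_trans ?_ K.small_d
  have := K.N₀_pos
  have := K.d_pos
  have := K.u_pos
  have := K.hα
  have := K.hA
  have := K.β_pos
  have := K.s_pos
  have := K.hc
  have := K.d_le_u
  unfold M
  gcongr

theorem sM_le : K.s * K.M ≤ K.r / 100 ∧ K.s * K.M * (1 / K.u) ≤ K.r / 100
    ∧ K.s * K.M * (1 / K.c) ≤ K.r / 100 := by
  have h := K.small_u
  have h1 := mul_pos K.s_pos K.M_pos
  have hc : 0 < 1 / K.c := one_div_pos.2 K.hc
  have hu : 0 < 1 / K.u := one_div_pos.2 K.u_pos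
  have e : K.s * K.M * ((1 + 1 / K.c) * (1 + 1 / K.u)) = K.s * K.M + K.s * K.M * (1 / K.u)
    + K.s * K.M * (1 / K.c) + K.s * K.M * (1 / K.c * (1 / K.u)) := by ring
  have p1 := mul_pos h1 hc
  have p2 := mul_pos h1 hu
  have p3 := mul_pos h1 (mul_pos hc hu)
  refine ⟨by linarith, by linarith, by linarith⟩

/-- Here |p| = |v|/s, while sM ≤ r/100 and r < u ≤ |v|. The radius 24 is 12 + 12: an asymptotic
momentum within 12M of p, plus a transfer of at most 12M. -/
theorem M_le_norm_p : 24 * K.M ≤ ‖K.p‖ / 2 := by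
  have h : ‖K.p‖ = ‖K.v‖ / K.s := norm_gInv K.hv
  rw [h, le_div_iff₀ two_pos, le_div_iff₀ K.s_pos]
  have := K.sM_le.1
  linarith [K.u_le_norm_v, K.r_lt_u, K.hr]

theorem norm_g_sub_le {q q' : E n} (hq : ‖q - K.p‖ ≤ 24 * K.M) (hq' : ‖q' - K.p‖ ≤ 24 * K.M) :
    ‖g K.c q - g K.c q'‖ ≤ 2 * K.s * ‖q - q'‖ := by
  rw [← K.glor_p]
  exact RelNewton.norm_g_sub_le K.hc (hq.trans K.M_le_norm_p) (hq'.trans K.M_le_norm_p)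

theorem norm_g_sub_v_le {q : E n} (hq : ‖q - K.p‖ ≤ 24 * K.M) :
    ‖g K.c q - K.v‖ ≤ 2 * K.s * ‖q - K.p‖ := by
  rw [← K.g_p]
  exact K.norm_g_sub_le hq (by simpa using K.M_pos.le)

/-- Pythagoras: |x + tv|² = |x|² + t²|v|² ≥ (|x| + |t||v|)²/2, and |v|/√2 = 2u. -/
theorem line_le (t : ℝ) : K.X + 2 * K.u * |t| ≤ ‖K.x + t • K.v‖ := by
  have h2 : (0 : ℝ) < √2 := by positivity
  have hs : √2 ^ 2 = 2 := Real.sq_sqrt (by norm_num)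
  have e : K.X + 2 * K.u * |t| = (‖K.x‖ + |t| * ‖K.v‖) / √2 := by
    unfold X u; field_simp
  rw [e, div_le_iff₀ h2]
  apply le_of_sq_le_sq _ (by positivity)
  rw [mul_pow, hs, norm_add_sq_real, inner_smul_right, real_inner_comm, K.hvx, norm_smul,
    Real.norm_eq_abs]
  nlinarith [sq_nonneg (‖K.x‖ - |t| * ‖K.v‖)]

theorem tube_le {κ l t : ℝ} {ξ : E n} (h : ‖ξ - (K.x + t • K.v)‖ ≤ κ + l * |t|) :
    1 - κ + K.X + (2 * K.u - l) * |t| ≤ 1 + ‖ξ‖ := by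
  have h1 := K.line_le t
  have h2 := norm_sub_norm_le (K.x + t • K.v) ξ
  rw [norm_sub_rev] at h2
  nlinarith

theorem tube_half {t : ℝ} {ξ : E n} (h : ‖ξ - (K.x + t • K.v)‖ ≤ 1 / 2 + K.u * |t|) :
    K.N₀ + K.u * |t| ≤ 1 + ‖ξ‖ := by
  have := K.tube_le h
  unfold N₀
  linarith

theorem force_F : ForceBound K.c K.A K.α (3 * K.m) (3 * K.β) K.F :=
  ForceBound.add K.hc K.hA.le K.hl K.hs K.hβ₁m K.hβ₂m K.hβ₂.le (K.hβ₂m.trans K.hmβ) le_rfl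

theorem N₀_le {κ : ℝ} (hκ : κ ≤ 1 / 2) : K.N₀ ≤ 1 + K.X - κ := by
  unfold N₀; linarith

theorem transfer_le {κ b : ℝ} (hκ : κ ≤ 1 / 2) {j : ℝ} (hb0 : 0 ≤ b) (hb : b ≤ j * K.β) :
    K.A * b * ((1 + K.X - κ) ^ (-K.α) / (K.α * K.u)) ≤ j * K.M := by
  have hN := K.N₀_pos
  have hle := K.N₀_le hκ
  have h1 : (1 + K.X - κ) ^ (-K.α) ≤ K.N₀ ^ (-K.α) := rpow_weight_le hN hle K.hα.le
  have hA := K.hA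
  have hu := K.u_pos
  have hα := K.hα
  have h3 : 0 ≤ (1 + K.X - κ) := by linarith
  calc _ ≤ K.A * (j * K.β) * (K.N₀ ^ (-K.α) / (K.α * K.u)) := by
        have h2 : (1 + K.X - κ) ^ (-K.α) / (K.α * K.u) ≤ K.N₀ ^ (-K.α) / (K.α * K.u) :=
          div_le_div_of_nonneg_right h1 (by positivity)
        exact mul_le_mul (mul_le_mul_of_nonneg_left hb hA.le) h2 (by positivity)
          (mul_nonneg hA.le (hb0.trans hb))
    _ = _ := by unfold M; ring

/-- The bound on `‖z' - a‖` that singles out free solutions. -/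
noncomputable def C (b κ : ℝ) : ℝ := 2 * K.s * (4 * K.A * b * ((1 + K.X - κ) ^ (-K.α) / (K.α * K.u)))

theorem C_nonneg {b κ : ℝ} (hb : 0 ≤ b) (hκ : κ ≤ 1 / 2) : 0 ≤ K.C b κ := by
  have := K.hA
  have := K.u_pos
  have := K.hα
  have := K.s_pos
  have := K.N₀_le hκ
  have := K.N₀_pos
  have : 0 < 1 + K.X - κ := by linarith
  unfold C
  positivity

theorem C_le {b κ j : ℝ} (hκ : κ ≤ 1 / 2) (hb0 : 0 ≤ b) (hb : b ≤ j * K.β) :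
    K.C b κ ≤ 8 * j * (K.s * K.M) := by
  have h := K.transfer_le hκ hb0 hb
  unfold C
  have := mul_le_mul_of_nonneg_left h K.s_pos.le
  linarith

/-- A solution whose velocity tends to `a` at `+∞` and which stays close to the line `x + t v`. -/
structure Good (H : E n → E n → E n) (a : E n) (z : ℝ → E n) : Prop where
  sol : IsNewtonSolution K.c H z
  tend : Tendsto (deriv z) atTop (𝓝 a)
  tube : ∀ t, ‖z t - (K.x + t • K.v)‖ ≤ 1 / 2 + K.u * |t|
  mom : ∀ t, ‖gInv K.c (deriv z t) - K.p‖ ≤ 16 * K.M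
  int : Integrable (along H z)

/-- The velocity deviates from v by at most C + |g(P) - v| ≤ 24sM + 24sM, which is less than u/2;
hence the opening u of the tube. -/
theorem tube_of_free {P y : E n} {b κ : ℝ} {H : E n → E n → E n} {z : ℝ → E n}
    (hb0 : 0 ≤ b) (hb : b ≤ 3 * K.β) (hκ : κ ≤ 1 / 2)
    (hP : ‖P - K.p‖ ≤ 12 * K.M) (hy : ‖y - K.x‖ ≤ κ)
    (hz : IsFreeSolution K.c H atTop (g K.c P) y (K.C b κ) z) (t : ℝ) :
    ‖z t - (K.x + t • K.v)‖ ≤ κ + K.u * |t| := by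
  have h1 := norm_integral_sub_smul_le hz.solution.continuous_deriv hz.deriv_sub_le t
  have h2 := K.norm_g_sub_v_le (hP.trans (by linarith [K.M_pos]))
  have h3 : ‖g K.c P - K.v‖ ≤ 24 * (K.s * K.M) := by
    have := mul_le_mul_of_nonneg_left hP K.s_pos.le
    linarith
  have h4 := K.C_le hκ hb0 hb
  have h5 := K.sM_le.1
  have h6 : K.C b κ + 24 * (K.s * K.M) ≤ K.u := by linarith [K.r_lt_u, K.hr]
  have e : z t - (K.x + t • K.v) = (y - K.x) + ((∫ τ in (0 : ℝ)..t, deriv z τ) - t • g K.c P)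
      + t • (g K.c P - K.v) := by
    rw [eq_integral_deriv hz.solution.differentiable hz.solution.continuous_deriv t, hz.initial]
    module
  rw [e]
  have h7 : ‖t • (g K.c P - K.v)‖ ≤ 24 * (K.s * K.M) * |t| := by
    rw [norm_smul, Real.norm_eq_abs, mul_comm]
    gcongr
  refine (norm_add₃_le).trans ?_
  nlinarith [abs_nonneg t]

/-- Used with b = `β₁` for the long range force and with b = 3`m` for the full force. `C` is exactly
the Lipschitz constant 2s times the maximal momentum transfer, so the class of competitors is mapped
to itself without slack. -/
theorem exists_unique_free {P y : E n} {b b' κ : ℝ} {H : E n → E n → E n}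
    (hH : ForceBound K.c K.A K.α b b' H) (hb0 : 0 ≤ b) (hb : b ≤ 3 * K.β) (hb0' : 0 ≤ b')
    (hb' : b' ≤ 3 * K.β) (hκ : κ ≤ 1 / 2) (hP : ‖P - K.p‖ ≤ 12 * K.M) (hy : ‖y - K.x‖ ≤ κ) :
    ∃ z, IsFreeSolution K.c H atTop (g K.c P) y (K.C b κ) z ∧
      (∀ z', IsFreeSolution K.c H atTop (g K.c P) y (K.C b κ) z' → z' = z) := by
  have hMp := K.M_pos
  have hm := K.N₀_le hκ
  have hm0 : 0 < 1 + K.X - κ := K.N₀_pos.trans_le hm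
  have hu := K.u_pos
  have hα := K.hα
  have hR := K.transfer_le hκ hb0 hb
  have hR' := K.transfer_le hκ hb0' hb'
  have hsM := K.sM_le
  refine hH.exists_unique_free (m := 1 + K.X - κ) (u := K.u) (L := 2 * K.s) K.hc K.hA.le K.hα hb0 hb0'
    (K.N₀_half.trans hm) K.u_pos (by linarith [K.s_pos]) (K.C_nonneg hb0 hκ) ?_ ?_ (le_of_eq rfl) ?_
  · intro t ξ hξ
    have h2 := K.norm_g_sub_v_le (hP.trans (by linarith))
    have h3 : ‖g K.c P - K.v‖ ≤ 24 * (K.s * K.M) := by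
      have := mul_le_mul_of_nonneg_left hP K.s_pos.le
      linarith
    have h4 := K.C_le hκ hb0 hb
    have h6 : K.C b κ + 24 * (K.s * K.M) ≤ K.u := by linarith [K.r_lt_u, K.hr, hsM.1]
    have e : ξ - (K.x + t • K.v) = (y - K.x) + (ξ - (y + t • g K.c P)) + t • (g K.c P - K.v) := by
      module
    have h7 : ‖t • (g K.c P - K.v)‖ ≤ 24 * (K.s * K.M) * |t| := by
      rw [norm_smul, Real.norm_eq_abs, mul_comm]
      gcongr
    have h8 : ‖ξ - (K.x + t • K.v)‖ ≤ κ + K.u * |t| := by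
      rw [e]
      refine (norm_add₃_le).trans ?_
      nlinarith [abs_nonneg t]
    have := K.tube_le h8
    linarith
  · intro π π' h h'
    have hb24 : ∀ q, ‖q - P‖ ≤ 4 * K.A * b * ((1 + K.X - κ) ^ (-K.α) / (K.α * K.u)) →
        ‖q - K.p‖ ≤ 24 * K.M := fun q hq => by
      rw [← sub_add_sub_cancel q P K.p]
      refine (norm_add_le _ _).trans ?_
      linarith
    exact K.norm_g_sub_le (hb24 π h) (hb24 π' h')
  · have h1 : K.s * (K.A * b' * ((1 + K.X - κ) ^ (-K.α) / (K.α * K.u))) * (1 / K.u)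
        ≤ 3 * (K.s * K.M * (1 / K.u)) := by
      have := mul_le_mul_of_nonneg_right (mul_le_mul_of_nonneg_left hR' K.s_pos.le)
        (one_div_pos.2 hu).le
      linarith
    have h2 : K.s * (K.A * b * ((1 + K.X - κ) ^ (-K.α) / (K.α * K.u))) * (1 / K.c)
        ≤ 3 * (K.s * K.M * (1 / K.c)) := by
      have := mul_le_mul_of_nonneg_right (mul_le_mul_of_nonneg_left hR K.s_pos.le)
        (one_div_pos.2 K.hc).le
      linarith
    -- The contraction factor is at most 8·3 + 4·3 = 36 hundredths of r, and r < 1/2.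
    have e : 2 * K.s * ((4 * K.A * b' / K.u + 2 * K.A * b / K.c) * ((1 + K.X - κ) ^ (-K.α) / (K.α * K.u)))
        = 8 * (K.s * (K.A * b' * ((1 + K.X - κ) ^ (-K.α) / (K.α * K.u))) * (1 / K.u))
        + 4 * (K.s * (K.A * b * ((1 + K.X - κ) ^ (-K.α) / (K.α * K.u))) * (1 / K.c)) := by
      ring
    rw [e]
    linarith [K.hr2]

theorem integrable_of_tube {b b' : ℝ} {H : E n → E n → E n} (hH : ForceBound K.c K.A K.α b b' H)
    {z : ℝ → E n} {κ : ℝ} (hκ : κ ≤ 1 / 2) (hz : IsNewtonSolution K.c H z)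
    (h : ∀ t, ‖z t - (K.x + t • K.v)‖ ≤ κ + K.u * |t|) :
    Integrable (along H z) ∧
      ∫ τ, ‖along H z τ‖ ≤ 4 * K.A * b * ((1 + K.X - κ) ^ (-K.α) / (K.α * K.u)) :=
  hH.integrable K.hα (K.N₀_half.trans (K.N₀_le hκ)) K.u_pos hz.differentiable.continuous
    hz.continuous_deriv (fun t => (hz.speed_lt t).le) fun t => by
      have := K.tube_le (h t)
      linarith

theorem mom_of_free {P y : E n} {b b' κ : ℝ} {H : E n → E n → E n} {z : ℝ → E n}
    (hH : ForceBound K.c K.A K.α b b' H) (hb0 : 0 ≤ b) (hb : b ≤ 3 * K.β) (hκ : κ ≤ 1 / 2)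
    (hP : ‖P - K.p‖ ≤ 12 * K.M) (hy : ‖y - K.x‖ ≤ κ)
    (hz : IsFreeSolution K.c H atTop (g K.c P) y (K.C b κ) z) (t : ℝ) :
    ‖gInv K.c (deriv z t) - P‖ ≤ 4 * K.A * b * ((1 + K.X - κ) ^ (-K.α) / (K.α * K.u)) := by
  have hi := K.integrable_of_tube hH hκ hz.solution (K.tube_of_free hb0 hb hκ hP hy hz)
  rw [hz.solution.gInv_deriv_Ioi (norm_g_lt K.hc P) hz.tendsto_deriv hi.1.integrableOn, gInv_g K.hc,
    show (P - ∫ τ in Ioi t, along H z τ) - P = -∫ τ in Ioi t, along H z τ by abel, norm_neg]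
  exact (norm_setIntegral_le_integral hi.1 _).trans hi.2

/-- The error of the asymptotic momentum and the transfer 4jM add up to at most 16M: j = 1 for the
long range force with P within 12M of p, and j = 3 for the full force with P = p. -/
theorem good_of_free {P y : E n} {b b' κ : ℝ} {H : E n → E n → E n} {z : ℝ → E n}
    (hH : ForceBound K.c K.A K.α b b' H) (hb0 : 0 ≤ b) (hκ : κ ≤ 1 / 2) {j : ℝ} (hj : j ≤ 3)
    (hb : b ≤ j * K.β) (hP : ‖P - K.p‖ ≤ 12 * K.M) (hP' : ‖P - K.p‖ ≤ (16 - 4 * j) * K.M)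
    (hy : ‖y - K.x‖ ≤ κ)
    (hz : IsFreeSolution K.c H atTop (g K.c P) y (K.C b κ) z) : K.Good H (g K.c P) z := by
  have hb3 : b ≤ 3 * K.β := hb.trans (by nlinarith [K.β_pos])
  have ht := K.tube_of_free hb0 hb3 hκ hP hy hz
  refine ⟨hz.solution, hz.tendsto_deriv, fun t => (ht t).trans (by linarith), fun t => ?_,
    (K.integrable_of_tube hH hκ hz.solution ht).1⟩
  rw [← sub_add_sub_cancel _ P K.p]
  refine (norm_add_le _ _).trans ?_
  have h1 := K.mom_of_free hH hb0 hb3 hκ hP hy hz t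
  have h2 := K.transfer_le hκ hb0 hb
  linarith

/-! ### Comparison of solutions with the same asymptotic velocity -/

/-- Comparison, on `t ≥ 0`, of two solutions with the same asymptotic velocity. -/
theorem Good.compare {H H' : E n → E n → E n} {w : E n} {Y Z : ℝ → E n} {a b S δ₀ : ℝ} {K : Ctx n}
    (hw : ‖w‖ < K.c) (hY : K.Good H w Y) (hZ : K.Good H' w Z) (ha0 : 0 ≤ a) (hb0 : 0 ≤ b)
    (hS : 0 ≤ S) (ha : a ≤ 6 * K.A * K.β) (hb : b ≤ 3 * K.A * K.β / K.c) (hδ : ‖Y 0 - Z 0‖ ≤ δ₀)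
    (hdiff : ∀ t, 0 < t → ‖along H Y t - along H' Z t‖
      ≤ a * (K.N₀ + K.u * t) ^ (-(K.α + 2)) * ‖Y t - Z t‖
        + b * (K.N₀ + K.u * t) ^ (-(K.α + 1)) * ‖deriv Y t - deriv Z t‖
        + S * (K.N₀ + K.u * t) ^ (-(K.α + 2))) :
    ∀ t, 0 ≤ t → ∫ τ in Ioi t, ‖along H Y τ - along H' Z τ‖
        ≤ 2 * ((a * δ₀ + S) / ((K.α + 1) * K.u)) * (K.N₀ + K.u * t) ^ (-(K.α + 1)) ∧
      ‖deriv Y t - deriv Z t‖ ≤ 2 * K.s * (∫ τ in Ioi t, ‖along H Y τ - along H' Z τ‖) := by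
  have hη : ∀ t, ‖deriv Y t - deriv Z t‖ ≤ 2 * K.s * ∫ τ in Ioi t, ‖along H Y τ - along H' Z τ‖ := by
    intro t
    have h1 : ‖deriv Y t - deriv Z t‖ ≤ 2 * K.s * ‖gInv K.c (deriv Y t) - gInv K.c (deriv Z t)‖ := by
      have := K.norm_g_sub_le ((hY.mom t).trans (by linarith [K.M_pos]))
        ((hZ.mom t).trans (by linarith [K.M_pos]))
      rwa [g_gInv (hY.sol.speed_lt t), g_gInv (hZ.sol.speed_lt t)] at this
    refine h1.trans (mul_le_mul_of_nonneg_left ?_ (by linarith [K.s_pos]))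
    rw [hY.sol.gInv_deriv_Ioi hw hY.tend hY.int.integrableOn,
      hZ.sol.gInv_deriv_Ioi hw hZ.tend hZ.int.integrableOn, sub_sub_sub_cancel_left, norm_sub_rev,
      ← integral_sub hY.int.integrableOn hZ.int.integrableOn]
    exact norm_integral_le_integral_norm _
  have hcd : Continuous fun t => ‖deriv Y t - deriv Z t‖ :=
    (hY.sol.continuous_deriv.sub hZ.sol.continuous_deriv).norm
  intro t ht
  refine ⟨?_, hη t⟩
  refine tail_bound (L := 2 * K.s) (η := fun t => ‖deriv Y t - deriv Z t‖)
    (δ := fun t => ‖Y t - Z t‖) (b := b) K.hα K.N₀_pos K.u_pos ha0 hb0 hS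
    ((norm_nonneg _).trans hδ) (by linarith [K.s_pos]) hcd (hY.int.sub hZ.int).norm.integrableOn
    (fun t => norm_nonneg _) ?_ hdiff (fun t _ => hη t) ?_ t ht
  · intro t ht
    have e : Y t - Z t = (Y 0 - Z 0) + ∫ τ in (0 : ℝ)..t, (deriv Y τ - deriv Z τ) := by
      rw [eq_integral_deriv hY.sol.differentiable hY.sol.continuous_deriv t,
        eq_integral_deriv hZ.sol.differentiable hZ.sol.continuous_deriv t,
        intervalIntegral.integral_sub (hY.sol.continuous_deriv.intervalIntegrable _ _)
          (hZ.sol.continuous_deriv.intervalIntegrable _ _)]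
      abel
    rw [e]
    refine (norm_add_le _ _).trans (add_le_add hδ ?_)
    exact intervalIntegral.norm_integral_le_integral_norm ht
  · have hc := K.hc
    have hu := K.u_pos
    have hN := K.N₀_pos
    have hα := K.hα
    have hsM := K.sM_le
    have hs := K.s_pos
    have h1 : a / K.u + a / K.u + b
        ≤ 6 * K.A * K.β / K.u + 6 * K.A * K.β / K.u + 3 * K.A * K.β / K.c := by gcongr
    have h2 : 2 * K.s * ((a / K.u + a / K.u + b) * K.N₀ ^ (-K.α) / (K.α * K.u))
        ≤ 2 * K.s * ((6 * K.A * K.β / K.u + 6 * K.A * K.β / K.u + 3 * K.A * K.β / K.c)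
          * K.N₀ ^ (-K.α) / (K.α * K.u)) := by gcongr
    -- The smallness required by `tail_bound`: at most 24 + 6 hundredths of r, below 1/2.
    have e : 2 * K.s * ((6 * K.A * K.β / K.u + 6 * K.A * K.β / K.u + 3 * K.A * K.β / K.c)
          * K.N₀ ^ (-K.α) / (K.α * K.u))
        = 24 * (K.s * K.M * (1 / K.u)) + 6 * (K.s * K.M * (1 / K.c)) := by
      unfold M; ring
    rw [e] at h2
    linarith [K.hr2]

theorem Good.lip {H H' : E n → E n → E n} {w w' : E n} {Y Z : ℝ → E n} {K : Ctx n} {b b' : ℝ}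
    {H₀ : E n → E n → E n} (hH₀ : ForceBound K.c K.A K.α b b' H₀)
    (hY : K.Good H w Y) (hZ : K.Good H' w' Z) (t : ℝ) :
    ‖along H₀ Y t - along H₀ Z t‖
      ≤ 2 * K.A * b' * (K.N₀ + K.u * |t|) ^ (-(K.α + 2)) * ‖Y t - Z t‖
        + K.A * b / K.c * (K.N₀ + K.u * |t|) ^ (-(K.α + 1)) * ‖deriv Y t - deriv Z t‖ :=
  hH₀.lip _ _ _ _ _ (by nlinarith [K.N₀_half, abs_nonneg t, K.u_pos]) (hZ.sol.speed_lt t).le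
    (hY.sol.speed_lt t).le fun _ hξ =>
      K.tube_half (segment_sub_smul_le (hZ.tube t) (hY.tube t) hξ)

/-- There is no source term: the initial offset alone drives the difference, so the bound is linear
in `δ₀`. This gives the contraction properties of Γ and 𝒢. -/
theorem Good.compare_same {H : E n → E n → E n} {w : E n} {Y Z : ℝ → E n} {K : Ctx n} {b b' δ₀ : ℝ}
    (hH : ForceBound K.c K.A K.α b b' H) (hb0 : 0 ≤ b) (hb0' : 0 ≤ b') (hb : b ≤ 3 * K.β)
    (hb' : b' ≤ 3 * K.β) (hw : ‖w‖ < K.c) (hY : K.Good H w Y) (hZ : K.Good H w Z)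
    (hδ : ‖Y 0 - Z 0‖ ≤ δ₀) (t : ℝ) (ht : 0 ≤ t) :
    ‖deriv Y t - deriv Z t‖ ≤ 2 * K.s * (4 * K.A * b' * δ₀ / ((K.α + 1) * K.u))
      * (K.N₀ + K.u * t) ^ (-(K.α + 1)) := by
  have hc := K.hc
  have hA := K.hA
  have h := Good.compare hw hY hZ (a := 2 * K.A * b') (b := K.A * b / K.c) (S := 0)
    (by positivity) (by positivity) le_rfl (by nlinarith)
    (div_le_div_of_nonneg_right (by nlinarith) hc.le) hδ (fun t ht => by
      have := hY.lip hH hZ t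
      rw [abs_of_pos ht] at this
      linarith) t ht
  refine h.2.trans ?_
  refine (mul_le_mul_of_nonneg_left h.1 (by linarith [K.s_pos])).trans (le_of_eq ?_)
  ring

/-- The constant in the decay of `‖Y' - Z'‖` for a solution `Y` for `F` and a solution `Z` for `Fl`. -/
noncomputable def Φ (δ₀ : ℝ) : ℝ := 4 * K.A * K.m * (δ₀ + 1) / ((K.α + 1) * K.u)

theorem Φ_pos {δ₀ : ℝ} (h : 0 ≤ δ₀) : 0 < K.Φ δ₀ := by
  have := K.hA
  have := K.m_pos
  have := K.hα
  have := K.u_pos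
  unfold Φ
  positivity

/-- The source is the short range force along Y. It decays like N^(-α-2), the rate of the
derivatives of the long range force. -/
theorem Good.compare_short {w : E n} {Y Z : ℝ → E n} {K : Ctx n} {δ₀ : ℝ} (hw : ‖w‖ < K.c)
    (hY : K.Good K.F w Y) (hZ : K.Good K.Fl w Z) (hδ : ‖Y 0 - Z 0‖ ≤ δ₀) (t : ℝ) (ht : 0 ≤ t) :
    ∫ τ in Ioi t, ‖along K.F Y τ - along K.Fl Z τ‖ ≤ K.Φ δ₀ * (K.N₀ + K.u * t) ^ (-(K.α + 1)) ∧
      ‖deriv Y t - deriv Z t‖ ≤ 2 * K.s * K.Φ δ₀ * (K.N₀ + K.u * t) ^ (-(K.α + 1)) := by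
  have hc := K.hc
  have hA := K.hA
  have hm := K.m_pos
  have hβ := K.β_pos
  have hmβ := K.hmβ
  have h := Good.compare hw hY hZ (a := 2 * K.A * K.m)
    (b := K.A * K.m / K.c) (S := 2 * K.A * K.m)
    (by positivity) (by positivity) (by positivity) (by nlinarith)
    (by gcongr; nlinarith) hδ (fun t ht => by
      have h1 := hY.lip (ForceBound.mono K.hc K.hA.le K.hl K.hβ₁m K.hβ₂m) hZ t
      have h2 := (ForceBound.mono K.hc K.hA.le K.hs K.hβ₂m le_rfl).bound (Y t) (deriv Y t)
        (K.N₀ + K.u * |t|) (by nlinarith [K.N₀_half, abs_nonneg t, K.u_pos])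
        (hY.sol.speed_lt t).le (K.tube_half (hY.tube t))
      rw [abs_of_pos ht] at h1 h2
      rw [show K.α + 1 + 1 = K.α + 2 by ring] at h2
      have e : along K.F Y t - along K.Fl Z t
          = (along K.Fl Y t - along K.Fl Z t) + K.Fs (Y t) (deriv Y t) := by
        simp only [along, F, Pi.add_apply]
        abel
      rw [e]
      exact (norm_add_le _ _).trans (add_le_add h1 h2)) t ht
  have e : 2 * ((2 * K.A * K.m * δ₀ + 2 * K.A * K.m) / ((K.α + 1) * K.u)) = K.Φ δ₀ := by
    unfold Φ; ring
  rw [e] at h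
  refine ⟨h.1, h.2.trans ?_⟩
  refine (mul_le_mul_of_nonneg_left h.1 (by linarith [K.s_pos])).trans (le_of_eq ?_)
  ring

theorem weight_pos {t : ℝ} (ht : 0 ≤ t) : 0 < K.N₀ + K.u * t := by
  have := K.N₀_pos
  have := K.u_pos
  positivity

theorem integrableOn_of_decay {f : ℝ → E n} (hf : Continuous f) {B : ℝ}
    (h : ∀ t, 0 ≤ t → ‖f t‖ ≤ B * (K.N₀ + K.u * t) ^ (-(K.α + 1))) (t : ℝ) :
    IntegrableOn f (Ioi t) := by
  have h0 : IntegrableOn f (Ioi 0) := by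
    refine ((integrableOn_weight K.hα K.u_pos (t := 0) (K.weight_pos le_rfl)).const_mul B).mono'
      hf.aestronglyMeasurable ?_
    filter_upwards [ae_restrict_mem measurableSet_Ioi] with τ hτ
    exact h τ (le_of_lt hτ)
  exact ((hf.integrableOn_Icc (a := t) (b := 0)).union h0).mono_set fun τ hτ => by
    by_cases h : τ ≤ 0
    · exact Or.inl ⟨le_of_lt hτ, h⟩
    · exact Or.inr (not_le.1 h)

theorem norm_integral_le_of_decay {f : ℝ → E n} {B : ℝ}
    (h : ∀ t, 0 ≤ t → ‖f t‖ ≤ B * (K.N₀ + K.u * t) ^ (-(K.α + 1))) {t : ℝ} (ht : 0 ≤ t) :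
    ‖∫ τ in Ioi t, f τ‖ ≤ B * ((K.N₀ + K.u * t) ^ (-K.α) / (K.α * K.u)) := by
  rw [← integral_weight K.hα K.u_pos (K.weight_pos ht), ← integral_const_mul]
  refine norm_integral_le_of_norm_le
    ((integrableOn_weight K.hα K.u_pos (K.weight_pos ht)).const_mul B) ?_
  filter_upwards [ae_restrict_mem measurableSet_Ioi] with τ hτ
  exact h τ (ht.trans (le_of_lt hτ))

end Ctx

/-! ### Full solutions asymptotic to a given free solution -/

theorem exists_unique_fixed {f : E n → E n} {R k : ℝ} (hR : 0 ≤ R) (hk0 : 0 ≤ k) (hk : k < 1)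
    (hf : MapsTo f (Metric.closedBall 0 R) (Metric.closedBall 0 R))
    (hL : ∀ q ∈ Metric.closedBall (0 : E n) R, ∀ q' ∈ Metric.closedBall (0 : E n) R,
      ‖f q - f q'‖ ≤ k * ‖q - q'‖) :
    ∃ b ∈ Metric.closedBall (0 : E n) R, f b = b ∧
      ∀ q ∈ Metric.closedBall (0 : E n) R, f q = q → q = b := by
  have : CompleteSpace (Metric.closedBall (0 : E n) R) := Metric.isClosed_closedBall.completeSpace_coe
  have : Nonempty (Metric.closedBall (0 : E n) R) := ⟨⟨0, by simpa using hR⟩⟩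
  have hc : ContractingWith ⟨k, hk0⟩ (hf.restrict f _ _) := by
    refine ⟨hk, LipschitzWith.of_dist_le_mul fun q q' => ?_⟩
    rw [Subtype.dist_eq, Subtype.dist_eq, dist_eq_norm, dist_eq_norm]
    exact hL q q.2 q' q'.2
  set b := ContractingWith.fixedPoint _ hc with hb
  have hfix : hf.restrict f _ _ b = b := hc.fixedPoint_isFixedPt
  refine ⟨b, b.2, congrArg Subtype.val hfix, fun q hq h => ?_⟩
  exact congrArg Subtype.val (hc.fixedPoint_unique (x := ⟨q, hq⟩) (Subtype.ext h))

theorem tendsto_sub_of_integrableOn {Y Z : ℝ → E n} (hY : Differentiable ℝ Y)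
    (hZ : Differentiable ℝ Z) {t : ℝ}
    (hi : IntegrableOn (fun τ => deriv Y τ - deriv Z τ) (Ioi t)) :
    Tendsto (fun τ => Y τ - Z τ) atTop
      (𝓝 (Y t - Z t + ∫ τ in Ioi t, (deriv Y τ - deriv Z τ))) := by
  have hd : ∀ τ ∈ Ioi t, HasDerivAt (fun τ => Y τ - Z τ) (deriv Y τ - deriv Z τ) τ := fun τ _ =>
    (hY τ).hasDerivAt.sub (hZ τ).hasDerivAt
  have hlim := tendsto_limUnder_of_hasDerivAt_of_integrableOn_Ioi hd hi
  have := integral_Ioi_of_hasDerivAt_of_tendsto' (a := t)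
    (fun τ _ => (hY τ).hasDerivAt.sub (hZ τ).hasDerivAt) hi hlim
  rw [this]
  simpa using hlim

theorem sub_eq_neg_integral {Y Z : ℝ → E n} (hY : Differentiable ℝ Y)
    (hZ : Differentiable ℝ Z) {t : ℝ}
    (hi : IntegrableOn (fun τ => deriv Y τ - deriv Z τ) (Ioi t))
    (h0 : Tendsto (fun τ => Y τ - Z τ) atTop (𝓝 0)) :
    Y t - Z t = -∫ τ in Ioi t, (deriv Y τ - deriv Z τ) :=
  eq_neg_of_add_eq_zero_left (tendsto_nhds_unique (tendsto_sub_of_integrableOn hY hZ hi) h0)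

namespace Ctx

variable {K : Ctx n}

theorem decay_mul_le {b j : ℝ} (hb0 : 0 ≤ b) (hb : b ≤ j * K.β) :
    K.s * (K.A * b / ((K.α + 1) * K.u)) * (K.N₀ ^ (-K.α) / (K.α * K.u)) ≤ j * (K.s * K.M * (1 / K.u)) := by
  have hA := K.hA
  have hu := K.u_pos
  have hα := K.hα
  have hs := K.s_pos
  have hN := K.N₀_pos
  have hj : 0 ≤ j * K.β := hb0.trans hb
  have h1 : K.A * b / ((K.α + 1) * K.u) ≤ K.A * (j * K.β) / (1 * K.u) := by
    gcongr
    linarith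
  calc _ ≤ K.s * (K.A * (j * K.β) / (1 * K.u)) * (K.N₀ ^ (-K.α) / (K.α * K.u)) := by gcongr
    _ = _ := by unfold M; ring

theorem three_m_le : 3 * K.m ≤ 3 * K.β := by linarith [K.hmβ]

theorem Good.sub_decay {w : E n} {Y Z : ℝ → E n} {δ₀ : ℝ} (hw : ‖w‖ < K.c)
    (hY : K.Good K.F w Y) (hZ : K.Good K.Fl w Z) (hδ : ‖Y 0 - Z 0‖ ≤ δ₀) :
    (∀ t, IntegrableOn (fun τ => deriv Y τ - deriv Z τ) (Ioi t)) ∧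
    ∀ t, 0 ≤ t → ‖∫ τ in Ioi t, (deriv Y τ - deriv Z τ)‖
      ≤ 2 * K.s * K.Φ δ₀ * ((K.N₀ + K.u * t) ^ (-K.α) / (K.α * K.u)) := by
  have hc : Continuous fun τ => deriv Y τ - deriv Z τ :=
    hY.sol.continuous_deriv.sub hZ.sol.continuous_deriv
  have h : ∀ t, 0 ≤ t → ‖deriv Y t - deriv Z t‖
      ≤ 2 * K.s * K.Φ δ₀ * (K.N₀ + K.u * t) ^ (-(K.α + 1)) :=
    fun t ht => (hY.compare_short hw hZ hδ t ht).2
  exact ⟨K.integrableOn_of_decay hc h, fun t ht => K.norm_integral_le_of_decay h ht⟩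

theorem Good.sub_decay_same {H : E n → E n → E n} {b b' : ℝ} {w : E n} {Y Z : ℝ → E n} {δ₀ : ℝ}
    (hH : ForceBound K.c K.A K.α b b' H) (hb0 : 0 ≤ b) (hb0' : 0 ≤ b') (hb : b ≤ 3 * K.β)
    (hb' : b' ≤ 3 * K.β) (hw : ‖w‖ < K.c)
    (hY : K.Good H w Y) (hZ : K.Good H w Z) (hδ : ‖Y 0 - Z 0‖ ≤ δ₀) :
    ‖∫ τ in Ioi 0, (deriv Y τ - deriv Z τ)‖ ≤ 24 * (K.s * K.M * (1 / K.u)) * δ₀ := by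
  have h : ∀ t, 0 ≤ t → ‖deriv Y t - deriv Z t‖
      ≤ 2 * K.s * (4 * K.A * b' * δ₀ / ((K.α + 1) * K.u)) * (K.N₀ + K.u * t) ^ (-(K.α + 1)) :=
    fun t ht => hY.compare_same hH hb0 hb0' hb hb' hw hZ hδ t ht
  refine (K.norm_integral_le_of_decay h le_rfl).trans ?_
  have h1 := decay_mul_le (K := K) hb0' hb'
  have h2 := mul_le_mul_of_nonneg_left h1 ((norm_nonneg _).trans hδ)
  rw [mul_zero, add_zero]
  calc _ = 8 * (δ₀ * (K.s * (K.A * b' / ((K.α + 1) * K.u)) * (K.N₀ ^ (-K.α) / (K.α * K.u)))) := by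
        ring
    _ ≤ 8 * (δ₀ * (3 * (K.s * K.M * (1 / K.u)))) := by gcongr
    _ = _ := by ring

theorem Φ_mul_le {δ₀ : ℝ} (h : 0 ≤ δ₀) : 2 * K.s * K.Φ δ₀ * (K.N₀ ^ (-K.α) / (K.α * K.u))
    ≤ 8 * (δ₀ + 1) * (K.s * K.M * (1 / K.u)) := by
  have h1 := decay_mul_le (K := K) (j := 1) K.m_pos.le (by linarith [K.hmβ])
  have h2 := mul_le_mul_of_nonneg_left h1 (show 0 ≤ 8 * (δ₀ + 1) by linarith)
  unfold Φ
  calc _ = 8 * (δ₀ + 1) * (K.s * (K.A * K.m / ((K.α + 1) * K.u)) * (K.N₀ ^ (-K.α) / (K.α * K.u))) := by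
        ring
    _ ≤ _ := h2
    _ = _ := by ring

/-- The solution for the full force that is asymptotic to a given solution `Z` for `Fl`. -/
theorem exists_wave {Z : ℝ → E n} (hZ : K.Good K.Fl K.v Z) (hZ0 : Z 0 = K.x) :
    ∃ Y : ℝ → E n, IsFreeSolution K.c K.F atTop K.v (Y 0) (K.C (3 * K.m) (1 / 2)) Y ∧
      ‖Y 0 - K.x‖ ≤ 1 / 2 ∧ Tendsto (fun t => Y t - Z t) atTop (𝓝 0) ∧
      ∀ Y', IsFreeSolution K.c K.F atTop K.v (Y' 0) (K.C (3 * K.m) (1 / 2)) Y' →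
        ‖Y' 0 - K.x‖ ≤ 1 / 2 → Tendsto (fun t => Y' t - Z t) atTop (𝓝 0) → Y' = Y := by
  have hm := K.m_pos
  have hβ := K.β_pos
  have hM := K.M_pos
  have hP : ‖K.p - K.p‖ ≤ 12 * K.M := by simpa using hM.le
  have hex : ∀ q : E n, ∃ z, ‖q‖ ≤ 1 / 2 → IsFreeSolution K.c K.F atTop K.v (K.x + q) (K.C (3 * K.m) (1 / 2)) z ∧
      ∀ z', IsFreeSolution K.c K.F atTop K.v (K.x + q) (K.C (3 * K.m) (1 / 2)) z' → z' = z := by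
    intro q
    by_cases hq : ‖q‖ ≤ 1 / 2
    · obtain ⟨z, hz, hz'⟩ := K.exists_unique_free K.force_F (by positivity) three_m_le
        (by positivity) le_rfl le_rfl hP (y := K.x + q) (by simpa using hq)
      rw [K.g_p] at hz hz'
      exact ⟨z, fun _ => ⟨hz, hz'⟩⟩
    · exact ⟨0, fun h => absurd h hq⟩
  choose Y hY using hex
  have hGood : ∀ q, ‖q‖ ≤ 1 / 2 → K.Good K.F K.v (Y q) := fun q hq => by
    have h := (hY q hq).1
    rw [← K.g_p] at h
    have := K.good_of_free K.force_F (by positivity) le_rfl le_rfl three_m_le hP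
      (by simp; linarith) (by simpa using hq) h
    rwa [K.g_p] at this
  have hinit : ∀ q, ‖q‖ ≤ 1 / 2 → Y q 0 = K.x + q := fun q hq => (hY q hq).1.initial
  have hYZ0 : ∀ q, ‖q‖ ≤ 1 / 2 → ‖Y q 0 - Z 0‖ ≤ 1 / 2 := fun q hq => by
    rw [hinit q hq, hZ0]
    simpa using hq
  have hsM := K.sM_le.2.1
  have hr2 := K.hr2
  have hdec := fun q hq => (hGood q hq).sub_decay K.hv hZ (hYZ0 q hq)
  -- The difference of positions tends to q - Γ(q), so being asymptotic to Z is the fixed point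
  -- equation of Γ.
  set Γ : E n → E n := fun q => -∫ τ in Ioi 0, (deriv (Y q) τ - deriv Z τ) with hΓ
  have hlim : ∀ q, ‖q‖ ≤ 1 / 2 → Tendsto (fun t => Y q t - Z t) atTop (𝓝 (q - Γ q)) := fun q hq => by
    have h := tendsto_sub_of_integrableOn (hGood q hq).sol.differentiable hZ.sol.differentiable
      ((hdec q hq).1 0)
    rw [hinit q hq, hZ0] at h
    simpa [Γ] using h
  obtain ⟨b, hb, hfix, huniq⟩ := exists_unique_fixed (f := Γ) (R := 1 / 2) (k := 1 / 2) (by norm_num)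
    (by norm_num) (by norm_num) (fun q hq => by
      rw [mem_closedBall_zero_iff] at hq ⊢
      have h := (hdec q hq).2 0 le_rfl
      rw [mul_zero, add_zero] at h
      have h2 := Φ_mul_le (K := K) (δ₀ := 1 / 2) (by norm_num)
      simp only [Γ, norm_neg]
      linarith) (fun q hq q' hq' => by
      rw [mem_closedBall_zero_iff] at hq hq'
      have e : Γ q - Γ q' = -∫ τ in Ioi 0, (deriv (Y q) τ - deriv (Y q') τ) := by
        simp only [Γ]
        rw [neg_sub_neg, ← integral_sub ((hdec q' hq').1 0) ((hdec q hq).1 0), ← integral_neg]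
        congr 1
        ext1 τ
        abel
      rw [e, norm_neg]
      refine ((hGood q hq).sub_decay_same K.force_F (by positivity) (by positivity) three_m_le le_rfl K.hv
        (hGood q' hq') (δ₀ := ‖q - q'‖) ?_).trans ?_
      · rw [hinit q hq, hinit q' hq', add_sub_add_left_eq_sub]
      · gcongr
        linarith)
  rw [mem_closedBall_zero_iff] at hb
  refine ⟨Y b, ?_, ?_, ?_, ?_⟩
  · rw [hinit b hb]; exact (hY b hb).1
  · rw [hinit b hb]; simpa using hb
  · have := hlim b hb
    rwa [hfix, sub_self] at this
  · intro Y' hY' hY'0 hlim'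
    -- A competitor belongs to the family, by uniqueness for its own initial position, and its
    -- displacement is a fixed point of Γ.
    set q := Y' 0 - K.x with hq
    have hq2 : K.x + q = Y' 0 := by rw [hq]; abel
    have hY'q : Y' = Y q := (hY q hY'0).2 Y' (by rw [hq2]; exact hY')
    have h2 := hlim q hY'0
    rw [← hY'q] at h2
    have h3 := tendsto_nhds_unique h2 hlim'
    have h4 : Γ q = q := (sub_eq_zero.1 h3).symm
    rw [hY'q, huniq q (by rwa [mem_closedBall_zero_iff]) h4]

end Ctx

/-! ### Integrals from -∞ and the incoming free solution -/

theorem integrableOn_comp_neg_Ioi {f : ℝ → E n} {t : ℝ} (h : IntegrableOn f (Iic t)) :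
    IntegrableOn (fun τ => f (-τ)) (Ioi (-t)) := by
  rw [← integrableOn_Ici_iff_integrableOn_Ioi, ← integrable_indicator_iff measurableSet_Ici]
  refine ((integrable_indicator_iff measurableSet_Iic).2 h).comp_neg.congr
    (Eventually.of_forall fun t => ?_)
  simp [indicator, neg_le]

theorem integral_Iic_eq (f : ℝ → E n) (t : ℝ) : ∫ τ in Iic t, f τ = ∫ τ in Ioi (-t), f (-τ) := by
  rw [integral_comp_neg_Ioi, neg_neg]

theorem hasDerivAt_integral_Iic {f : ℝ → E n} (hf : Continuous f) {t₀ : ℝ}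
    (hi : IntegrableOn f (Iic t₀)) (t : ℝ) : HasDerivAt (fun t => ∫ τ in Iic t, f τ) (f t) t := by
  have h := hasDerivAt_integral_Ioi (hf.comp continuous_neg) (integrableOn_comp_neg_Ioi hi) (-t)
  have h2 := h.scomp t (hasDerivAt_neg t)
  refine (h2.congr_of_eventuallyEq (Eventually.of_forall fun s => ?_)).congr_deriv (by simp)
  simp only [Function.comp]
  exact integral_Iic_eq f s

theorem tendsto_integral_Iic {f : ℝ → E n} {t₀ : ℝ} (hi : IntegrableOn f (Iic t₀)) :
    Tendsto (fun t => ∫ τ in Iic t, f τ) atBot (𝓝 0) := by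
  have h := (tendsto_integral_Ioi (integrableOn_comp_neg_Ioi hi)).comp tendsto_neg_atBot_atTop
  refine h.congr fun t => ?_
  exact (integral_Iic_eq f t).symm

theorem integrableOn_Iic_of_continuous {f : ℝ → E n} (hf : Continuous f) {t₀ : ℝ}
    (hi : IntegrableOn f (Iic t₀)) (t : ℝ) : IntegrableOn f (Iic t) :=
  (hi.union (hf.integrableOn_Icc (a := t₀) (b := t))).mono_set fun τ hτ => by
    by_cases h : τ ≤ t₀
    · exact Or.inl h
    · exact Or.inr ⟨(not_le.1 h).le, hτ⟩

theorem integrableOn_weight_Iic {γ m u t : ℝ} (hγ : 0 < γ) (hu : 0 < u) (hm : 0 < m) :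
    IntegrableOn (fun τ => (m + u * |τ|) ^ (-(γ + 1))) (Iic t) :=
  (integrable_weight_abs hγ hu hm).integrableOn

theorem integral_weight_Iic {γ m u t : ℝ} (hγ : 0 < γ) (hu : 0 < u) (hm : 0 < m) (ht : t ≤ 0) :
    ∫ τ in Iic t, (m + u * |τ|) ^ (-(γ + 1)) = (m + u * |t|) ^ (-γ) / (γ * u) := by
  rw [show Iic t = Iic (- -t) by rw [neg_neg], ← integral_comp_neg_Ioi, abs_of_nonpos ht,
    ← integral_weight hγ hu (by nlinarith)]
  refine setIntegral_congr_fun measurableSet_Ioi fun τ hτ => ?_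
  have h : 0 < τ := by have := mem_Ioi.1 hτ; linarith
  simp only [abs_neg, abs_of_pos h]

namespace Ctx

variable {K : Ctx n}

theorem rev_C (b κ : ℝ) : K.rev.C b κ = K.C b κ := by
  simp [C, rev_s, rev_X, rev_u]

theorem exists_incoming (K : Ctx n) :
    ∃ z, IsFreeSolution K.c K.Fl atBot K.v K.x (K.C K.β₁ 0) z ∧
      ∀ z', IsFreeSolution K.c K.Fl atBot K.v K.x (K.C K.β₁ 0) z' → z' = z := by
  have hM := K.rev.M_pos
  have hβ : K.β₁ ≤ 3 * K.β := by linarith [K.hβ₁m, K.hmβ, K.β_pos]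
  have hβ' : K.β₂ ≤ 3 * K.β := by linarith [K.hβ₂m, K.hmβ, K.β_pos]
  obtain ⟨z, hz, hz'⟩ := K.rev.exists_unique_free (P := K.rev.p) (y := K.x) (κ := 0) K.rev.hl
    K.hβ₁.le hβ K.hβ₂.le hβ' (by norm_num) (by simpa using hM.le) (by simp)
  rw [K.rev.g_p, rev_C] at hz hz'
  refine ⟨fun t => z (-t), ?_, fun z₁ hz₁ => ?_⟩
  · have := hz.rev_atTop
    rw [show K.rev.Fl = revForce K.Fl from rfl, revForce_revForce] at this
    simpa using this
  · have := hz' _ hz₁.rev_atBot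
    rw [← this]
    ext1 t
    simp

section incoming

variable {zm : ℝ → E n} (hz : IsFreeSolution K.c K.Fl atBot K.v K.x (K.C K.β₁ 0) zm)

include hz

theorem rev_free : IsFreeSolution K.rev.c K.rev.Fl atTop (g K.rev.c K.rev.p) K.x (K.rev.C K.β₁ 0)
    (fun t => zm (-t)) := by
  rw [K.rev.g_p, rev_C]
  exact hz.rev_atBot

theorem rev_good : K.rev.Good K.rev.Fl K.rev.v (fun t => zm (-t)) := by
  have hM := K.rev.M_pos
  have h := K.rev.good_of_free (P := K.rev.p) (κ := 0) K.rev.hl K.hβ₁.le (by norm_num) (j := 1) (by norm_num)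
    (by simpa using K.hβ₁m.trans K.hmβ) (by simpa using hM.le) (by simp; linarith) (by simp)
    (rev_free hz)
  rwa [K.rev.g_p] at h

theorem zm_tube (t : ℝ) : ‖zm t - (K.x + t • K.v)‖ ≤ K.u * |t| := by
  have hM := K.rev.M_pos
  have hβ : K.β₁ ≤ 3 * K.β := by linarith [K.hβ₁m, K.hmβ, K.β_pos]
  have h := K.rev.tube_of_free (P := K.rev.p) (κ := 0) K.hβ₁.le hβ (by norm_num)
    (by simpa using hM.le) (by simp) (rev_free hz) (-t)
  simpa [rev_u] using h

theorem zm_integrable : Integrable (along K.Fl zm) ∧ ∫ τ, ‖along K.Fl zm τ‖ ≤ 4 * K.M := by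
  have h := K.integrable_of_tube (κ := 0) K.hl (by norm_num) hz.solution
    (fun t => by simpa using zm_tube hz t)
  have h2 := K.transfer_le (κ := 0) (j := 1) (by norm_num) K.hβ₁.le (by linarith [K.hβ₁m, K.hmβ])
  exact ⟨h.1, h.2.trans (by linarith)⟩

theorem zm_deriv (t : ℝ) : deriv zm t = g K.c (gInv K.c K.v + ∫ τ in Iic t, along K.Fl zm τ) :=
  hz.solution.deriv_Iic K.hv hz.tendsto_deriv (zm_integrable hz).1.integrableOn

end incoming

/-- `M`, with the smaller escape rate `d` instead of `u`. -/
noncomputable def Md (K : Ctx n) : ℝ := K.A * K.β * (K.N₀ ^ (-K.α) / (K.α * K.d))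

theorem M_le_Md : K.M ≤ K.Md := by
  have := K.N₀_pos
  have := K.d_pos
  have := K.d_le_u
  have := K.hα
  have := K.hA
  have := K.β_pos
  unfold M Md
  gcongr

theorem sMd_le : K.s * K.Md ≤ K.r / 100 := by
  have h := K.small_d
  have h1 := mul_pos K.s_pos (K.M_pos.trans_le M_le_Md)
  have hc : 0 < 1 / K.c := one_div_pos.2 K.hc
  have hu : 0 < 1 / K.d := one_div_pos.2 K.d_pos
  refine le_trans ?_ h
  change _ ≤ K.s * K.Md * _
  have : 1 ≤ (1 + 1 / K.c) * (1 + 1 / K.d) := by nlinarith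
  nlinarith

theorem norm_g_sub_le_d {q q' : E n} (hq : ‖q - K.p‖ ≤ 24 * K.Md) (hq' : ‖q' - K.p‖ ≤ 24 * K.Md) :
    ‖g K.c q - g K.c q'‖ ≤ 2 * K.s * ‖q - q'‖ := by
  have hM : 24 * K.Md ≤ ‖K.p‖ / 2 := by
    have h : ‖K.p‖ = ‖K.v‖ / K.s := norm_gInv K.hv
    rw [h, le_div_iff₀ two_pos, le_div_iff₀ K.s_pos]
    have := K.sMd_le
    linarith [K.u_le_norm_v, K.r_lt_u, K.hr]
  rw [← K.glor_p]
  exact RelNewton.norm_g_sub_le K.hc (hq.trans hM) (hq'.trans hM)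

/-! ### Curves z₋ + f with f in the deflection space -/

section deflection

variable {zm f : ℝ → E n} (hz : IsFreeSolution K.c K.Fl atBot K.v K.x (K.C K.β₁ 0) zm)
  (hf : f ∈ deflectionSpace K.c K.r K.v K.x zm)

include hf in
-- The norm bounds |f| only for t < 0; continuity adds t = 0.
theorem deflection_zero_le : ‖f 0‖ ≤ K.r := by
  have hc : ContinuousWithinAt (fun t => ‖f t‖) (Iio 0) 0 := hf.1.continuous.norm.continuousWithinAt
  exact le_of_tendsto hc (eventually_mem_nhdsWithin.mono fun t ht => hf.2.2.2.2 t ht)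

include hf in
theorem deflection_le (t : ℝ) : ‖f t‖ ≤ K.r + K.r * |t| := by
  have hr := K.hr
  rcases lt_or_ge t 0 with ht | ht
  · have := hf.2.2.2.2 t ht
    have := mul_nonneg hr.le (abs_nonneg t)
    linarith
  · have hcd : Continuous (deriv f) := hf.1.continuous_deriv (by norm_num)
    rw [eq_integral_deriv (hf.1.differentiable (by norm_num)) hcd t]
    refine (norm_add_le _ _).trans (add_le_add (deflection_zero_le hf) ?_)
    have := intervalIntegral.norm_integral_le_of_norm_le_const (a := 0) (b := t)
      (f := deriv f) (C := K.r) fun τ hτ => by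
        rw [uIoc_of_le ht] at hτ
        exact hf.2.2.2.1 τ hτ.1
    simpa using this

include hz hf

theorem deriv_add_deflection (t : ℝ) : deriv (zm + f) t = deriv zm t + deriv f t :=
  deriv_add (hz.solution.differentiable t) (hf.1.differentiable (by norm_num) t)

/-- The free solution uses an opening u and the deflection adds r. Of the escape rate 2u there
remains d = u - r, which is why d appears in the estimates. -/
theorem deflection_tube (t : ℝ) :
    ‖zm t + f t - (K.x + t • K.v)‖ ≤ K.r + (K.u + K.r) * |t| := by
  rw [show zm t + f t - (K.x + t • K.v) = (zm t - (K.x + t • K.v)) + f t by abel]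
  refine (norm_add_le _ _).trans ?_
  have := zm_tube hz t
  have := deflection_le hf t
  linarith

theorem weight_le_of_segment {t : ℝ} {ξ : E n} (hξ : ξ ∈ segment ℝ (zm t) (zm t + f t)) :
    1 - K.r + K.X + K.d * |t| ≤ 1 + ‖ξ‖ := by
  have h1 : ‖zm t - (K.x + t • K.v)‖ ≤ K.r + (K.u + K.r) * |t| := by
    have := zm_tube hz t
    have := mul_nonneg K.hr.le (abs_nonneg t)
    linarith [K.hr]
  have := K.tube_le (segment_sub_smul_le h1 (deflection_tube hz hf t) hξ)
  rw [d_eq]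
  linarith

theorem continuous_along_deflection : Continuous (along K.F (zm + f)) := by
  have h : Continuous (deriv (zm + f)) := by
    have : deriv (zm + f) = fun t => deriv zm t + deriv f t :=
      funext (deriv_add_deflection hz hf)
    rw [this]
    exact hz.solution.continuous_deriv.add (hf.1.continuous_deriv (by norm_num))
  exact K.force_F.cont.comp ((hz.solution.differentiable.continuous.add hf.1.continuous).prodMk h)

theorem deflection_integrable : Integrable (along K.F (zm + f)) ∧
    ∫ τ, ‖along K.F (zm + f) τ‖ ≤ 12 * K.Md := by
  have hcd : Continuous (deriv (zm + f)) := by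
    have : deriv (zm + f) = fun t => deriv zm t + deriv f t :=
      funext (deriv_add_deflection hz hf)
    rw [this]
    exact hz.solution.continuous_deriv.add (hf.1.continuous_deriv (by norm_num))
  have hN := K.N₀_le K.hr2.le
  have h := K.force_F.integrable (m := 1 + K.X - K.r) (u := K.d) K.hα (K.N₀_half.trans hN) K.d_pos
    (γ := zm + f) (w := deriv (zm + f)) (hz.solution.differentiable.continuous.add hf.1.continuous)
    hcd (fun t => by rw [deriv_add_deflection hz hf]; exact hf.2.1 t) fun t => by
      have := weight_le_of_segment hz hf (right_mem_segment ℝ (zm t) (zm t + f t))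
      simp only [Pi.add_apply]
      linarith
  refine ⟨h.1, h.2.trans ?_⟩
  have h1 : (1 + K.X - K.r) ^ (-K.α) ≤ K.N₀ ^ (-K.α) := rpow_weight_le K.N₀_pos hN K.hα.le
  have hA := K.hA
  have hd := K.d_pos
  have hα := K.hα
  have hm := K.m_pos
  have hβ := K.β_pos
  have h3 : 0 ≤ (1 + K.X - K.r) := by linarith [K.N₀_pos]
  have h2 : (1 + K.X - K.r) ^ (-K.α) / (K.α * K.d) ≤ K.N₀ ^ (-K.α) / (K.α * K.d) :=
    div_le_div_of_nonneg_right h1 (by positivity)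
  calc _ ≤ 4 * K.A * (3 * K.β) * (K.N₀ ^ (-K.α) / (K.α * K.d)) :=
        mul_le_mul (mul_le_mul_of_nonneg_left three_m_le (by positivity)) h2 (by positivity) (by positivity)
    _ = _ := by unfold Md; ring

theorem dotA_args (t : ℝ) :
    ‖(gInv K.c K.v + ∫ τ in Iic t, along K.F (zm + f) τ) - K.p‖ ≤ 12 * K.Md ∧
      ‖(gInv K.c K.v + ∫ τ in Iic t, along K.Fl zm τ) - K.p‖ ≤ 12 * K.Md := by
  have h1 := deflection_integrable hz hf
  have h2 := zm_integrable hz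
  have h3 := K.M_le_Md
  have h4 := K.M_pos
  constructor
  · rw [show K.p = gInv K.c K.v from rfl, add_sub_cancel_left]
    exact (norm_setIntegral_le_integral h1.1 _).trans h1.2
  · rw [show K.p = gInv K.c K.v from rfl, add_sub_cancel_left]
    exact (norm_setIntegral_le_integral h2.1 _).trans (h2.2.trans (by linarith))

/-- The integrand F(z₋+f) - F^l(z₋) has three parts, all of order N^(-α-2) with N = 1 - r + X +
d|τ|: displacement in F^l, change of velocity in F^l, and F^s itself. Integrating from -∞ and
applying the Lipschitz bound of g gives the decay of ẏ₋. -/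
theorem norm_dotA_le {t : ℝ} (ht : t ≤ 0) : ‖dotA K.c K.F K.Fl K.v zm f t‖
    ≤ 2 * K.s * (K.A * (K.r * K.β₁ / K.c + 2 * K.β₂ * (K.r + 1)))
      * ((1 - K.r + K.X + K.d * |t|) ^ (-(K.α + 1)) / ((K.α + 1) * K.d)) := by
  have hN := K.N₀_le K.hr2.le
  have hm0 : 0 < 1 - K.r + K.X := by linarith [K.N₀_pos]
  have hmh : 1 / 2 ≤ 1 - K.r + K.X := by linarith [K.N₀_half]
  have hα := K.hα
  have hA := K.hA
  have hc := K.hc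
  have hβ₁ := K.hβ₁
  have hβ₂ := K.hβ₂
  have hd := K.d_pos
  have h1 := deflection_integrable hz hf
  have h2 := zm_integrable hz
  have h3 := dotA_args hz hf t
  have hMd : 0 < K.Md := K.M_pos.trans_le K.M_le_Md
  have hL := K.norm_g_sub_le_d (h3.1.trans (by linarith)) (h3.2.trans (by linarith))
  unfold dotA
  refine hL.trans ?_
  rw [add_sub_add_left_eq_sub, ← integral_sub h1.1.integrableOn h2.1.integrableOn, mul_assoc (2 * K.s)]
  refine mul_le_mul_of_nonneg_left ?_ (by linarith [K.s_pos])
  rw [← integral_weight_Iic (by linarith) hd hm0 ht, ← integral_const_mul]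
  refine norm_integral_le_of_norm_le
    ((integrableOn_weight_Iic (by linarith) hd hm0).const_mul _) ?_
  -- The bounds of the deflection space hold for τ < 0 only, so the null set {0} is discarded.
  have hae : ∀ᵐ τ ∂(volume.restrict (Iic t)), τ ≠ 0 :=
    ae_restrict_of_ae (by simp [ae_iff, measure_singleton])
  filter_upwards [ae_restrict_mem measurableSet_Iic, hae] with τ hτ hτ0
  have hτneg : τ < 0 := lt_of_le_of_ne (le_trans hτ ht) hτ0
  set N := 1 - K.r + K.X + K.d * |τ| with hNdef
  have hNh : 1 / 2 ≤ N := by have := mul_nonneg hd.le (abs_nonneg τ); linarith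
  have hN0 : 0 < N := by linarith
  -- The weight in the norm of f supplies the missing power of N in the velocity term.
  have hf' : ‖deriv f τ‖ ≤ K.r * N⁻¹ := by
    have := hf.2.2.1 τ hτneg
    have h4 : N * ‖deriv f τ‖ ≤ K.r :=
      (mul_le_mul_of_nonneg_right (le_max_right _ _) (norm_nonneg _)).trans this
    rw [← div_eq_mul_inv, le_div_iff₀ hN0]
    linarith
  have hl := K.hl.lip (zm τ) (zm τ + f τ) (deriv zm τ) (deriv (zm + f) τ) N hNh
    (hz.solution.speed_lt τ).le (by rw [deriv_add_deflection hz hf]; exact hf.2.1 τ)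
    (fun ξ hξ => weight_le_of_segment hz hf hξ)
  have hs := K.hs.bound (zm τ + f τ) (deriv (zm + f) τ) N hNh
    (by rw [deriv_add_deflection hz hf]; exact hf.2.1 τ)
    (weight_le_of_segment hz hf (right_mem_segment ℝ _ _))
  have e : along K.F (zm + f) τ - along K.Fl zm τ
      = (K.Fl (zm τ + f τ) (deriv (zm + f) τ) - K.Fl (zm τ) (deriv zm τ))
        + K.Fs (zm τ + f τ) (deriv (zm + f) τ) := by
    simp only [along, F, Pi.add_apply]
    abel
  rw [e]
  refine (norm_add_le _ _).trans ((add_le_add hl hs).trans ?_)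
  rw [add_sub_cancel_left, deriv_add_deflection hz hf, add_sub_cancel_left]
  have eN : N ^ (-(K.α + 1)) * N⁻¹ = N ^ (-(K.α + 1 + 1)) := by
    rw [← Real.rpow_neg_one, ← Real.rpow_add hN0]
    ring_nf
  rw [show K.α + 2 = K.α + 1 + 1 by ring]
  have hW : 0 < N ^ (-(K.α + 1 + 1)) := by positivity
  have hW' : 0 < N ^ (-(K.α + 1)) := by positivity
  calc _ ≤ 2 * K.A * K.β₂ * N ^ (-(K.α + 1 + 1)) * K.r
        + K.A * K.β₁ / K.c * N ^ (-(K.α + 1)) * (K.r * N⁻¹)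
        + 2 * K.A * K.β₂ * N ^ (-(K.α + 1 + 1)) := by
        gcongr
        exact hf.2.2.2.2 τ hτneg
    _ = 2 * K.A * K.β₂ * N ^ (-(K.α + 1 + 1)) * K.r
        + K.A * K.β₁ / K.c * K.r * (N ^ (-(K.α + 1)) * N⁻¹)
        + 2 * K.A * K.β₂ * N ^ (-(K.α + 1 + 1)) := by ring
    _ = _ := by rw [eN]; ring

theorem continuous_dotA : Continuous (dotA K.c K.F K.Fl K.v zm f) := by
  have h1 := deflection_integrable hz hf
  have h2 := zm_integrable hz
  have c1 : Continuous fun t => ∫ τ in Iic t, along K.F (zm + f) τ :=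
    continuous_iff_continuousAt.2 fun t => (hasDerivAt_integral_Iic
      (continuous_along_deflection hz hf) (t₀ := 0) h1.1.integrableOn t).continuousAt
  have c2 : Continuous fun t => ∫ τ in Iic t, along K.Fl zm τ :=
    continuous_iff_continuousAt.2 fun t => (hasDerivAt_integral_Iic
      (hz.solution.continuous_along K.hl.cont) (t₀ := 0) h2.1.integrableOn t).continuousAt
  exact (continuous_g.comp (continuous_const.add c1)).sub (continuous_g.comp (continuous_const.add c2))

theorem integrableOn_dotA (t : ℝ) : IntegrableOn (dotA K.c K.F K.Fl K.v zm f) (Iic t) := by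
  have hc := continuous_dotA hz hf
  refine integrableOn_Iic_of_continuous hc (t₀ := 0) ?_ t
  have hm0 : 0 < 1 - K.r + K.X := by linarith [K.N₀_pos, K.N₀_le K.hr2.le]
  refine ((integrableOn_weight_Iic K.hα K.d_pos hm0).const_mul
    (2 * K.s * (K.A * (K.r * K.β₁ / K.c + 2 * K.β₂ * (K.r + 1))) / ((K.α + 1) * K.d))).mono'
    hc.aestronglyMeasurable ?_
  filter_upwards [ae_restrict_mem measurableSet_Iic] with τ hτ
  refine (norm_dotA_le hz hf hτ).trans (le_of_eq ?_)
  ring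

theorem hasDerivAt_opA (t : ℝ) : HasDerivAt (opA K.c K.F K.Fl K.v zm f)
    (dotA K.c K.F K.Fl K.v zm f t) t :=
  hasDerivAt_integral_Iic (continuous_dotA hz hf) (integrableOn_dotA hz hf 0) t

/-- Differentiating f = 𝒜(f) and adding the momentum formula for the velocity of z₋ cancels the
second g, which leaves the momentum equation of the full force. -/
theorem newton_of_fixed (hfix : opA K.c K.F K.Fl K.v zm f = f) :
    IsNewtonSolution K.c K.F (zm + f) ∧
    (∀ t, deriv (zm + f) t = g K.c (gInv K.c K.v + ∫ τ in Iic t, along K.F (zm + f) τ)) ∧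
    Tendsto (deriv (zm + f)) atBot (𝓝 K.v) ∧ Tendsto f atBot (𝓝 0) := by
  have hi := deflection_integrable hz hf
  have hd : ∀ t, deriv (zm + f) t = g K.c (gInv K.c K.v + ∫ τ in Iic t, along K.F (zm + f) τ) := by
    intro t
    have h := (hasDerivAt_opA hz hf t).deriv
    rw [hfix] at h
    rw [deriv_add_deflection hz hf, h, zm_deriv hz, dotA]
    abel
  refine ⟨⟨hz.solution.differentiable.add (hf.1.differentiable (by norm_num)), fun t => ?_, fun t => ?_⟩,
    hd, ?_, ?_⟩
  · rw [hd]; exact norm_g_lt K.hc _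
  · have : (fun s => gInv K.c (deriv (zm + f) s))
        = fun s => gInv K.c K.v + ∫ τ in Iic s, along K.F (zm + f) τ := by
      ext1 s; rw [hd, gInv_g K.hc]
    rw [this]
    exact (hasDerivAt_integral_Iic (continuous_along_deflection hz hf) (t₀ := 0)
      hi.1.integrableOn t).const_add _
  · have h1 : Tendsto (fun t => gInv K.c K.v + ∫ τ in Iic t, along K.F (zm + f) τ) atBot
        (𝓝 (gInv K.c K.v + 0)) :=
      tendsto_const_nhds.add (tendsto_integral_Iic (t₀ := 0) hi.1.integrableOn)
    rw [add_zero] at h1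
    have h2 := ((continuous_g (c := K.c)).tendsto (gInv K.c K.v)).comp h1
    rw [g_gInv K.hv] at h2
    exact h2.congr fun t => (hd t).symm
  · have := tendsto_integral_Iic (integrableOn_dotA hz hf 0)
    refine this.congr fun t => ?_
    exact congrFun hfix t

/-- A bootstrap: membership in the space gives escape only at rate d. This bounds the velocity
deviation by 24s`Md` ≤ u, so the curve lies in the tube of opening u; the momentum transfer is then
estimated again at rate u, which is what uniqueness in `exists_wave` requires. -/
theorem rev_free_of_fixed (hfix : opA K.c K.F K.Fl K.v zm f = f) :
    IsFreeSolution K.rev.c K.rev.F atTop K.rev.v ((zm + f) 0) (K.rev.C (3 * K.rev.m) (1 / 2))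
      (fun t => (zm + f) (-t)) ∧ ‖(zm + f) 0 - K.x‖ ≤ 1 / 2 := by
  obtain ⟨hN, hd, ht, -⟩ := newton_of_fixed hz hf hfix
  have hMd : 0 < K.Md := K.M_pos.trans_le K.M_le_Md
  have h0 : (zm + f) 0 - K.x = f 0 := by simp [hz.initial]
  have hv : ∀ t, ‖deriv (zm + f) t - K.v‖ ≤ 24 * (K.s * K.Md) := fun t => by
    have h3 := (dotA_args hz hf t).1
    have := K.norm_g_sub_le_d (h3.trans (by linarith)) (q' := K.p) (by simpa using hMd.le)
    rw [K.g_p, ← hd] at this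
    have := mul_le_mul_of_nonneg_left h3 K.s_pos.le
    linarith
  have htube : ∀ t, ‖(zm + f) t - (K.x + t • K.v)‖ ≤ 1 / 2 + K.u * |t| := fun t => by
    have h1 := norm_integral_sub_smul_le hN.continuous_deriv hv t
    have e : (zm + f) t - (K.x + t • K.v)
        = f 0 + ((∫ τ in (0 : ℝ)..t, deriv (zm + f) τ) - t • K.v) := by
      rw [eq_integral_deriv hN.differentiable hN.continuous_deriv t, ← h0]
      abel
    rw [e]
    refine (norm_add_le _ _).trans ?_
    have h2 := deflection_zero_le hf
    have h3 := K.sMd_le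
    have h4 : 24 * (K.s * K.Md) ≤ K.u := by linarith [K.r_lt_u, K.hr]
    have h5 := mul_le_mul_of_nonneg_right h4 (abs_nonneg t)
    linarith [K.hr2]
  refine ⟨IsFreeSolution.rev_atBot (w := K.v) ⟨hN, ht, rfl, fun t => ?_⟩, ?_⟩
  · rw [hd, rev_C]
    have hi := K.integrable_of_tube K.force_F le_rfl hN htube
    have h1 := (norm_setIntegral_le_integral hi.1 (Iic t)).trans hi.2
    have h2 := K.transfer_le (b := 3 * K.m) (j := 3) le_rfl (by linarith [K.m_pos]) three_m_le
    have h3 := K.norm_g_sub_v_le (q := gInv K.c K.v + ∫ τ in Iic t, along K.F (zm + f) τ) (by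
      rw [show K.p = gInv K.c K.v from rfl, add_sub_cancel_left]
      linarith [K.M_pos])
    refine h3.trans ?_
    rw [show K.p = gInv K.c K.v from rfl, add_sub_cancel_left]
    exact mul_le_mul_of_nonneg_left h1 (by linarith [K.s_pos])
  · rw [h0]
    exact (deflection_zero_le hf).trans K.hr2.le

end deflection

end Ctx

/-! ### The incoming deflection and the outgoing data -/

namespace Ctx

variable {K : Ctx n}

theorem rev_Φ (δ₀ : ℝ) : K.rev.Φ δ₀ = K.Φ δ₀ := by
  simp [Φ, rev_u]

theorem Φ_mul_le' {δ₀ : ℝ} (h : 0 ≤ δ₀) :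
    2 * K.s * K.Φ δ₀ * K.N₀ ^ (-K.α) ≤ 8 * (δ₀ + 1) * (K.s * K.M) := by
  have hA := K.hA
  have hu := K.u_pos
  have hα := K.hα
  have hs := K.s_pos
  have hN := K.N₀_pos
  have hm := K.m_pos
  have hmβ := K.hmβ
  have hβ := K.β_pos
  unfold Φ M
  calc _ = 8 * (δ₀ + 1) * (K.s * (K.A * K.m * (K.N₀ ^ (-K.α) / ((K.α + 1) * K.u)))) := by ring
    _ ≤ 8 * (δ₀ + 1) * (K.s * (K.A * K.β * (K.N₀ ^ (-K.α) / (K.α * K.u)))) := by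
      gcongr
      linarith

/-- The incoming deflection `ym` of the free solution `zm`. -/
structure Incoming (K : Ctx n) (zm ym : ℝ → E n) : Prop where
  free : IsFreeSolution K.c K.Fl atBot K.v K.x (K.C K.β₁ 0) zm
  mem : ym ∈ deflectionSpace K.c K.r K.v K.x zm
  fixed : opA K.c K.F K.Fl K.v zm ym = ym
  good : K.rev.Good K.rev.F K.rev.v (fun t => (zm + ym) (-t))

theorem exists_deflection {zm : ℝ → E n}
    (hz : IsFreeSolution K.c K.Fl atBot K.v K.x (K.C K.β₁ 0) zm) :
    ∃ ym, K.Incoming zm ym ∧ ∀ f ∈ deflectionSpace K.c K.r K.v K.x zm,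
      opA K.c K.F K.Fl K.v zm f = f → f = ym := by
  have hM := K.M_pos
  have hm := K.m_pos
  have hr := K.hr
  have hu := K.u_pos
  have hα := K.hα
  have hsM := K.sM_le
  have hr2 := K.hr2
  have hZ := rev_good hz
  -- The deflection is the time-reversed wave minus z₋. It remains to see that it lies in the space
  -- and is fixed by 𝒜.
  obtain ⟨Y, hY, hY0, hlim, huniq⟩ := K.rev.exists_wave hZ (by simpa using hz.initial)
  have hgood : K.rev.Good K.rev.F K.rev.v Y := by
    have h := K.rev.good_of_free (P := K.rev.p) (κ := 1 / 2) (j := 3) (y := Y 0) (z := Y)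
      K.rev.force_F (by simpa using hm.le) le_rfl le_rfl three_m_le
      (by simpa using K.rev.M_pos.le) (by simp; linarith [K.rev.M_pos]) hY0
      (by rw [K.rev.g_p]; exact hY)
    rwa [K.rev.g_p] at h
  set ym : ℝ → E n := fun t => Y (-t) - zm t with hym
  have hsum : zm + ym = fun t => Y (-t) := by
    ext1 t; simp [ym]
  have hX : IsFreeSolution K.c K.F atBot K.v (Y 0) (K.C (3 * K.m) (1 / 2)) (zm + ym) := by
    have h := hY.rev_atTop
    rw [rev_C, show K.rev.F = revForce K.F from rfl, revForce_revForce] at h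
    rw [hsum]
    simpa using h
  have hdY : ∀ t, deriv Y t = -deriv (zm + ym) (-t) := fun t => by
    rw [hsum, deriv_comp_neg']
    simp
  have hdym : ∀ t, HasDerivAt ym (deriv (zm + ym) t - deriv zm t) t := fun t => by
    have h1 := (hX.solution.differentiable t).hasDerivAt.sub (hz.solution.differentiable t).hasDerivAt
    have : zm + ym - zm = ym := by abel
    rwa [this] at h1
  have hYZ0 : ‖Y 0 - zm (-0)‖ ≤ 1 / 2 := by
    rw [neg_zero, hz.initial]; exact hY0
  have hneg : ∀ t, t ≤ 0 → ‖deriv ym t‖ ≤ 2 * K.s * K.Φ (1 / 2) * (K.N₀ + K.u * |t|) ^ (-(K.α + 1)) := by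
    intro t ht
    have h := (hgood.compare_short K.rev.hv hZ hYZ0 (-t) (by linarith)).2
    rw [hdY, deriv_comp_neg', rev_s, rev_Φ, rev_N₀, rev_u, rev_α] at h
    simp only [neg_neg] at h
    rw [show -deriv (zm + ym) t - -deriv zm t = -(deriv (zm + ym) t - deriv zm t) by abel, norm_neg] at h
    rw [(hdym t).deriv, abs_of_nonpos ht]
    exact h
  have hmem : ym ∈ deflectionSpace K.c K.r K.v K.x zm := by
    refine ⟨?_, ?_, ?_, ?_, ?_⟩
    · rw [contDiff_one_iff_deriv]
      refine ⟨fun t => (hdym t).differentiableAt, ?_⟩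
      have : deriv ym = fun t => deriv (zm + ym) t - deriv zm t := funext fun t => (hdym t).deriv
      rw [this]
      exact hX.solution.continuous_deriv.sub hz.solution.continuous_deriv
    · intro t
      rw [(hdym t).deriv, add_sub_cancel]
      exact (hX.solution.speed_lt t).le
    · intro t ht
      have hN : 0 < K.N₀ + K.u * |t| := K.weight_pos (abs_nonneg t)
      -- The weight of the norm is at most 2N with N = N₀ + u|t|; against velocity decay N^(-α-1)
      -- this leaves N^(-α) ≤ N₀^(-α), hence a bound 24sM < r.
      have h1 : max 1 (1 - K.r + K.X + K.d * |t|) ≤ 2 * (K.N₀ + K.u * |t|) := by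
        have hX := K.X_nonneg
        have hd := K.d_le_u
        have ha := abs_nonneg t
        have h2 : K.d * |t| ≤ K.u * |t| := by gcongr
        have h3 : 0 ≤ K.u * |t| := by positivity
        unfold N₀
        exact max_le (by linarith) (by linarith)
      have h2 := mul_le_mul h1 (hneg t ht.le) (norm_nonneg _) (by positivity)
      refine h2.trans ?_
      have e : (K.N₀ + K.u * |t|) * (K.N₀ + K.u * |t|) ^ (-(K.α + 1)) = (K.N₀ + K.u * |t|) ^ (-K.α) := by
        rw [show -K.α = 1 + -(K.α + 1) by ring, Real.rpow_add hN, Real.rpow_one]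
      have h3 : (K.N₀ + K.u * |t|) ^ (-K.α) ≤ K.N₀ ^ (-K.α) :=
        rpow_weight_le K.N₀_pos (by nlinarith [abs_nonneg t]) hα.le
      have hs := K.s_pos
      have hΦ := K.Φ_pos (δ₀ := 1 / 2) (by norm_num)
      have h4 := Φ_mul_le' (K := K) (δ₀ := 1 / 2) (by norm_num)
      calc _ = 2 * (2 * K.s * K.Φ (1 / 2) * ((K.N₀ + K.u * |t|) * (K.N₀ + K.u * |t|) ^ (-(K.α + 1)))) := by
            ring
        _ ≤ 2 * (2 * K.s * K.Φ (1 / 2) * K.N₀ ^ (-K.α)) := by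
            rw [e]; gcongr
        _ ≤ K.r := by linarith
    · intro t _
      -- For t > 0 no decay is claimed: both velocities are close to v, within 24sM and 8sM.
      rw [(hdym t).deriv, ← sub_sub_sub_cancel_right _ _ K.v]
      refine (norm_sub_le _ _).trans ?_
      have h1 := hX.deriv_sub_le t
      have h2 := hz.deriv_sub_le t
      have h3 := K.C_le (b := 3 * K.m) (κ := 1 / 2) (j := 3) le_rfl (by positivity) three_m_le
      have h4 := K.C_le (b := K.β₁) (κ := 0) (j := 1) (by norm_num) K.hβ₁.le
        (by linarith [K.hβ₁m, K.hmβ])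
      linarith
    · intro t ht
      have hdec := hgood.sub_decay K.rev.hv hZ hYZ0
      have h1 := sub_eq_neg_integral hgood.sol.differentiable hZ.sol.differentiable (hdec.1 (-t)) hlim
      simp only [neg_neg] at h1
      have h2 := hdec.2 (-t) (by linarith)
      rw [rev_s, rev_Φ, rev_N₀, rev_u, rev_α] at h2
      have h3 : (K.N₀ + K.u * -t) ^ (-K.α) ≤ K.N₀ ^ (-K.α) :=
        rpow_weight_le K.N₀_pos (by nlinarith) hα.le
      have hs := K.s_pos
      have hΦ := K.Φ_pos (δ₀ := 1 / 2) (by norm_num)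
      have h4 := Φ_mul_le (K := K) (δ₀ := 1 / 2) (by norm_num)
      have h5 : (K.N₀ + K.u * -t) ^ (-K.α) / (K.α * K.u) ≤ K.N₀ ^ (-K.α) / (K.α * K.u) :=
        div_le_div_of_nonneg_right h3 (by positivity)
      have h6 := mul_le_mul_of_nonneg_left h5 (show 0 ≤ 2 * K.s * K.Φ (1 / 2) by positivity)
      simp only [ym]
      rw [h1, norm_neg]
      linarith
  have htend : Tendsto ym atBot (𝓝 0) := by
    have := hlim.comp tendsto_neg_atBot_atTop
    simpa [Function.comp_def, ym] using this
  have hdot : ∀ t, dotA K.c K.F K.Fl K.v zm ym t = deriv (zm + ym) t - deriv zm t := fun t => by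
    have hi := deflection_integrable hz hmem
    rw [zm_deriv hz, hX.solution.deriv_Iic K.hv hX.tendsto_deriv hi.1.integrableOn, dotA]
  have hfix : opA K.c K.F K.Fl K.v zm ym = ym := by
    ext1 t
    have h := integral_Iic_of_hasDerivAt_of_tendsto' (f := ym) (f' := dotA K.c K.F K.Fl K.v zm ym)
      (a := t) (fun τ _ => by rw [hdot]; exact hdym τ) (integrableOn_dotA hz hmem t) htend
    rw [sub_zero] at h
    exact h
  refine ⟨ym, ⟨hz, hmem, hfix, ?_⟩, fun f hf hff => ?_⟩
  · rw [hsum]; simpa using hgood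
  · obtain ⟨h1, h2⟩ := rev_free_of_fixed hz hf hff
    obtain ⟨-, -, -, h3⟩ := newton_of_fixed hz hf hff
    have h4 := huniq (fun t => (zm + f) (-t)) (by simpa using h1) (by simpa using h2) (by
      have := h3.comp tendsto_neg_atTop_atBot
      simpa [Function.comp_def] using this)
    ext1 t
    have h5 := congrFun h4 (-t)
    simp only [neg_neg, Pi.add_apply] at h5
    simp only [ym, ← h5]
    abel

namespace Incoming

variable {zm ym : ℝ → E n} (h : K.Incoming zm ym)

include h

theorem newton : IsNewtonSolution K.c K.F (zm + ym) := (newton_of_fixed h.free h.mem h.fixed).1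

theorem deriv_eq (t : ℝ) :
    deriv (zm + ym) t = g K.c (gInv K.c K.v + ∫ τ in Iic t, along K.F (zm + ym) τ) :=
  (newton_of_fixed h.free h.mem h.fixed).2.1 t

theorem hasDerivAt_ym (t : ℝ) : HasDerivAt ym (deriv (zm + ym) t - deriv zm t) t := by
  have h1 := (h.newton.differentiable t).hasDerivAt.sub (h.free.solution.differentiable t).hasDerivAt
  have : zm + ym - zm = ym := by abel
  rwa [this] at h1

theorem deriv_ym (t : ℝ) : deriv ym t = dotA K.c K.F K.Fl K.v zm ym t := by
  rw [(h.hasDerivAt_ym t).deriv, h.deriv_eq, zm_deriv h.free, dotA]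

theorem tendsto_ym : Tendsto ym atBot (𝓝 0) := (newton_of_fixed h.free h.mem h.fixed).2.2.2

theorem tendsto_deriv_ym : Tendsto (deriv ym) atBot (𝓝 0) := by
  have h1 := (newton_of_fixed h.free h.mem h.fixed).2.2.1.sub h.free.tendsto_deriv
  rw [sub_self] at h1
  exact h1.congr fun t => ((h.hasDerivAt_ym t).deriv).symm

theorem tube (t : ℝ) : ‖(zm + ym) t - (K.x + t • K.v)‖ ≤ 1 / 2 + K.u * |t| := by
  have := h.good.tube (-t)
  simpa [rev_u] using this

theorem integrable : Integrable (along K.F (zm + ym)) ∧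
    ∫ τ, ‖along K.F (zm + ym) τ‖ ≤ 4 * K.A * (3 * K.m) * (K.N₀ ^ (-K.α) / (K.α * K.u)) := by
  have := K.integrable_of_tube K.force_F le_rfl h.newton h.tube
  rwa [show 1 + K.X - 1 / 2 = K.N₀ by unfold N₀; ring] at this

theorem momentum_le (s : Set ℝ) :
    ‖(gInv K.c K.v + ∫ τ in s, along K.F (zm + ym) τ) - K.p‖
      ≤ 4 * K.A * (3 * K.m) * (K.N₀ ^ (-K.α) / (K.α * K.u)) := by
  rw [show K.p = gInv K.c K.v from rfl, add_sub_cancel_left]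
  exact (norm_setIntegral_le_integral h.integrable.1 _).trans h.integrable.2

omit h in
theorem transfer_m_le : 4 * K.A * (3 * K.m) * (K.N₀ ^ (-K.α) / (K.α * K.u)) ≤ 12 * K.M := by
  have := K.transfer_le (b := 3 * K.m) (j := 3) (κ := 1 / 2) le_rfl (by linarith [K.m_pos]) three_m_le
  rw [show 1 + K.X - 1 / 2 = K.N₀ by unfold N₀; ring] at this
  linarith

/-- The outgoing momentum. -/
theorem outMomentum_le : ‖(gInv K.c K.v + ∫ τ, along K.F (zm + ym) τ) - K.p‖
    ≤ 4 * K.A * (3 * K.m) * (K.N₀ ^ (-K.α) / (K.α * K.u)) := by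
  have := h.momentum_le univ
  rwa [Measure.restrict_univ] at this

theorem norm_deriv_sub_le (t : ℝ) : ‖deriv (zm + ym) t - K.v‖ ≤ 24 * (K.s * K.M) := by
  rw [h.deriv_eq]
  have h1 := (h.momentum_le (Iic t)).trans transfer_m_le
  have h2 := K.norm_g_sub_v_le (h1.trans (by linarith [K.M_pos]))
  have := mul_le_mul_of_nonneg_left h1 K.s_pos.le
  linarith

theorem norm_outVel_sub_le : ‖outVel K.c K.F K.v (zm + ym) - K.v‖
    ≤ 24 * K.A * K.s * K.m * (K.N₀ ^ (-K.α) / (K.α * K.u)) := by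
  have h1 := h.outMomentum_le
  have h2 := K.norm_g_sub_v_le ((h1.trans transfer_m_le).trans (by linarith [K.M_pos]))
  have := mul_le_mul_of_nonneg_left h1 K.s_pos.le
  unfold outVel
  linarith

theorem norm_ym_zero_le : ‖ym 0‖ ≤ 2 * K.s * K.Φ (1 / 2) * (K.N₀ ^ (-K.α) / (K.α * K.u)) := by
  have hZ := rev_good h.free
  have h00 : ‖(zm + ym) (-0) - zm (-0)‖ ≤ 1 / 2 := by
    simp only [neg_zero, Pi.add_apply, add_sub_cancel_left]
    exact (deflection_zero_le h.mem).trans K.hr2.le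
  have hdec := h.good.sub_decay K.rev.hv hZ h00
  have h1 := sub_eq_neg_integral h.good.sol.differentiable hZ.sol.differentiable (hdec.1 0) (by
    have := h.tendsto_ym.comp tendsto_neg_atTop_atBot
    simpa [Function.comp_def] using this)
  have h2 := hdec.2 0 le_rfl
  rw [rev_s, rev_Φ, rev_N₀, rev_u, rev_α, mul_zero, add_zero] at h2
  simp only [neg_zero, Pi.add_apply, add_sub_cancel_left] at h1
  rw [h1, norm_neg]
  exact h2

/-- The same trajectory seen from +∞: the momentum gained up to t tends to the total transfer, so
the velocity tends to ã and the comparison lemmas apply on t ≥ 0. -/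
theorem good_out : K.Good K.F (outVel K.c K.F K.v (zm + ym)) (zm + ym) := by
  have hi := h.integrable.1
  refine ⟨h.newton, ?_, h.tube, fun t => ?_, hi⟩
  · have h1 : Tendsto (fun t => gInv K.c K.v + ∫ τ in Iic t, along K.F (zm + ym) τ) atTop
        (𝓝 (gInv K.c K.v + (((∫ τ, along K.F (zm + ym) τ) - 0)))) := by
      refine tendsto_const_nhds.add ?_
      refine (tendsto_const_nhds.sub (tendsto_integral_Ioi (t₀ := 0) hi.integrableOn)).congr fun t => ?_
      rw [sub_eq_iff_eq_add, ← intervalIntegral.integral_Iic_add_Ioi hi.integrableOn hi.integrableOn]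
    rw [sub_zero] at h1
    have h2 := ((continuous_g (c := K.c)).tendsto _).comp h1
    exact h2.congr fun t => (h.deriv_eq t).symm
  · rw [h.deriv_eq, gInv_g K.hc]
    have := (h.momentum_le (Iic t)).trans transfer_m_le
    linarith [K.M_pos]

theorem exists_outgoing {q : E n} {κ : ℝ} (hκ : κ ≤ 1 / 2) (hq : ‖q‖ ≤ κ) :
    ∃ z, IsFreeSolution K.c K.Fl atTop (outVel K.c K.F K.v (zm + ym)) (K.x + q) (K.C K.β₁ κ) z ∧
      ∀ z', IsFreeSolution K.c K.Fl atTop (outVel K.c K.F K.v (zm + ym)) (K.x + q) (K.C K.β₁ κ) z' →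
        z' = z := by
  refine K.exists_unique_free K.hl K.hβ₁.le (by linarith [K.hβ₁m, K.hmβ, K.β_pos]) K.hβ₂.le
    (by linarith [K.hβ₂m, K.hmβ, K.β_pos]) hκ (h.outMomentum_le.trans transfer_m_le) (by simpa using hq)

theorem outgoing_good {q : E n} {κ : ℝ} {z : ℝ → E n} (hκ : κ ≤ 1 / 2) (hq : ‖q‖ ≤ κ)
    (hz : IsFreeSolution K.c K.Fl atTop (outVel K.c K.F K.v (zm + ym)) (K.x + q) (K.C K.β₁ κ) z) :
    K.Good K.Fl (outVel K.c K.F K.v (zm + ym)) z := by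
  have h1 := h.outMomentum_le.trans transfer_m_le
  exact K.good_of_free K.hl K.hβ₁.le hκ (j := 1) (by norm_num) (by linarith [K.hβ₁m, K.hmβ]) h1
    (h1.trans (by linarith [K.M_pos])) (by simpa using hq) hz

omit h in
theorem norm_outVel_lt : ‖outVel K.c K.F K.v (zm + ym)‖ < K.c := norm_g_lt K.hc _

theorem hIntegrand_eq {z : ℝ → E n} (hz : K.Good K.Fl (outVel K.c K.F K.v (zm + ym)) z) (σ : ℝ) :
    hIntegrand K.c K.F K.Fl (outVel K.c K.F K.v (zm + ym)) (zm + ym) z σ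
      = deriv (zm + ym) σ - deriv z σ := by
  have hg := h.good_out
  rw [hg.sol.deriv_Ioi norm_outVel_lt hg.tend hg.int.integrableOn,
    hz.sol.deriv_Ioi norm_outVel_lt hz.tend hz.int.integrableOn, hIntegrand]

theorem hIntegrand_integrableOn {z : ℝ → E n} (hz : K.Good K.Fl (outVel K.c K.F K.v (zm + ym)) z)
    (t : ℝ) : IntegrableOn (hIntegrand K.c K.F K.Fl (outVel K.c K.F K.v (zm + ym)) (zm + ym) z)
      (Ioi t) := by
  rw [show hIntegrand K.c K.F K.Fl (outVel K.c K.F K.v (zm + ym)) (zm + ym) z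
      = fun σ => deriv (zm + ym) σ - deriv z σ from funext (h.hIntegrand_eq hz)]
  exact (h.good_out.sub_decay norm_outVel_lt hz le_rfl).1 t

theorem hFun_eq {z : ℝ → E n} (hz : K.Good K.Fl (outVel K.c K.F K.v (zm + ym)) z) (t : ℝ) :
    hFun K.c K.F K.Fl (outVel K.c K.F K.v (zm + ym)) (zm + ym) z t
      = -∫ σ in Ioi t, (deriv (zm + ym) σ - deriv z σ) := by
  unfold hFun
  simp only [h.hIntegrand_eq hz]

theorem initial_sub {q : E n} {z : ℝ → E n} (hz0 : z 0 = K.x + q) : (zm + ym) 0 - z 0 = ym 0 - q := by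
  rw [hz0, Pi.add_apply, h.free.initial]
  abel

theorem norm_ym_zero_le_r : ‖ym 0‖ ≤ 12 / 100 * K.r := by
  have h1 := h.norm_ym_zero_le
  have h2 := Φ_mul_le (K := K) (δ₀ := 1 / 2) (by norm_num)
  have := K.sM_le.2.1
  linarith

section outgoing

variable {zp : E n → ℝ → E n}
  (hzp : ∀ q, ‖q‖ ≤ 1 / 2 → K.Good K.Fl (outVel K.c K.F K.v (zm + ym)) (zp q))
  (hzp0 : ∀ q, ‖q‖ ≤ 1 / 2 → zp q 0 = K.x + q)

include hzp

/-- Both terms of the integrand of h are velocities, written through their momenta at +∞. -/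
theorem mapG_eq {q : E n} (hq : ‖q‖ ≤ 1 / 2) : mapG K.c K.F K.Fl K.v zm ym zp q
    = ym 0 + ∫ σ in Ioi 0, (deriv (zm + ym) σ - deriv (zp q) σ) := by
  unfold mapG
  rw [h.fixed, h.hFun_eq (hzp q hq), sub_neg_eq_add]

include hzp0

/-- The constant is 28 = 12 + 16: 12 for y₋(0), where the offset is at most 1/2, and 16 for the
outgoing part, where the offset y₋(0) - q is only known to be at most 1. -/
theorem norm_mapG_le {q : E n} (hq : ‖q‖ ≤ 1 / 2) : ‖mapG K.c K.F K.Fl K.v zm ym zp q‖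
    ≤ 28 * (K.s * (K.A * K.m / ((K.α + 1) * K.u)) * (K.N₀ ^ (-K.α) / (K.α * K.u))) := by
  rw [h.mapG_eq hzp hq]
  have h0 : ‖(zm + ym) 0 - zp q 0‖ ≤ 1 := by
    rw [h.initial_sub (hzp0 q hq)]
    refine (norm_sub_le _ _).trans ?_
    linarith [h.norm_ym_zero_le_r, K.hr2]
  have h1 := (h.good_out.sub_decay norm_outVel_lt (hzp q hq) h0).2 0 le_rfl
  have h2 := h.norm_ym_zero_le
  rw [mul_zero, add_zero] at h1
  refine (norm_add_le _ _).trans ((add_le_add h2 h1).trans (le_of_eq ?_))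
  unfold Φ
  ring

theorem norm_mapG_le_r {q : E n} (hq : ‖q‖ ≤ 1 / 2) :
    ‖mapG K.c K.F K.Fl K.v zm ym zp q‖ ≤ 28 / 100 * K.r := by
  have h1 := h.norm_mapG_le hzp hzp0 hq
  have h2 := decay_mul_le (K := K) (j := 1) K.m_pos.le (by linarith [K.hmβ])
  have := K.sM_le.2.1
  linarith

theorem mapG_mapsTo : MapsTo (mapG K.c K.F K.Fl K.v zm ym zp) (Metric.closedBall 0 (1 / 2))
    (Metric.closedBall 0 (1 / 2)) := fun q hq => by
  rw [mem_closedBall_zero_iff] at hq ⊢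
  have := h.norm_mapG_le_r hzp hzp0 hq
  linarith [K.hr2, K.hr]

/-- The trajectory cancels; what remains compares z₊(q,·) and z₊(q',·), which share the force and
the asymptotic velocity. The factor is at most 24r/100 < 12/100 ≤ 1/6. -/
theorem mapG_contract {q q' : E n} (hq : ‖q‖ ≤ 1 / 2) (hq' : ‖q'‖ ≤ 1 / 2) :
    ‖mapG K.c K.F K.Fl K.v zm ym zp q - mapG K.c K.F K.Fl K.v zm ym zp q'‖ ≤ 1 / 6 * ‖q - q'‖ := by
  rw [h.mapG_eq hzp hq, h.mapG_eq hzp hq', add_sub_add_left_eq_sub,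
    ← integral_sub ((h.good_out.sub_decay norm_outVel_lt (hzp q hq) le_rfl).1 0)
      ((h.good_out.sub_decay norm_outVel_lt (hzp q' hq') le_rfl).1 0)]
  have e : ∀ σ, deriv (zm + ym) σ - deriv (zp q) σ - (deriv (zm + ym) σ - deriv (zp q') σ)
      = deriv (zp q') σ - deriv (zp q) σ := fun σ => by abel
  simp only [e]
  refine ((hzp q' hq').sub_decay_same K.hl K.hβ₁.le K.hβ₂.le
    (by linarith [K.hβ₁m, K.hmβ, K.β_pos]) (by linarith [K.hβ₂m, K.hmβ, K.β_pos]) norm_outVel_lt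
    (hzp q hq) (δ₀ := ‖q - q'‖) ?_).trans ?_
  · rw [hzp0 q hq, hzp0 q' hq', add_sub_add_left_eq_sub, norm_sub_rev]
  · gcongr
    linarith [K.sM_le.2.1, K.hr2]

variable {b : E n} (hb : ‖b‖ ≤ 1 / 2) (hfix : mapG K.c K.F K.Fl K.v zm ym zp b = b)

include hb hfix

/-- At the fixed point the a priori offset 1 improves to 1/2, since |y₋(0)| and |𝒢(b)| are at most
12r/100 and 28r/100. -/
theorem outgoing_initial_le : ‖(zm + ym) 0 - zp b 0‖ ≤ 1 / 2 := by
  rw [h.initial_sub (hzp0 b hb)]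
  have := h.norm_mapG_le_r hzp hzp0 hb
  rw [hfix] at this
  refine (norm_sub_le _ _).trans ?_
  linarith [h.norm_ym_zero_le_r, K.hr2, K.hr]

/-- The limit of the position difference is 𝒢(b) - b. This identifies h(b,·) with trajectory minus
free solution. -/
theorem outgoing_tendsto : Tendsto (fun t => (zm + ym) t - zp b t) atTop (𝓝 0) := by
  have h1 := tendsto_sub_of_integrableOn h.newton.differentiable (hzp b hb).sol.differentiable
    ((h.good_out.sub_decay norm_outVel_lt (hzp b hb) le_rfl).1 0)
  rw [h.initial_sub (hzp0 b hb)] at h1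
  have h2 := h.mapG_eq hzp hb
  rw [hfix] at h2
  rwa [show ym 0 - b + ∫ τ in Ioi 0, (deriv (zm + ym) τ - deriv (zp b) τ) = 0 by
    rw [sub_add_eq_add_sub, ← h2, sub_self]] at h1

theorem hFun_eq_sub (t : ℝ) : hFun K.c K.F K.Fl (outVel K.c K.F K.v (zm + ym)) (zm + ym) (zp b) t
    = (zm + ym) t - zp b t := by
  rw [h.hFun_eq (hzp b hb), ← sub_eq_neg_integral h.newton.differentiable
    (hzp b hb).sol.differentiable
    ((h.good_out.sub_decay norm_outVel_lt (hzp b hb) le_rfl).1 t)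
    (h.outgoing_tendsto hzp hzp0 hb hfix)]

theorem hasDerivAt_hFun (t : ℝ) :
    HasDerivAt (hFun K.c K.F K.Fl (outVel K.c K.F K.v (zm + ym)) (zm + ym) (zp b))
      (deriv (zm + ym) t - deriv (zp b) t) t := by
  rw [show hFun K.c K.F K.Fl (outVel K.c K.F K.v (zm + ym)) (zm + ym) (zp b)
    = fun t => (zm + ym) t - zp b t from funext (h.hFun_eq_sub hzp hzp0 hb hfix)]
  exact (h.newton.differentiable t).hasDerivAt.sub ((hzp b hb).sol.differentiable t).hasDerivAt

theorem tendsto_hFun :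
    Tendsto (hFun K.c K.F K.Fl (outVel K.c K.F K.v (zm + ym)) (zm + ym) (zp b)) atTop (𝓝 0) := by
  rw [show hFun K.c K.F K.Fl (outVel K.c K.F K.v (zm + ym)) (zm + ym) (zp b)
    = fun t => (zm + ym) t - zp b t from funext (h.hFun_eq_sub hzp hzp0 hb hfix)]
  exact h.outgoing_tendsto hzp hzp0 hb hfix

theorem tendsto_deriv_hFun :
    Tendsto (deriv (hFun K.c K.F K.Fl (outVel K.c K.F K.v (zm + ym)) (zm + ym) (zp b))) atTop
      (𝓝 0) := by
  have h1 := h.good_out.tend.sub (hzp b hb).tend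
  rw [sub_self] at h1
  exact h1.congr fun t => ((h.hasDerivAt_hFun hzp hzp0 hb hfix t).deriv).symm

theorem norm_deriv_hFun_le {t : ℝ} (ht : 0 ≤ t) :
    ‖deriv (hFun K.c K.F K.Fl (outVel K.c K.F K.v (zm + ym)) (zm + ym) (zp b)) t‖
      ≤ 2 * K.s * K.Φ (1 / 2) * (K.N₀ + K.u * t) ^ (-(K.α + 1)) := by
  rw [(h.hasDerivAt_hFun hzp hzp0 hb hfix t).deriv]
  exact (h.good_out.compare_short norm_outVel_lt (hzp b hb)
    (h.outgoing_initial_le hzp hzp0 hb hfix) t ht).2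

end outgoing

end Incoming

end Ctx

/-! ### Replacement by the straight line and linearization of g -/

namespace Ctx

variable {K : Ctx n}

/-- The short range force along the asymptotic line. -/
def lineForce (K : Ctx n) (τ : ℝ) : E n := K.Fs (τ • K.v + K.x) K.v

theorem lineForce_tube (t : ℝ) : K.N₀ + K.u * |t| ≤ 1 + ‖t • K.v + K.x‖ := by
  apply K.tube_half
  rw [add_comm, sub_self, norm_zero]
  have := K.u_pos
  positivity

theorem continuous_lineForce : Continuous K.lineForce :=
  K.hs.cont.comp (((continuous_id.smul continuous_const).add continuous_const).prodMk continuous_const)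

theorem integrable_lineForce : Integrable K.lineForce :=
  (K.hs.integrable (γ := fun τ => τ • K.v + K.x) (w := fun _ => K.v) (by linarith [K.hα]) K.N₀_half
    K.u_pos (by fun_prop) continuous_const (fun _ => K.hv.le) lineForce_tube).1

theorem norm_integral_lineForce_le {t : ℝ} (ht : 0 ≤ t) :
    ‖∫ τ in Ioi t, K.lineForce τ‖
      ≤ 2 * K.A * K.β₂ / ((K.α + 1) * K.u) * (K.N₀ + K.u * t) ^ (-(K.α + 1)) := by
  have hα1 : 0 < K.α + 1 := by linarith [K.hα]
  have h := integral_weight hα1 K.u_pos (K.weight_pos ht)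
  refine (norm_integral_le_of_norm_le
    ((integrableOn_weight hα1 K.u_pos (K.weight_pos ht)).const_mul (2 * K.A * K.β₂)) ?_).trans ?_
  · filter_upwards [ae_restrict_mem measurableSet_Ioi] with τ hτ
    have hτ0 : 0 < τ := ht.trans_lt hτ
    have := K.hs.bound (τ • K.v + K.x) K.v (K.N₀ + K.u * |τ|)
      (by nlinarith [K.N₀_half, abs_nonneg τ, K.u_pos]) K.hv.le (lineForce_tube τ)
    rwa [abs_of_pos hτ0] at this
  · rw [integral_const_mul, h]
    apply le_of_eq
    ring

theorem integrableOn_integral_lineForce :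
    IntegrableOn (fun σ => ∫ τ in Ioi σ, K.lineForce τ) (Ioi 0) :=
  K.integrableOn_of_decay (continuous_iff_continuousAt.2 fun t =>
    (hasDerivAt_integral_Ioi continuous_lineForce (t₀ := 0)
      integrable_lineForce.integrableOn t).continuousAt)
    (fun _ ht => norm_integral_lineForce_le ht) 0

theorem integral_lineForce_rev (K : Ctx n) (t : ℝ) :
    ∫ τ in Ioi (-t), K.rev.lineForce τ = ∫ τ in Iic t, K.lineForce τ := by
  rw [integral_Iic_eq]
  congr 1
  ext1 τ
  simp [lineForce, rev, revForce]

/-- The coefficient of the quadratic error. -/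
noncomputable def Θ (K : Ctx n) : ℝ :=
  144 * (K.A * K.β) * (K.s * K.M) * ((1 + 1 / K.u) * (1 + 1 / K.c))

theorem rev_Θ (K : Ctx n) : K.rev.Θ = K.Θ := by
  simp [Θ, rev_s, rev_M, rev_u]

theorem norm_dg_apply_le (K : Ctx n) (q : E n) : ‖dg K.c K.p q‖ ≤ K.s * ‖q‖ := by
  rw [← K.glor_p]
  exact RelNewton.norm_dg_apply_le K.hc _ _

/-- A solution `Y` for the full force and a solution `Z` for `Fl`, both close to the line. -/
structure Pair (K : Ctx n) (w : E n) (Y Z : ℝ → E n) : Prop where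
  hw : ‖w‖ < K.c
  hY : K.Good K.F w Y
  hZ : K.Good K.Fl w Z
  vel : ∀ t, ‖deriv Y t - K.v‖ ≤ 24 * (K.s * K.M)
  init : ‖Y 0 - K.x‖ ≤ 12 * (K.s * K.M * (1 / K.u))
  init' : ‖Y 0 - Z 0‖ ≤ 12 * (K.s * K.M * (1 / K.u))

namespace Pair

variable {w : E n} {Y Z : ℝ → E n} (h : K.Pair w Y Z)

include h

theorem init_half : ‖Y 0 - Z 0‖ ≤ 1 / 2 := by
  have := h.init'
  linarith [K.sM_le.2.1, K.hr2, K.hr]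

theorem momentum (t : ℝ) (ht : 0 ≤ t) :
    ∫ τ in Ioi t, ‖along K.F Y τ - along K.Fl Z τ‖
      ≤ K.Φ (1 / 2) * (K.N₀ + K.u * t) ^ (-(K.α + 1)) :=
  (h.hY.compare_short h.hw h.hZ h.init_half t ht).1

theorem velocity (t : ℝ) (ht : 0 ≤ t) : ‖deriv Y t - deriv Z t‖
    ≤ 2 * K.s * K.Φ (1 / 2) * (K.N₀ + K.u * t) ^ (-(K.α + 1)) :=
  (h.hY.compare_short h.hw h.hZ h.init_half t ht).2

theorem sub_le (t : ℝ) (ht : 0 ≤ t) : ‖Y t - Z t‖ ≤ 24 * (K.s * K.M * (1 / K.u)) := by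
  have hcd : Continuous fun τ => deriv Y τ - deriv Z τ :=
    h.hY.sol.continuous_deriv.sub h.hZ.sol.continuous_deriv
  have e : Y t - Z t = (Y 0 - Z 0) + ∫ τ in (0 : ℝ)..t, (deriv Y τ - deriv Z τ) := by
    rw [eq_integral_deriv h.hY.sol.differentiable h.hY.sol.continuous_deriv t,
      eq_integral_deriv h.hZ.sol.differentiable h.hZ.sol.continuous_deriv t,
      intervalIntegral.integral_sub (h.hY.sol.continuous_deriv.intervalIntegrable _ _)
        (h.hZ.sol.continuous_deriv.intervalIntegrable _ _)]
    abel
  have hs := K.s_pos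
  have hΦ := K.Φ_pos (δ₀ := 1 / 2) (by norm_num)
  have hi : IntegrableOn (fun τ => 2 * K.s * K.Φ (1 / 2) * (K.N₀ + K.u * τ) ^ (-(K.α + 1))) (Ioi 0) :=
    (integrableOn_weight K.hα K.u_pos (K.weight_pos le_rfl)).const_mul _
  have h1 : ‖∫ τ in (0 : ℝ)..t, (deriv Y τ - deriv Z τ)‖ ≤ 12 * (K.s * K.M * (1 / K.u)) := by
    refine (intervalIntegral.norm_integral_le_integral_norm ht).trans ?_
    rw [intervalIntegral.integral_of_le ht]
    have h2 : ∫ τ in Ioc 0 t, ‖deriv Y τ - deriv Z τ‖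
        ≤ ∫ τ in Ioc 0 t, 2 * K.s * K.Φ (1 / 2) * (K.N₀ + K.u * τ) ^ (-(K.α + 1)) :=
      setIntegral_mono_on (hcd.norm.integrableOn_Icc.mono_set Ioc_subset_Icc_self)
        (hi.mono_set Ioc_subset_Ioi_self) measurableSet_Ioc fun τ hτ => h.velocity τ hτ.1.le
    have h3 : ∫ τ in Ioc 0 t, 2 * K.s * K.Φ (1 / 2) * (K.N₀ + K.u * τ) ^ (-(K.α + 1))
        ≤ ∫ τ in Ioi 0, 2 * K.s * K.Φ (1 / 2) * (K.N₀ + K.u * τ) ^ (-(K.α + 1)) := by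
      refine setIntegral_mono_set hi ?_ Ioc_subset_Ioi_self.eventuallyLE
      filter_upwards [ae_restrict_mem measurableSet_Ioi] with τ hτ
      have := K.weight_pos (le_of_lt hτ)
      positivity
    refine (h2.trans h3).trans ?_
    rw [integral_const_mul, integral_weight K.hα K.u_pos (K.weight_pos le_rfl), mul_zero, add_zero]
    have := Φ_mul_le (K := K) (δ₀ := 1 / 2) (by norm_num)
    linarith
  rw [e]
  refine (norm_add_le _ _).trans ?_
  linarith [h.init']

theorem line_le (t : ℝ) (ht : 0 ≤ t) :
    ‖Y t - (t • K.v + K.x)‖ ≤ 12 * (K.s * K.M * (1 / K.u)) + 24 * (K.s * K.M) * t := by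
  have h1 := norm_integral_sub_smul_le h.hY.sol.continuous_deriv h.vel t
  rw [abs_of_nonneg ht] at h1
  rw [eq_integral_deriv h.hY.sol.differentiable h.hY.sol.continuous_deriv t,
    show Y 0 + (∫ τ in (0 : ℝ)..t, deriv Y τ) - (t • K.v + K.x)
      = (Y 0 - K.x) + ((∫ τ in (0 : ℝ)..t, deriv Y τ) - t • K.v) by abel]
  exact (norm_add_le _ _).trans (add_le_add h.init h1)

/-- F^l sees the displacement and the velocity difference of Y and Z; F^s sees those between Y and
the line. Each is at most a multiple of sM, up to the linear growth in t of the distance from the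
line, which the faster decay of the derivatives of F^s absorbs. -/
theorem diff_le (t : ℝ) (ht : 0 < t) :
    ‖along K.F Y t - along K.Fl Z t - K.lineForce t‖ ≤ K.Θ * (K.N₀ + K.u * t) ^ (-(K.α + 1 + 1)) := by
  have hβ₁ : K.β₁ ≤ K.β := K.hβ₁m.trans K.hmβ
  have hβ₂ : K.β₂ ≤ K.β := K.hβ₂m.trans K.hmβ
  have hA := K.hA
  have hβ := K.β_pos
  have hβ₂0 := K.hβ₂
  have hs := K.s_pos
  have hM := K.M_pos
  have hu := K.u_pos
  have hc := K.hc
  have hα := K.hα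
  have hN := K.weight_pos ht.le
  have hNh : 1 / 2 ≤ K.N₀ + K.u * t := by nlinarith [K.N₀_half]
  have h1 := h.hY.lip (ForceBound.mono K.hc K.hA.le K.hl hβ₁ hβ₂) h.hZ t
  rw [abs_of_pos ht, show K.α + 2 = K.α + 1 + 1 by ring] at h1
  have h2 := K.hs.lip (t • K.v + K.x) (Y t) K.v (deriv Y t) (K.N₀ + K.u * t) hNh K.hv.le
    (h.hY.sol.speed_lt t).le (fun ξ hξ => by
      have := K.tube_half (t := t) (segment_sub_smul_le (a := K.x + t • K.v) (by
        rw [add_comm, sub_self, norm_zero]; positivity) (h.hY.tube t) hξ)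
      rwa [abs_of_pos ht] at this)
  rw [show K.α + 1 + 2 = K.α + 1 + 1 + 1 by ring] at h2
  have e : along K.F Y t - along K.Fl Z t - K.lineForce t
      = (along K.Fl Y t - along K.Fl Z t)
        + (K.Fs (Y t) (deriv Y t) - K.Fs (t • K.v + K.x) K.v) := by
    simp only [along, F, Pi.add_apply, lineForce]
    abel
  rw [e]
  have hΔ := h.sub_le t ht.le
  have hη := h.velocity t ht.le
  have hl := h.line_le t ht.le
  have hv := h.vel t
  have w1 := rpow_weight_succ_le (p := K.α + 1 + 1) hNh
  have w2 := mul_weight_le (p := K.α + 1 + 1) hu K.N₀_pos ht.le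
  have hΦ := Φ_mul_le' (K := K) (δ₀ := 1 / 2) (by norm_num)
  have w3 : (K.N₀ + K.u * t) ^ (-(K.α + 1)) * (2 * K.s * K.Φ (1 / 2) * (K.N₀ + K.u * t) ^ (-(K.α + 1)))
      ≤ 12 * (K.s * K.M) * (K.N₀ + K.u * t) ^ (-(K.α + 1 + 1)) := by
    have e1 : (K.N₀ + K.u * t) ^ (-(K.α + 1)) * (K.N₀ + K.u * t) ^ (-(K.α + 1))
        = (K.N₀ + K.u * t) ^ (-K.α) * (K.N₀ + K.u * t) ^ (-(K.α + 1 + 1)) := by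
      rw [← Real.rpow_add hN, ← Real.rpow_add hN]
      ring_nf
    have e2 : (K.N₀ + K.u * t) ^ (-K.α) ≤ K.N₀ ^ (-K.α) :=
      rpow_weight_le K.N₀_pos (by nlinarith) hα.le
    have hΦ0 := K.Φ_pos (δ₀ := 1 / 2) (by norm_num)
    calc _ = 2 * K.s * K.Φ (1 / 2)
          * ((K.N₀ + K.u * t) ^ (-(K.α + 1)) * (K.N₀ + K.u * t) ^ (-(K.α + 1))) := by ring
      _ = 2 * K.s * K.Φ (1 / 2) * (K.N₀ + K.u * t) ^ (-K.α) * (K.N₀ + K.u * t) ^ (-(K.α + 1 + 1)) := by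
          rw [e1]; ring
      _ ≤ 2 * K.s * K.Φ (1 / 2) * K.N₀ ^ (-K.α) * (K.N₀ + K.u * t) ^ (-(K.α + 1 + 1)) := by
          have h0 : 0 ≤ 2 * K.s * K.Φ (1 / 2) := by positivity
          exact mul_le_mul_of_nonneg_right (mul_le_mul_of_nonneg_left e2 h0) (by positivity)
      _ ≤ _ := by
          refine mul_le_mul_of_nonneg_right ?_ (by positivity)
          linarith
  set W := (K.N₀ + K.u * t) ^ (-(K.α + 1 + 1)) with hW
  set W1 := (K.N₀ + K.u * t) ^ (-(K.α + 1)) with hW1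
  set W2 := (K.N₀ + K.u * t) ^ (-(K.α + 1 + 1 + 1)) with hW2
  have hW0 : 0 < W := by positivity
  have hW10 : 0 < W1 := by positivity
  have hW20 : 0 < W2 := by positivity
  set k := K.s * K.M with hk
  have hk0 : 0 < k := by positivity
  refine (norm_add_le _ _).trans ((add_le_add h1 h2).trans ?_)
  calc _ ≤ (2 * K.A * K.β * W * (24 * (k * (1 / K.u)))
          + K.A * K.β / K.c * W1 * (2 * K.s * K.Φ (1 / 2) * W1))
        + (2 * K.A * K.β * W2 * (12 * (k * (1 / K.u)) + 24 * k * t)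
          + K.A * K.β / K.c * W * (24 * k)) := by gcongr
    -- Collecting terms: 48 + 48 + 48 = 144 in front of 1/u and 12 + 24 = 36 in front of 1/c.
    _ = 2 * K.A * K.β * W * (24 * (k * (1 / K.u)))
        + K.A * K.β / K.c * (W1 * (2 * K.s * K.Φ (1 / 2) * W1))
        + (2 * K.A * K.β * (12 * (k * (1 / K.u))) * W2 + 2 * K.A * K.β * (24 * k) * (t * W2)
          + K.A * K.β / K.c * W * (24 * k)) := by ring
    _ ≤ 2 * K.A * K.β * W * (24 * (k * (1 / K.u)))
        + K.A * K.β / K.c * (12 * k * W)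
        + (2 * K.A * K.β * (12 * (k * (1 / K.u))) * (2 * W) + 2 * K.A * K.β * (24 * k) * (W / K.u)
          + K.A * K.β / K.c * W * (24 * k)) := by gcongr
    _ = K.A * K.β * k * W * (144 * (1 / K.u) + 36 * (1 / K.c)) := by ring
    _ ≤ K.A * K.β * k * W * (144 * ((1 + 1 / K.u) * (1 + 1 / K.c))) := by
        gcongr
        have hu' : 0 < 1 / K.u := one_div_pos.2 hu
        have hc' : 0 < 1 / K.c := one_div_pos.2 hc
        nlinarith [mul_pos hu' hc']
    _ = _ := by unfold Θ; ring

theorem integral_diff_le (t : ℝ) (ht : 0 ≤ t) :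
    ‖(∫ τ in Ioi t, (along K.F Y τ - along K.Fl Z τ)) - ∫ τ in Ioi t, K.lineForce τ‖
      ≤ K.Θ / ((K.α + 1) * K.u) * (K.N₀ + K.u * t) ^ (-(K.α + 1)) := by
  have hα1 : 0 < K.α + 1 := by linarith [K.hα]
  have hi : IntegrableOn (fun τ => along K.F Y τ - along K.Fl Z τ) (Ioi t) :=
    (h.hY.int.sub h.hZ.int).integrableOn
  rw [← integral_sub hi integrable_lineForce.integrableOn]
  refine (norm_integral_le_of_norm_le
    ((integrableOn_weight hα1 K.u_pos (K.weight_pos ht)).const_mul K.Θ) ?_).trans ?_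
  · filter_upwards [ae_restrict_mem measurableSet_Ioi] with τ hτ
    exact h.diff_le τ (ht.trans_lt hτ)
  · rw [integral_const_mul, integral_weight hα1 K.u_pos (K.weight_pos ht)]
    apply le_of_eq
    ring

theorem norm_integral_le : ‖∫ τ in Ioi 0, (along K.F Y τ - along K.Fl Z τ)‖
    ≤ K.Φ (1 / 2) * K.N₀ ^ (-(K.α + 1)) := by
  have := h.momentum 0 le_rfl
  rw [mul_zero, add_zero] at this
  exact (norm_integral_le_integral_norm _).trans this

/-- Linearization of the total velocity difference. -/
theorem norm_integral_deriv_add_le :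
    ‖(∫ σ in Ioi 0, (deriv Y σ - deriv Z σ))
        + dg K.c K.p (∫ σ in Ioi 0, ∫ τ in Ioi σ, K.lineForce τ)‖
      ≤ (96 * K.s ^ 2 / K.c * K.M * K.Φ (1 / 2) + K.s * (K.Θ / ((K.α + 1) * K.u)))
        * (K.N₀ ^ (-K.α) / (K.α * K.u)) := by
  have hc := K.hc
  have hM := K.M_pos
  have hs := K.s_pos
  rw [← ContinuousLinearMap.integral_comp_comm _ integrableOn_integral_lineForce,
    ← integral_add ((h.hY.sub_decay h.hw h.hZ le_rfl).1 0)
      ((dg K.c K.p).integrable_comp integrableOn_integral_lineForce)]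
  have key : ∀ σ, 0 ≤ σ → ‖deriv Y σ - deriv Z σ + dg K.c K.p (∫ τ in Ioi σ, K.lineForce τ)‖
      ≤ (96 * K.s ^ 2 / K.c * K.M * K.Φ (1 / 2) + K.s * (K.Θ / ((K.α + 1) * K.u)))
        * (K.N₀ + K.u * σ) ^ (-(K.α + 1)) := by
    intro σ hσ
    set D := ∫ τ in Ioi σ, (along K.F Y τ - along K.Fl Z τ) with hD
    have hmom : gInv K.c (deriv Y σ) - gInv K.c (deriv Z σ) = -D := by
      rw [h.hY.sol.gInv_deriv_Ioi h.hw h.hY.tend h.hY.int.integrableOn,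
        h.hZ.sol.gInv_deriv_Ioi h.hw h.hZ.tend h.hZ.int.integrableOn, hD,
        integral_sub h.hY.int.integrableOn h.hZ.int.integrableOn]
      abel
    have h1 := norm_g_sub_sub_dg_le K.hc (p := K.p) (ρ := 16 * K.M)
      (le_trans (by linarith) K.M_le_norm_p) (h.hY.mom σ) (h.hZ.mom σ)
    rw [g_gInv (h.hY.sol.speed_lt σ), g_gInv (h.hZ.sol.speed_lt σ), hmom, norm_neg, K.glor_p] at h1
    have h2 : ‖D‖ ≤ K.Φ (1 / 2) * (K.N₀ + K.u * σ) ^ (-(K.α + 1)) :=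
      (norm_integral_le_integral_norm _).trans (h.momentum σ hσ)
    have h3 := h.integral_diff_le σ hσ
    rw [← hD] at h3
    -- The momentum difference at σ is -D, since the momentum is integrated backwards from +∞; hence
    -- the plus sign in front of dg.
    have e : deriv Y σ - deriv Z σ + dg K.c K.p (∫ τ in Ioi σ, K.lineForce τ)
        = (deriv Y σ - deriv Z σ - dg K.c K.p (-D))
          - dg K.c K.p (D - ∫ τ in Ioi σ, K.lineForce τ) := by
      rw [map_sub, map_neg]
      abel
    rw [e]
    refine (norm_sub_le _ _).trans ?_
    have h4 := K.norm_dg_apply_le (D - ∫ τ in Ioi σ, K.lineForce τ)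
    calc _ ≤ 6 * K.s ^ 2 / K.c * (16 * K.M) * (K.Φ (1 / 2) * (K.N₀ + K.u * σ) ^ (-(K.α + 1)))
          + K.s * (K.Θ / ((K.α + 1) * K.u) * (K.N₀ + K.u * σ) ^ (-(K.α + 1))) := by
          refine add_le_add (h1.trans ?_) (h4.trans ?_) <;> gcongr
      _ = _ := by ring
  have := K.norm_integral_le_of_decay key le_rfl
  rwa [mul_zero, add_zero] at this

end Pair

namespace Incoming

variable {zm ym : ℝ → E n} (h : K.Incoming zm ym)

include h

theorem norm_ym_zero_le_unit : ‖ym 0‖ ≤ 12 * (K.s * K.M * (1 / K.u)) := by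
  have h1 := h.norm_ym_zero_le
  have h2 := Φ_mul_le (K := K) (δ₀ := 1 / 2) (by norm_num)
  linarith

theorem pair_rev : K.rev.Pair K.rev.v (fun t => (zm + ym) (-t)) (fun t => zm (-t)) where
  hw := K.rev.hv
  hY := h.good
  hZ := rev_good h.free
  vel t := by
    rw [deriv_comp_neg', rev_s, rev_M, rev_v,
      show -deriv (zm + ym) (-t) - -K.v = -(deriv (zm + ym) (-t) - K.v) by abel, norm_neg]
    exact h.norm_deriv_sub_le _
  init := by
    rw [rev_s, rev_M, rev_u]
    simp only [neg_zero, Pi.add_apply, rev_x, h.free.initial, add_sub_cancel_left]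
    exact h.norm_ym_zero_le_unit
  init' := by
    rw [rev_s, rev_M, rev_u]
    simp only [neg_zero, Pi.add_apply, add_sub_cancel_left]
    exact h.norm_ym_zero_le_unit

theorem pair {z : ℝ → E n} (hz : K.Good K.Fl (outVel K.c K.F K.v (zm + ym)) z)
    (h0 : ‖(zm + ym) 0 - z 0‖ ≤ 12 * (K.s * K.M * (1 / K.u))) :
    K.Pair (outVel K.c K.F K.v (zm + ym)) (zm + ym) z where
  hw := norm_outVel_lt
  hY := h.good_out
  hZ := hz
  vel := h.norm_deriv_sub_le
  init := by
    simp only [Pi.add_apply, h.free.initial, add_sub_cancel_left]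
    exact h.norm_ym_zero_le_unit
  init' := h0

omit h in
theorem integral_rev : ∫ τ in Ioi 0, (along K.rev.F (fun t => (zm + ym) (-t)) τ
      - along K.rev.Fl (fun t => zm (-t)) τ)
    = ∫ τ in Iic 0, (along K.F (zm + ym) τ - along K.Fl zm τ) := by
  rw [integral_Iic_eq, neg_zero]
  simp only [show K.rev.F = revForce K.F from rfl, show K.rev.Fl = revForce K.Fl from rfl, along_rev]

/-- Both ã and v + W̃ are g of momenta within 12M of p, whose difference is the sum of the half-line
differences `Dm` and `Dp`. Only velocities need to be asymptotic, so z₊(0,·) is admissible with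
initial offset y₋(0). By `hlf`, dg(p) acts on the line integral as multiplication by s. -/
theorem outVel_error (hlf : inner ℝ K.v (∫ τ, K.lineForce τ) = 0) {z : ℝ → E n}
    (hz : K.Good K.Fl (outVel K.c K.F K.v (zm + ym)) z) (hz0 : z 0 = K.x) :
    ‖(outVel K.c K.F K.v (zm + ym) - K.v) - tildeW K.c K.Fl K.v zm z - K.s • ∫ τ, K.lineForce τ‖
      ≤ (144 * K.s ^ 2 / K.c * K.M * K.Φ (1 / 2) + 2 * K.s * (K.Θ / ((K.α + 1) * K.u)))
        * K.N₀ ^ (-(K.α + 1)) := by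
  have hc := K.hc
  have hM := K.M_pos
  have hs := K.s_pos
  have hX := h.integrable.1
  have hzm := zm_integrable h.free
  have hP := h.pair hz (by
    simp only [Pi.add_apply, h.free.initial, hz0, add_sub_cancel_left]
    exact h.norm_ym_zero_le_unit)
  have hR := h.pair_rev
  have a1 := hR.norm_integral_le
  have a2 := hP.norm_integral_le
  have a3 := hR.integral_diff_le 0 le_rfl
  have a4 := hP.integral_diff_le 0 le_rfl
  have e0 := K.integral_lineForce_rev 0
  rw [neg_zero] at e0
  rw [integral_rev, rev_Φ, rev_N₀, rev_α] at a1
  rw [integral_rev, e0, rev_Θ, rev_N₀, rev_α, rev_u, mul_zero, add_zero] at a3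
  rw [mul_zero, add_zero] at a4
  set Dm := ∫ τ in Iic 0, (along K.F (zm + ym) τ - along K.Fl zm τ) with hDm
  set Dp := ∫ τ in Ioi 0, (along K.F (zm + ym) τ - along K.Fl z τ) with hDp
  set J := (∫ τ in Iic 0, along K.Fl zm τ) + ∫ τ in Ioi 0, along K.Fl z τ with hJ
  have hIJ : (∫ τ, along K.F (zm + ym) τ) - J = Dm + Dp := by
    rw [hDm, hDp, hJ, integral_sub hX.integrableOn hzm.1.integrableOn,
      integral_sub hX.integrableOn hz.int.integrableOn,
      ← intervalIntegral.integral_Iic_add_Ioi (b := 0) hX.integrableOn hX.integrableOn]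
    abel
  have hline : ∫ τ, K.lineForce τ = (∫ τ in Iic 0, K.lineForce τ) + ∫ τ in Ioi 0, K.lineForce τ :=
    (intervalIntegral.integral_Iic_add_Ioi integrable_lineForce.integrableOn
      integrable_lineForce.integrableOn).symm
  have hdg : dg K.c K.p (∫ τ, K.lineForce τ) = K.s • ∫ τ, K.lineForce τ := by
    rw [dg_apply, K.g_p, hlf, K.glor_p]
    simp
  have m1 : ‖(K.p + ∫ τ, along K.F (zm + ym) τ) - K.p‖ ≤ 12 * K.M := h.outMomentum_le.trans transfer_m_le
  have m2 : ‖(K.p + J) - K.p‖ ≤ 12 * K.M := by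
    have hzi := K.integrable_of_tube K.hl le_rfl hz.sol hz.tube
    have t1 := K.transfer_le (κ := 1 / 2) (j := 1) le_rfl K.hβ₁.le (by linarith [K.hβ₁m, K.hmβ])
    have t2 := (norm_setIntegral_le_integral hzi.1 (Ioi 0)).trans hzi.2
    have t3 := (norm_setIntegral_le_integral hzm.1 (Iic 0)).trans hzm.2
    rw [add_sub_cancel_left]
    refine (norm_add_le _ _).trans ?_
    linarith
  have hlin := norm_g_sub_sub_dg_le K.hc (p := K.p) (ρ := 12 * K.M)
    (le_trans (by linarith) K.M_le_norm_p) m1 m2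
  rw [add_sub_add_left_eq_sub, hIJ, K.glor_p] at hlin
  have e : (outVel K.c K.F K.v (zm + ym) - K.v) - tildeW K.c K.Fl K.v zm z - K.s • ∫ τ, K.lineForce τ
      = (g K.c (K.p + ∫ τ, along K.F (zm + ym) τ) - g K.c (K.p + J) - dg K.c K.p (Dm + Dp))
        + dg K.c K.p ((Dm - ∫ τ in Iic 0, K.lineForce τ) + (Dp - ∫ τ in Ioi 0, K.lineForce τ)) := by
    rw [← hdg, hline, tildeW, outVel, add_assoc, ← hJ, show K.p = gInv K.c K.v from rfl]
    simp only [map_add, map_sub]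
    abel
  rw [e]
  refine (norm_add_le _ _).trans ?_
  have h4 := K.norm_dg_apply_le
    ((Dm - ∫ τ in Iic 0, K.lineForce τ) + (Dp - ∫ τ in Ioi 0, K.lineForce τ))
  calc _ ≤ 6 * K.s ^ 2 / K.c * (12 * K.M) * (K.Φ (1 / 2) * K.N₀ ^ (-(K.α + 1))
            + K.Φ (1 / 2) * K.N₀ ^ (-(K.α + 1)))
          + K.s * (K.Θ / ((K.α + 1) * K.u) * K.N₀ ^ (-(K.α + 1))
            + K.Θ / ((K.α + 1) * K.u) * K.N₀ ^ (-(K.α + 1))) := by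
        refine add_le_add (hlin.trans ?_) (h4.trans ?_)
        · gcongr
          exact (norm_add_le _ _).trans (add_le_add a1 a2)
        · gcongr
          exact (norm_add_le _ _).trans (add_le_add a3 a4)
    _ = _ := by ring

omit h in
theorem integral_Iic_lineForce_rev : ∫ σ in Ioi 0, ∫ τ in Ioi σ, K.rev.lineForce τ
    = ∫ σ in Iic 0, ∫ τ in Iic σ, K.lineForce τ := by
  rw [integral_Iic_eq, neg_zero]
  congr 1
  ext1 σ
  rw [← integral_lineForce_rev, neg_neg]

/-- The fixed point b is y₋(0) plus the outgoing integral of velocity differences, and y₋(0) is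
minus such an integral for the reversed pair. Linearizing each half gives the two double integrals
and the factor 2. -/
theorem position_error {zp : E n → ℝ → E n}
    (hzp : ∀ q, ‖q‖ ≤ 1 / 2 → K.Good K.Fl (outVel K.c K.F K.v (zm + ym)) (zp q))
    (hzp0 : ∀ q, ‖q‖ ≤ 1 / 2 → zp q 0 = K.x + q) {b : E n} (hb : ‖b‖ ≤ 1 / 2)
    (hfix : mapG K.c K.F K.Fl K.v zm ym zp b = b) :
    ‖b - dg K.c K.p ((∫ σ in Iic 0, ∫ τ in Iic σ, K.lineForce τ)
        - ∫ σ in Ioi 0, ∫ τ in Ioi σ, K.lineForce τ)‖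
      ≤ 2 * ((96 * K.s ^ 2 / K.c * K.M * K.Φ (1 / 2) + K.s * (K.Θ / ((K.α + 1) * K.u)))
        * (K.N₀ ^ (-K.α) / (K.α * K.u))) := by
  have hz := hzp b hb
  have hdec := (h.good_out.sub_decay norm_outVel_lt hz (h.outgoing_initial_le hzp hzp0 hb hfix))
  have h0 : (zm + ym) 0 - zp b 0 = -∫ τ in Ioi 0, (deriv (zm + ym) τ - deriv (zp b) τ) :=
    sub_eq_neg_integral h.newton.differentiable hz.sol.differentiable (hdec.1 0)
      (h.outgoing_tendsto hzp hzp0 hb hfix)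
  have hP := h.pair hz (by
    rw [h0, norm_neg]
    have h1 := hdec.2 0 le_rfl
    rw [mul_zero, add_zero] at h1
    have h2 := Φ_mul_le (K := K) (δ₀ := 1 / 2) (by norm_num)
    linarith)
  have hR := h.pair_rev
  have a1 := hR.norm_integral_deriv_add_le
  have a2 := hP.norm_integral_deriv_add_le
  rw [integral_Iic_lineForce_rev, rev_p, dg_neg, rev_Φ, rev_N₀, rev_α, rev_u, rev_Θ, rev_s, rev_M,
    rev_c] at a1
  have hym : ∫ σ in Ioi 0, (deriv (fun t => (zm + ym) (-t)) σ - deriv (fun t => zm (-t)) σ) = -ym 0 := by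
    have hZ := rev_good h.free
    have h1 := sub_eq_neg_integral (t := 0) h.good.sol.differentiable hZ.sol.differentiable
      ((h.good.sub_decay K.rev.hv hZ hR.init_half).1 0) (by
        have := h.tendsto_ym.comp tendsto_neg_atTop_atBot
        simpa [Function.comp_def] using this)
    simp only [neg_zero, Pi.add_apply, add_sub_cancel_left] at h1
    rw [h1, neg_neg]
    rfl
  rw [hym] at a1
  have hbe : b = ym 0 + ∫ σ in Ioi 0, (deriv (zm + ym) σ - deriv (zp b) σ) := by
    conv_lhs => rw [← hfix]
    exact h.mapG_eq hzp hb
  set I := ∫ σ in Ioi 0, (deriv (zm + ym) σ - deriv (zp b) σ) with hI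
  set Lm := ∫ σ in Iic 0, ∫ τ in Iic σ, K.lineForce τ with hLm
  set Lp := ∫ σ in Ioi 0, ∫ τ in Ioi σ, K.lineForce τ with hLp
  have e : b - dg K.c K.p (Lm - Lp) = (I + dg K.c K.p Lp) - (-ym 0 + dg K.c K.p Lm) := by
    rw [hbe, map_sub]
    abel
  rw [e]
  refine (norm_sub_le _ _).trans ?_
  linarith

end Incoming

end Ctx

/-! ### Work of the short range force along the line -/

theorem inner_mulVec_self_of_antisymm {M : Matrix (Fin n) (Fin n) ℝ} (hM : ∀ i k, M k i = -M i k)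
    (v : E n) : inner ℝ v (WithLp.toLp 2 (M.mulVec v.ofLp) : E n) = 0 := by
  have e : inner ℝ v (WithLp.toLp 2 (M.mulVec v.ofLp) : E n) = ∑ i, ∑ k, v i * M i k * v k := by
    rw [PiLp.inner_apply]
    refine Finset.sum_congr rfl fun i _ => ?_
    simp only [Matrix.mulVec, dotProduct, RCLike.inner_apply, conj_trivial, Finset.sum_mul]
    exact Finset.sum_congr rfl fun k _ => by ring
  have e' : ∑ i, ∑ k, v i * M i k * v k = -∑ i, ∑ k, v i * M i k * v k := by
    conv_lhs => rw [Finset.sum_comm]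
    rw [← Finset.sum_neg_distrib]
    refine Finset.sum_congr rfl fun i _ => ?_
    rw [← Finset.sum_neg_distrib]
    exact Finset.sum_congr rfl fun k _ => by rw [hM i k]; ring
  rw [e]
  linarith

namespace Ctx

variable {K : Ctx n}

theorem integrableOn_integral_lineForce_Iic :
    IntegrableOn (fun σ => ∫ τ in Iic σ, K.lineForce τ) (Iic 0) := by
  have h := K.rev.integrableOn_integral_lineForce
  have e : (fun σ => ∫ τ in Ioi σ, K.rev.lineForce τ) = fun σ => ∫ τ in Iic (-σ), K.lineForce τ :=
    funext fun σ => by rw [← integral_lineForce_rev, neg_neg]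
  rw [e] at h
  have h2 := integrableOn_Iic_of_comp_neg (f := fun σ => ∫ τ in Iic σ, K.lineForce τ) (t := 0)
    (by rw [neg_zero]; exact h)
  exact h2

section potential

variable {V : E n → ℝ} {B : E n → Matrix (Fin n) (Fin n) ℝ} {b₀ b₁ b₂ : ℝ}
  (hV : FieldBounds (K.α + 1) b₀ b₁ b₂ V B)

include hV

theorem abs_potential_line_le (t : ℝ) :
    |V (t • K.v + K.x)| ≤ b₀ * (K.N₀ + K.u * |t|) ^ (-(K.α + 1)) := by
  have hN : 0 < K.N₀ + K.u * |t| := K.weight_pos (abs_nonneg t)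
  have hb : 0 ≤ b₀ := by
    have := (abs_nonneg _).trans (hV.V_zero 0)
    rw [norm_zero, add_zero, Real.one_rpow, mul_one] at this
    exact this
  exact (hV.V_zero _).trans (mul_le_mul_of_nonneg_left
    (rpow_weight_le hN (lineForce_tube t) (by linarith [K.hα])) hb)

theorem continuous_potential_line : Continuous fun t : ℝ => V (t • K.v + K.x) :=
  hV.contDiff_V.continuous.comp (by fun_prop)

theorem integrable_potential_line : Integrable fun t : ℝ => V (t • K.v + K.x) :=
  ((integrable_weight_abs K.hα K.u_pos K.N₀_pos).const_mul b₀).mono'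
    (continuous_potential_line hV).aestronglyMeasurable
    (Eventually.of_forall fun t => abs_potential_line_le hV t)

theorem tendsto_potential_line : Tendsto (fun t : ℝ => V (t • K.v + K.x)) (cocompact ℝ) (𝓝 0) := by
  have h1 : Tendsto (fun t : ℝ => K.N₀ + K.u * |t|) (cocompact ℝ) atTop :=
    tendsto_atTop_add_const_left _ _ (tendsto_norm_cocompact_atTop.const_mul_atTop K.u_pos)
  have h2 := ((tendsto_rpow_neg_atTop (show 0 < K.α + 1 by linarith [K.hα])).comp h1).const_mul b₀
  rw [mul_zero] at h2
  exact squeeze_zero_norm (fun t => abs_potential_line_le hV t) h2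

variable (hFs : K.Fs = force K.c V B)

include hFs

/-- The magnetic part does no work, so V^s is the potential of the component of the force along v.
-/
theorem hasDerivAt_potential_line (t : ℝ) :
    HasDerivAt (fun t : ℝ => V (t • K.v + K.x)) (-inner ℝ K.v (K.lineForce t)) t := by
  have h1 : HasFDerivAt V (fderiv ℝ V (t • K.v + K.x)) (t • K.v + K.x) :=
    (hV.contDiff_V.differentiable (by norm_num) _).hasFDerivAt
  have h2 : HasDerivAt (fun t : ℝ => t • K.v + K.x) K.v t := by
    simpa using ((hasDerivAt_id t).smul_const K.v).add_const K.x
  have h3 := h1.comp_hasDerivAt t h2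
  have e : -inner ℝ K.v (K.lineForce t) = fderiv ℝ V (t • K.v + K.x) K.v := by
    rw [show K.lineForce t = K.Fs (t • K.v + K.x) K.v from rfl, hFs, force, inner_add_right, inner_neg_right, inner_smul_right,
      inner_mulVec_self_of_antisymm (fun i k => hV.antisymm _ i k), real_inner_comm,
      inner_gradient_left]
    ring
  rw [e]
  exact h3

theorem inner_integral_Ioi_lineForce (t : ℝ) :
    inner ℝ K.v (∫ τ in Ioi t, K.lineForce τ) = V (t • K.v + K.x) := by
  have hi := integrable_lineForce (K := K)
  have h := integral_Ioi_of_hasDerivAt_of_tendsto' (a := t) (m := 0)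
    (fun τ _ => hasDerivAt_potential_line hV hFs τ) (hi.const_inner K.v).neg.integrableOn
    ((tendsto_potential_line hV).mono_left atTop_le_cocompact)
  rw [integral_neg, integral_inner hi.integrableOn] at h
  linarith

theorem inner_integral_Iic_lineForce (t : ℝ) :
    inner ℝ K.v (∫ τ in Iic t, K.lineForce τ) = -V (t • K.v + K.x) := by
  have hi := integrable_lineForce (K := K)
  have h := integral_Iic_of_hasDerivAt_of_tendsto' (a := t) (m := 0)
    (fun τ _ => hasDerivAt_potential_line hV hFs τ) (hi.const_inner K.v).neg.integrableOn
    ((tendsto_potential_line hV).mono_left atBot_le_cocompact)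
  rw [integral_neg, integral_inner hi.integrableOn] at h
  linarith

theorem inner_integral_lineForce : inner ℝ K.v (∫ τ, K.lineForce τ) = 0 := by
  have hi := integrable_lineForce (K := K)
  rw [← intervalIntegral.integral_Iic_add_Ioi (b := 0) hi.integrableOn hi.integrableOn,
    inner_add_right, inner_integral_Iic_lineForce hV hFs, inner_integral_Ioi_lineForce hV hFs]
  ring

/-- The inner integrals over (-∞,σ) and (σ,∞) have inner products -V^s and +V^s with v. The
difference of the double integrals thus contributes -∫V^s, and the minus sign in dg turns it into
the added potential term. -/
theorem dg_double_integral : dg K.c K.p ((∫ σ in Iic 0, ∫ τ in Iic σ, K.lineForce τ)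
        - ∫ σ in Ioi 0, ∫ τ in Ioi σ, K.lineForce τ)
    = K.s • ((∫ σ in Iic 0, ∫ τ in Iic σ, K.lineForce τ)
        - (∫ σ in Ioi 0, ∫ τ in Ioi σ, K.lineForce τ)
        + ((∫ τ : ℝ, V (τ • K.v + K.x)) / K.c ^ 2) • K.v) := by
  have hVi := integrable_potential_line hV
  have e : inner ℝ K.v ((∫ σ in Iic 0, ∫ τ in Iic σ, K.lineForce τ)
      - ∫ σ in Ioi 0, ∫ τ in Ioi σ, K.lineForce τ) = -∫ τ : ℝ, V (τ • K.v + K.x) := by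
    rw [inner_sub_right, ← integral_inner integrableOn_integral_lineForce_Iic,
      ← integral_inner integrableOn_integral_lineForce]
    simp only [inner_integral_Iic_lineForce hV hFs, inner_integral_Ioi_lineForce hV hFs]
    rw [integral_neg, ← intervalIntegral.integral_Iic_add_Ioi (b := 0) hVi.integrableOn
      hVi.integrableOn]
    ring
  rw [dg_apply, K.g_p, K.glor_p, e, mul_neg, neg_smul, sub_neg_eq_add,
    one_div_mul_eq_div]

end potential

end Ctx

/-! ### Threshold and numerical constants -/

theorem rpow_three_halves_sq_le (hn : 2 ≤ n) : ((n : ℝ) ^ (3 / 2 : ℝ)) ^ 2 ≤ (n : ℝ) ^ 4 / 2 := by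
  have hn2 : (2 : ℝ) ≤ n := by exact_mod_cast hn
  rw [← Real.rpow_natCast, ← Real.rpow_mul (by linarith),
    show (3 / 2 : ℝ) * ((2 : ℕ) : ℝ) = ((3 : ℕ) : ℝ) by norm_num, Real.rpow_natCast]
  have : 0 < (n : ℝ) ^ 3 := by positivity
  nlinarith

/-- For n ≥ 2, n^(3/2) ≤ n²/√2, and 1/√2 < 5/7. -/
theorem rpow_three_halves_le (hn : 2 ≤ n) : (n : ℝ) ^ (3 / 2 : ℝ) ≤ 5 / 7 * (n : ℝ) ^ 2 := by
  have h := rpow_three_halves_sq_le hn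
  refine le_of_sq_le_sq ?_ (by positivity)
  have : 0 < (n : ℝ) ^ 4 := by positivity
  nlinarith

theorem freeBound_eq {c α b κ : ℝ} {v x : E n} (hκ : κ ≤ 1 / 2) :
    freeBound c α b v x κ = 2 * lor c v * (4 * (n : ℝ) ^ (3 / 2 : ℝ) * b
      * ((1 + ‖x‖ / √2 - κ) ^ (-α) / (α * (‖v‖ / (2 * √2))))) := by
  have hX : 0 ≤ ‖x‖ / √2 := by positivity
  have h2 : (2 : ℝ) ^ (9 / 2 : ℝ) = 16 * √2 := by
    rw [show (9 / 2 : ℝ) = ((4 : ℕ) : ℝ) + 1 / 2 by norm_num, Real.rpow_add two_pos,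
      Real.rpow_natCast, ← Real.sqrt_eq_rpow]
    norm_num
  rw [freeBound, h2, Real.rpow_neg (by linarith)]
  simp only [div_eq_mul_inv, mul_inv, inv_inv]
  ring

/-- The threshold function decreases in ρ, so it is at most 1 at |v|. With n^(3/2) ≤ (5/7)n² the
constant becomes 5/(7·72) ≤ 1/100. -/
theorem small_of_rhoTilde_le (hn : 2 ≤ n) {c α r β : ℝ} (hc : 0 < c) (hα : 0 < α) (hr : 0 < r)
    (hrc : r < c / (2 * √2)) (hβ : 0 < β) {v x : E n} (hv : ‖v‖ < c)
    (hρ : rhoTilde n c α r β ‖x‖ ≤ ‖v‖) :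
    r < ‖v‖ / (2 * √2) ∧
      lor c v * ((n : ℝ) ^ (3 / 2 : ℝ) * β
        * ((1 / 2 + ‖x‖ / √2) ^ (-α) / (α * (‖v‖ / (2 * √2) - r))))
        * ((1 + 1 / c) * (1 + 1 / (‖v‖ / (2 * √2) - r))) ≤ r / 100 := by
  have h2 : 0 < 2 * √2 := by positivity
  have hX : 0 ≤ ‖x‖ / √2 := by positivity
  obtain ⟨hmem, hone⟩ := (rhoTilde_spec hn hc hα hr hrc hβ (norm_nonneg x) _).2 rfl
  have hvmem : ‖v‖ ∈ Ioo (2 * √2 * r) c := ⟨hmem.1.trans_le hρ, hv⟩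
  have hd : r < ‖v‖ / (2 * √2) := by
    rw [lt_div_iff₀ h2]
    linarith [hvmem.1]
  have hle : thresholdFun n c α r β ‖x‖ ‖v‖ ≤ 1 :=
    ((thresholdFun_strictAntiOn hn hc hα hr hβ (norm_nonneg x)).antitoneOn hmem hvmem hρ).trans
      hone.le
  refine ⟨hd, ?_⟩
  have hd0 : 0 < ‖v‖ / (2 * √2) - r := sub_pos.2 hd
  have hs := lor_pos hv
  have hN : 0 < 1 / 2 + ‖x‖ / √2 := by linarith
  have hA := rpow_three_halves_le hn
  set d := ‖v‖ / (2 * √2) - r with hd_def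
  set N := 1 / 2 + ‖x‖ / √2 with hN_def
  have e : thresholdFun n c α r β ‖x‖ ‖v‖
      = 72 * (n : ℝ) ^ 2 * (lor c v * (β * (N ^ (-α) / (α * d))) * ((1 + 1 / c) * (1 + 1 / d))) / r := by
    rw [thresholdFun, ← hd_def, ← hN_def, Real.rpow_neg hN.le, lor]
    simp only [div_eq_mul_inv, mul_inv]
    ring
  rw [e, div_le_one hr] at hle
  have hQ : 0 < lor c v * (β * (N ^ (-α) / (α * d))) * ((1 + 1 / c) * (1 + 1 / d)) := by positivity
  set Q := lor c v * (β * (N ^ (-α) / (α * d))) * ((1 + 1 / c) * (1 + 1 / d)) with hQ_def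
  calc _ = (n : ℝ) ^ (3 / 2 : ℝ) * Q := by rw [hQ_def]; ring
    _ ≤ 5 / 7 * (n : ℝ) ^ 2 * Q := by gcongr
    _ ≤ _ := by
      have : 0 < (n : ℝ) ^ 2 * Q := by positivity
      linarith

namespace Ctx

variable (K : Ctx n)

theorem N₀_rpow (a : ℝ) : K.N₀ ^ (-a) = (K.N₀ ^ a)⁻¹ := Real.rpow_neg K.N₀_pos.le a

theorem deflection_decay_bound {ν t : ℝ} (hν : 1 ≤ ν) (ht : t ≤ 0) :
    2 * K.s * (K.A * (K.r * K.β₁ / K.c + 2 * K.β₂ * (K.r + 1)))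
      * ((1 - K.r + K.X + K.d * |t|) ^ (-(K.α + 1)) / ((K.α + 1) * K.d))
    ≤ 2 * K.A * K.s * (K.r * K.β₁ / K.c + 2 * K.β₂ * (ν * K.r + 1))
      / ((K.α + 1) * K.d * (1 - K.r + K.X - K.d * t) ^ (K.α + 1)) := by
  have := K.hA
  have := K.s_pos
  have := K.hβ₂
  have := K.hα
  have := K.d_pos
  have hr := K.hr
  have hw : 0 < 1 - K.r + K.X - K.d * t := by nlinarith [K.hr2, K.X_nonneg]
  rw [abs_of_nonpos ht, mul_neg, ← sub_eq_add_neg, Real.rpow_neg hw.le]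
  calc _ = 2 * K.A * K.s * (K.r * K.β₁ / K.c + 2 * K.β₂ * (1 * K.r + 1))
      / ((K.α + 1) * K.d * (1 - K.r + K.X - K.d * t) ^ (K.α + 1)) := by
        simp only [div_eq_mul_inv, mul_inv]
        ring
    _ ≤ _ := by gcongr

theorem outVel_bound : 24 * K.A * K.s * K.m * (K.N₀ ^ (-K.α) / (K.α * K.u))
    ≤ 24 * K.A * K.s * K.m / (K.α * K.d * K.N₀ ^ K.α) := by
  have := K.hA
  have := K.s_pos
  have := K.m_pos
  have := K.hα
  have := K.d_pos
  have := K.u_pos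
  have := K.N₀_pos
  calc _ ≤ 24 * K.A * K.s * K.m * (K.N₀ ^ (-K.α) / (K.α * K.d)) := by
        gcongr
        exact K.d_le_u
    _ = _ := by
        rw [N₀_rpow]
        simp only [div_eq_mul_inv, mul_inv]
        ring

/-- 28·5/7 = 20 ≤ 24. -/
theorem position_bound {ν : ℝ} (hA : K.A ≤ 5 / 7 * ν) :
    28 * (K.s * (K.A * K.m / ((K.α + 1) * K.u)) * (K.N₀ ^ (-K.α) / (K.α * K.u)))
    ≤ 24 * ν * K.s * K.m * (1 / K.c + 1) / (K.α * (K.α + 1) * K.d ^ 2 * K.N₀ ^ K.α) := by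
  have := K.hA
  have := K.s_pos
  have := K.m_pos
  have := K.hα
  have := K.d_pos
  have := K.u_pos
  have := K.N₀_pos
  have hc := one_div_pos.2 K.hc
  have hdu := K.d_le_u
  have hν : 0 < ν := by linarith
  calc _ ≤ 28 * (K.s * ((5 / 7 * ν) * K.m / ((K.α + 1) * K.d)) * (K.N₀ ^ (-K.α) / (K.α * K.d))) := by
        gcongr
    _ = 20 * (ν * K.s * K.m / (K.α * (K.α + 1) * K.d ^ 2 * K.N₀ ^ K.α)) := by
        rw [N₀_rpow]
        simp only [div_eq_mul_inv, mul_inv]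
        ring
    _ ≤ (24 * (1 / K.c + 1)) * (ν * K.s * K.m / (K.α * (K.α + 1) * K.d ^ 2 * K.N₀ ^ K.α)) := by
        gcongr
        linarith
    _ = _ := by ring

theorem outgoing_decay_bound {ν : ℝ} (hA : K.A ≤ ν) {t : ℝ} (ht : 0 ≤ t) :
    2 * K.s * K.Φ (1 / 2) * (K.N₀ + K.u * t) ^ (-(K.α + 1))
    ≤ 20 * ν * K.s * K.m * (1 / K.c + 1) / ((K.α + 1) * K.d * (K.N₀ + t * K.u) ^ (K.α + 1)) := by
  have := K.hA
  have := K.s_pos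
  have := K.m_pos
  have := K.hα
  have := K.d_pos
  have := K.u_pos
  have hN := K.weight_pos ht
  have hc := one_div_pos.2 K.hc
  have hdu := K.d_le_u
  have hν : 0 < ν := by linarith
  rw [mul_comm t]
  calc _ = 12 * (K.A * K.s * K.m / ((K.α + 1) * K.u * (K.N₀ + K.u * t) ^ (K.α + 1))) := by
        rw [Real.rpow_neg hN.le, Φ]
        simp only [div_eq_mul_inv, mul_inv]
        ring
    _ ≤ (20 * (1 / K.c + 1)) * (ν * K.s * K.m / ((K.α + 1) * K.d * (K.N₀ + K.u * t) ^ (K.α + 1))) := by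
        gcongr
        linarith
    _ = _ := by ring

/-- The two contributions give 864 + 288 = 1152, halved by A² ≤ ν/2 to 576 ≤ 944. -/
theorem outVel_error_bound {ν : ℝ} (hA : K.A ^ 2 ≤ ν / 2) :
    (144 * K.s ^ 2 / K.c * K.M * K.Φ (1 / 2) + 2 * K.s * (K.Θ / ((K.α + 1) * K.u)))
        * K.N₀ ^ (-(K.α + 1))
    ≤ 944 * ν * K.β ^ 2 * K.s ^ 2 * (K.r / K.c + 1) * (1 + 1 / K.c) * (1 + 1 / K.d) ^ 2
      / (K.α ^ 2 * K.d ^ 2 * K.N₀ ^ (2 * K.α + 1)) := by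
  have hA0 := K.hA
  have hs := K.s_pos
  have hm := K.m_pos
  have hmβ := K.hmβ
  have hβ := K.β_pos
  have hα := K.hα
  have hd := K.d_pos
  have hu := K.u_pos
  have hN := K.N₀_pos
  have hc := K.hc
  have hr := K.hr
  have hdu := K.d_le_u
  have hν : 0 < ν := by nlinarith
  have e : K.N₀ ^ (-K.α) * K.N₀ ^ (-(K.α + 1)) = (K.N₀ ^ (2 * K.α + 1))⁻¹ := by
    rw [← Real.rpow_neg hN.le, ← Real.rpow_add hN]
    ring_nf
  calc _ = K.s ^ 2 * K.A ^ 2 * K.β * (864 * K.m * (1 / K.c)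
          + 288 * K.β * ((1 + 1 / K.u) * (1 + 1 / K.c))) / (K.α * (K.α + 1) * K.u ^ 2)
          * (K.N₀ ^ (-K.α) * K.N₀ ^ (-(K.α + 1))) := by
        rw [Θ, M, Φ]
        simp only [div_eq_mul_inv, mul_inv]
        ring
    _ ≤ K.s ^ 2 * (ν / 2) * K.β * (864 * K.β * ((1 + 1 / K.d) * (1 + 1 / K.c))
          + 288 * K.β * ((1 + 1 / K.d) * (1 + 1 / K.c))) / (K.α * K.α * K.d ^ 2)
          * (K.N₀ ^ (-K.α) * K.N₀ ^ (-(K.α + 1))) := by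
        have h1 : 1 / K.c ≤ (1 + 1 / K.d) * (1 + 1 / K.c) := by
          have := one_div_pos.2 hc
          have := one_div_pos.2 hd
          nlinarith
        gcongr
        linarith
    _ = 576 * (ν * K.β ^ 2 * K.s ^ 2 * 1 * (1 + 1 / K.c) * ((1 + 1 / K.d) * 1)
          / (K.α ^ 2 * K.d ^ 2 * K.N₀ ^ (2 * K.α + 1))) := by
        rw [e]
        simp only [div_eq_mul_inv, mul_inv]
        ring
    _ ≤ 944 * (ν * K.β ^ 2 * K.s ^ 2 * (K.r / K.c + 1) * (1 + 1 / K.c)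
          * ((1 + 1 / K.d) * (1 + 1 / K.d)) / (K.α ^ 2 * K.d ^ 2 * K.N₀ ^ (2 * K.α + 1))) := by
        have h1 : 1 ≤ K.r / K.c + 1 := by
          have := div_pos hr hc
          linarith
        have h2 : 1 ≤ 1 + 1 / K.d := by
          have := one_div_pos.2 hd
          linarith
        gcongr
        norm_num
    _ = _ := by ring

/-- The two contributions give 1152 + 288 = 1440, halved by A² ≤ ν/2 to 720 ≤ 808. -/
theorem position_error_bound {ν : ℝ} (hA : K.A ^ 2 ≤ ν / 2) :
    2 * ((96 * K.s ^ 2 / K.c * K.M * K.Φ (1 / 2) + K.s * (K.Θ / ((K.α + 1) * K.u)))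
        * (K.N₀ ^ (-K.α) / (K.α * K.u)))
    ≤ 808 * ν * K.β ^ 2 * K.s ^ 2 * (1 / K.c + 1) ^ 2 * (1 + 1 / K.d) ^ 2
      / (K.α ^ 2 * (K.α + 1) * K.d ^ 3 * K.N₀ ^ (2 * K.α)) := by
  have hA0 := K.hA
  have hs := K.s_pos
  have hm := K.m_pos
  have hmβ := K.hmβ
  have hβ := K.β_pos
  have hα := K.hα
  have hd := K.d_pos
  have hu := K.u_pos
  have hN := K.N₀_pos
  have hc := K.hc
  have hdu := K.d_le_u
  have hν : 0 < ν := by nlinarith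
  have e : K.N₀ ^ (-K.α) * K.N₀ ^ (-K.α) = (K.N₀ ^ (2 * K.α))⁻¹ := by
    rw [← Real.rpow_neg hN.le, ← Real.rpow_add hN]
    ring_nf
  calc _ = K.s ^ 2 * K.A ^ 2 * K.β * (1152 * K.m * (1 / K.c)
          + 288 * K.β * ((1 + 1 / K.u) * (1 + 1 / K.c))) / (K.α ^ 2 * (K.α + 1) * K.u ^ 3)
          * (K.N₀ ^ (-K.α) * K.N₀ ^ (-K.α)) := by
        rw [Θ, M, Φ]
        simp only [div_eq_mul_inv, mul_inv]
        ring
    _ ≤ K.s ^ 2 * (ν / 2) * K.β * (1152 * K.β * ((1 + 1 / K.d) * (1 + 1 / K.c))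
          + 288 * K.β * ((1 + 1 / K.d) * (1 + 1 / K.c))) / (K.α ^ 2 * (K.α + 1) * K.d ^ 3)
          * (K.N₀ ^ (-K.α) * K.N₀ ^ (-K.α)) := by
        have h1 : 1 / K.c ≤ (1 + 1 / K.d) * (1 + 1 / K.c) := by
          have := one_div_pos.2 hc
          have := one_div_pos.2 hd
          nlinarith
        gcongr
    _ = 720 * (ν * K.β ^ 2 * K.s ^ 2 * ((1 / K.c + 1) * 1) * ((1 + 1 / K.d) * 1)
          / (K.α ^ 2 * (K.α + 1) * K.d ^ 3 * K.N₀ ^ (2 * K.α))) := by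
        rw [e]
        simp only [div_eq_mul_inv, mul_inv]
        ring
    _ ≤ 808 * (ν * K.β ^ 2 * K.s ^ 2 * ((1 / K.c + 1) * (1 / K.c + 1))
          * ((1 + 1 / K.d) * (1 + 1 / K.d)) / (K.α ^ 2 * (K.α + 1) * K.d ^ 3 * K.N₀ ^ (2 * K.α))) := by
        have h1 : 1 ≤ 1 / K.c + 1 := by
          have := one_div_pos.2 hc
          linarith
        have h2 : 1 ≤ 1 + 1 / K.d := by
          have := one_div_pos.2 hd
          linarith
        gcongr
        norm_num
    _ = _ := by ring

end Ctx

end RelNewton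

/-! ### Assembly -/

theorem mainTheorem3 (n : ℕ) (hn : 2 ≤ n) (c : ℝ) (hc : 0 < c)
    (α : ℝ) (hα : α ∈ Ioc (0 : ℝ) 1)
    -- the constants of the long range and of the short range fields
    (βl βs : ℕ → ℝ) (hβl : ∀ m ∈ Icc 0 2, 0 < βl m) (hβs : ∀ m ∈ Icc 1 3, 0 < βs m)
    (Vl Vs : E n → ℝ) (Bl Bs : E n → Matrix (Fin n) (Fin n) ℝ)
    (hl : FieldBounds α (βl 0) (βl 1) (βl 2) Vl Bl)
    (hs : FieldBounds (α + 1) (βs 1) (βs 2) (βs 3) Vs Bs)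
    (hB : ClosedField fun x => Bl x + Bs x)
    (Fl Fs F : E n → E n → E n) (hFl : Fl = force c Vl Bl) (hFs : Fs = force c Vs Bs)
    (hF : F = Fl + Fs)
    (β₂ β : ℝ) (hβ₂ : β₂ = max (βl 2) (βs 2)) (hβ : β = max (βl 1) (max β₂ (βs 3)))
    (r : ℝ) (hr : 0 < r) (hr' : r < min (1 / 2) (c / (2 * √2)))
    (v x : E n) (hv : ‖v‖ < c) (hvx : inner ℝ v x = 0)
    (hρ : rhoTilde n c α r β ‖x‖ ≤ ‖v‖) :
    -- the free solution `z₋(v, x, ·)`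
    ∃ zm : ℝ → E n, IsFreeSolution c Fl atBot v x (freeBound c α (βl 1) v x 0) zm ∧
      (∀ z, IsFreeSolution c Fl atBot v x (freeBound c α (βl 1) v x 0) z → z = zm) ∧
      Integrable (along Fl zm) ∧
      (∀ f ∈ deflectionSpace c r v x zm,
        Integrable (along F (zm + f)) ∧ ∀ t, IntegrableOn (dotA c F Fl v zm f) (Iic t)) ∧
    -- the deflection `y₋`
    ∃ ym ∈ deflectionSpace c r v x zm, opA c F Fl v zm ym = ym ∧
      (∀ f ∈ deflectionSpace c r v x zm, opA c F Fl v zm f = f → f = ym) ∧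
      IsNewtonSolution c F (zm + ym) ∧
      Tendsto ym atBot (𝓝 0) ∧ Tendsto (deriv ym) atBot (𝓝 0) ∧
    -- the outgoing velocity `ã`
    ∃ a : E n, a = outVel c F v (zm + ym) ∧
    -- the free solutions `z₊(ã, x + q, ·)`
    ∃ zp : E n → ℝ → E n,
      (∀ q ∈ Metric.closedBall (0 : E n) (1 / 2),
        IsFreeSolution c Fl atTop a (x + q) (freeBound c α (βl 1) v x ‖q‖) (zp q) ∧
        (∀ z, IsFreeSolution c Fl atTop a (x + q) (freeBound c α (βl 1) v x ‖q‖) z → z = zp q) ∧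
        Integrable (along Fl (zp q)) ∧
        ∀ t, IntegrableOn (hIntegrand c F Fl a (zm + ym) (zp q)) (Ioi t)) ∧
    -- `𝒢` is a `1/6`-contraction of the closed ball of radius `1/2`
      MapsTo (mapG c F Fl v zm ym zp) (Metric.closedBall 0 (1 / 2)) (Metric.closedBall 0 (1 / 2)) ∧
      (∀ q ∈ Metric.closedBall (0 : E n) (1 / 2), ∀ q' ∈ Metric.closedBall (0 : E n) (1 / 2),
        ‖mapG c F Fl v zm ym zp q - mapG c F Fl v zm ym zp q'‖ ≤ 1 / 6 * ‖q - q'‖) ∧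
    -- its fixed point `b̃_sc`
    ∃ b ∈ Metric.closedBall (0 : E n) (1 / 2), mapG c F Fl v zm ym zp b = b ∧
      (∀ q ∈ Metric.closedBall (0 : E n) (1 / 2), mapG c F Fl v zm ym zp q = q → q = b) ∧
    -- the outgoing deflection `y₊`
    ∃ yp : ℝ → E n, yp = hFun c F Fl a (zm + ym) (zp b) ∧
      (∀ t, 0 ≤ t → zm t + ym t = zp b t + yp t) ∧
      Tendsto yp atTop (𝓝 0) ∧ Tendsto (deriv yp) atTop (𝓝 0) ∧
    -- the bound on the derivative of `y₋`
      (∀ t, t ≤ 0 → ‖deriv ym t‖ ≤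
        2 * (n : ℝ) ^ (3 / 2 : ℝ) * √(1 - ‖v‖ ^ 2 / c ^ 2)
            * (r * βl 1 / c + 2 * β₂ * (√n * r + 1))
          / ((α + 1) * (‖v‖ / (2 * √2) - r)
            * (1 - r + ‖x‖ / √2 - (‖v‖ / (2 * √2) - r) * t) ^ (α + 1))) ∧
    -- the bound on `ã_sc = ã - v`
      ‖a - v‖ ≤
        24 * (n : ℝ) ^ (3 / 2 : ℝ) * √(1 - ‖v‖ ^ 2 / c ^ 2) * max (βl 1) β₂
          / (α * (‖v‖ / (2 * √2) - r) * (1 / 2 + ‖x‖ / √2) ^ α) ∧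
    -- the bound on `b̃_sc`
      ‖b‖ ≤
        24 * (n : ℝ) ^ 2 * √(1 - ‖v‖ ^ 2 / c ^ 2) * max (βl 1) β₂ * (1 / c + 1)
          / (α * (α + 1) * (‖v‖ / (2 * √2) - r) ^ 2 * (1 / 2 + ‖x‖ / √2) ^ α) ∧
    -- the bound on the derivative of `y₊`
      (∀ t, 0 ≤ t → DifferentiableAt ℝ yp t ∧ ‖deriv yp t‖ ≤
        20 * (n : ℝ) ^ 4 * √(1 - ‖v‖ ^ 2 / c ^ 2) * max (βl 1) β₂ * (1 / c + 1)
          / ((α + 1) * (‖v‖ / (2 * √2) - r)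
            * (1 / 2 + ‖x‖ / √2 + t * (‖v‖ / (2 * √2))) ^ (α + 1))) ∧
    -- convergence of the integrals along the straight line
      Integrable (fun τ : ℝ => Fs (τ • v + x) v) ∧
      Integrable (fun τ : ℝ => Vs (τ • v + x)) ∧
      IntegrableOn (fun σ : ℝ => ∫ τ in Iic σ, Fs (τ • v + x) v) (Iic 0) ∧
      IntegrableOn (fun σ : ℝ => ∫ τ in Ioi σ, Fs (τ • v + x) v) (Ioi 0) ∧
    -- the error estimate for `ã_sc - W̃`
      ‖(a - v) - tildeW c Fl v zm (zp 0)
          - √(1 - ‖v‖ ^ 2 / c ^ 2) • ∫ τ : ℝ, Fs (τ • v + x) v‖ ≤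
        944 * (n : ℝ) ^ 4 * β ^ 2 * (1 - ‖v‖ ^ 2 / c ^ 2) * (r / c + 1) * (1 + 1 / c)
            * (1 + 1 / (‖v‖ / (2 * √2) - r)) ^ 2
          / (α ^ 2 * (‖v‖ / (2 * √2) - r) ^ 2 * (1 / 2 + ‖x‖ / √2) ^ (2 * α + 1)) ∧
    -- the error estimate for `b̃_sc`
      ‖b - √(1 - ‖v‖ ^ 2 / c ^ 2) •
          ((∫ σ in Iic (0 : ℝ), ∫ τ in Iic σ, Fs (τ • v + x) v)
            - (∫ σ in Ioi (0 : ℝ), ∫ τ in Ioi σ, Fs (τ • v + x) v)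
            + ((∫ τ : ℝ, Vs (τ • v + x)) / c ^ 2) • v)‖ ≤
        808 * (n : ℝ) ^ 4 * β ^ 2 * (1 - ‖v‖ ^ 2 / c ^ 2) * (1 / c + 1) ^ 2
            * (1 + 1 / (‖v‖ / (2 * √2) - r)) ^ 2
          / (α ^ 2 * (α + 1) * (‖v‖ / (2 * √2) - r) ^ 3 * (1 / 2 + ‖x‖ / √2) ^ (2 * α)) := by
  subst hFl hFs hF hβ₂ hβ
  obtain ⟨hα0, hα1⟩ := hα
  have hl1 : 0 < βl 1 := hβl 1 (by simp)
  have hl2 : 0 < βl 2 := hβl 2 (by simp)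
  have hs2 : 0 < βs 2 := hβs 2 (by simp)
  have hs3 : 0 < βs 3 := hβs 3 (by simp)
  have hb2 : 0 < max (βl 2) (βs 2) := lt_max_of_lt_left hl2
  have hb0 : 0 < max (βl 1) (max (max (βl 2) (βs 2)) (βs 3)) := lt_max_of_lt_left hl1
  have hA : 0 < (n : ℝ) ^ (3 / 2 : ℝ) := Real.rpow_pos_of_pos (by exact_mod_cast (by omega : 0 < n)) _
  have hn1 : (1 : ℝ) ≤ n := by exact_mod_cast (by omega : 1 ≤ n)
  obtain ⟨hd, hsmall⟩ := small_of_rhoTilde_le hn hc hα0 hr (hr'.trans_le (min_le_right _ _)) hb0 hv hρ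
  have hfl := hl.forceBound (c := c) (by omega) hc hα0 hl1.le hl2.le
  have hfs := hs.forceBound (c := c) (by omega) hc (by linarith) hs2.le hs3.le
  -- The second-order constant of the long range field and the first-order constant of the short
  -- range field are both enlarged to β₂, so one constant serves as Lipschitz bound for F^l and as
  -- size bound for F^s.
  obtain ⟨K, rfl, rfl, hKA, hK₁, hK₂, hKm, hKβ, rfl, rfl, rfl, hKl, hKs⟩ : ∃ K : Ctx n,
      K.c = c ∧ K.α = α ∧ K.A = (n : ℝ) ^ (3 / 2 : ℝ) ∧ K.β₁ = βl 1 ∧ K.β₂ = max (βl 2) (βs 2) ∧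
      K.m = max (βl 1) (max (βl 2) (βs 2)) ∧
      K.β = max (βl 1) (max (max (βl 2) (βs 2)) (βs 3)) ∧ K.r = r ∧ K.v = v ∧ K.x = x ∧
      K.Fl = force c Vl Bl ∧ K.Fs = force c Vs Bs := ⟨
    { c := c, α := α, A := (n : ℝ) ^ (3 / 2 : ℝ), β₁ := βl 1, β₂ := max (βl 2) (βs 2)
      m := max (βl 1) (max (βl 2) (βs 2)), β := max (βl 1) (max (max (βl 2) (βs 2)) (βs 3))
      r := r, v := v, x := x, Fl := force c Vl Bl, Fs := force c Vs Bs
      hc := hc, hα := hα0, hα1 := hα1, hA := hA, hβ₁ := hl1, hβ₂ := hb2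
      hβ₁m := le_max_left _ _, hβ₂m := le_max_right _ _
      hmβ := max_le_max le_rfl (le_max_left _ _)
      hr := hr, hr2 := hr'.trans_le (min_le_left _ _), hv := hv, hvx := hvx, hd := hd
      hl := hfl.mono hc hA.le le_rfl (le_max_left _ _)
      hs := hfs.mono hc hA.le (le_max_right _ _) ((le_max_right _ _).trans (le_max_right _ _))
      small := hsmall },
    rfl, rfl, rfl, rfl, rfl, rfl, rfl, rfl, rfl, rfl, rfl, rfl⟩
  rw [← hKl, ← hKs, ← hKβ, ← hKm, ← hK₁, ← hK₂, ← hKA, ← Ctx.F]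
  have hA1 : K.A ≤ 5 / 7 * (n : ℝ) ^ 2 := hKA ▸ rpow_three_halves_le hn
  have hA2 : K.A ^ 2 ≤ (n : ℝ) ^ 4 / 2 := hKA ▸ rpow_three_halves_sq_le hn
  have hA4 : K.A ≤ (n : ℝ) ^ 4 := by
    have : (n : ℝ) ^ 2 ≤ (n : ℝ) ^ 4 := pow_le_pow_right₀ hn1 (by norm_num)
    nlinarith
  have hsq : 1 - ‖K.v‖ ^ 2 / K.c ^ 2 = K.s ^ 2 := (lor_sq hv).symm
  have hC : ∀ κ ≤ 1 / 2, freeBound K.c K.α K.β₁ K.v K.x κ = K.C K.β₁ κ := fun κ hκ => by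
    rw [freeBound_eq hκ, ← hKA]
    rfl
  rw [hC 0 (by norm_num)]
  obtain ⟨zm, hzm, hzmu⟩ := Ctx.exists_incoming K
  refine ⟨zm, hzm, hzmu, (Ctx.zm_integrable hzm).1, fun f hf =>
    ⟨(Ctx.deflection_integrable hzm hf).1, Ctx.integrableOn_dotA hzm hf⟩, ?_⟩
  obtain ⟨ym, h, hymu⟩ := Ctx.exists_deflection hzm
  refine ⟨ym, h.mem, h.fixed, hymu, h.newton, h.tendsto_ym, h.tendsto_deriv_ym, _, rfl, ?_⟩
  have hex : ∀ q : E n, ∃ z, ‖q‖ ≤ 1 / 2 →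
      IsFreeSolution K.c K.Fl atTop (outVel K.c K.F K.v (zm + ym)) (K.x + q) (K.C K.β₁ ‖q‖) z ∧
      ∀ z', IsFreeSolution K.c K.Fl atTop (outVel K.c K.F K.v (zm + ym)) (K.x + q) (K.C K.β₁ ‖q‖) z' →
        z' = z := fun q => by
    by_cases hq : ‖q‖ ≤ 1 / 2
    · obtain ⟨z, hz⟩ := h.exists_outgoing hq le_rfl
      exact ⟨z, fun _ => hz⟩
    · exact ⟨0, fun h => absurd h hq⟩
  choose zp hzpf using hex
  have hzp : ∀ q, ‖q‖ ≤ 1 / 2 → K.Good K.Fl (outVel K.c K.F K.v (zm + ym)) (zp q) := fun q hq =>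
    h.outgoing_good hq le_rfl (hzpf q hq).1
  have hzp0 : ∀ q, ‖q‖ ≤ 1 / 2 → zp q 0 = K.x + q := fun q hq => (hzpf q hq).1.initial
  have hmaps := h.mapG_mapsTo hzp hzp0
  have hcontr : ∀ q, ‖q‖ ≤ 1 / 2 → ∀ q', ‖q'‖ ≤ 1 / 2 →
      ‖mapG K.c K.F K.Fl K.v zm ym zp q - mapG K.c K.F K.Fl K.v zm ym zp q'‖ ≤ 1 / 6 * ‖q - q'‖ :=
    fun q hq q' hq' => h.mapG_contract hzp hzp0 hq hq'
  obtain ⟨b, hb', hfix, hbu⟩ := exists_unique_fixed (f := mapG K.c K.F K.Fl K.v zm ym zp) (R := 1 / 2)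
    (k := 1 / 6) (by norm_num) (by norm_num) (by norm_num) hmaps
    fun q hq q' hq' => hcontr q (mem_closedBall_zero_iff.1 hq) q' (mem_closedBall_zero_iff.1 hq')
  have hb := mem_closedBall_zero_iff.1 hb'
  have hbb := h.norm_mapG_le hzp hzp0 hb
  rw [hfix] at hbb
  have h0 : ‖(0 : E n)‖ ≤ 1 / 2 := by simp
  refine ⟨zp, fun q hq => ?_, hmaps, ?_, b, hb', hfix, hbu, _, rfl, fun t _ => ?_,
    h.tendsto_hFun hzp hzp0 hb hfix, h.tendsto_deriv_hFun hzp hzp0 hb hfix, fun t ht => ?_, ?_, ?_,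
    fun t ht => ⟨(h.hasDerivAt_hFun hzp hzp0 hb hfix t).differentiableAt, ?_⟩,
    Ctx.integrable_lineForce (K := K), Ctx.integrable_potential_line (K := K) hs,
    Ctx.integrableOn_integral_lineForce_Iic (K := K), Ctx.integrableOn_integral_lineForce (K := K),
    ?_, ?_⟩
  · have hq' := mem_closedBall_zero_iff.1 hq
    rw [hC _ hq']
    exact ⟨(hzpf q hq').1, (hzpf q hq').2, (hzp q hq').int, h.hIntegrand_integrableOn (hzp q hq')⟩
  · exact fun q hq q' hq' => hcontr q (mem_closedBall_zero_iff.1 hq) q' (mem_closedBall_zero_iff.1 hq')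
  · have e := h.hFun_eq_sub hzp hzp0 hb hfix t
    change _ = zp b t + hFun K.c K.F K.Fl (outVel K.c K.F K.v (zm + ym)) (zm + ym) (zp b) t
    rw [e, add_sub_cancel]
    rfl
  · rw [h.deriv_ym]
    exact (Ctx.norm_dotA_le hzm h.mem ht).trans
      (K.deflection_decay_bound (Real.one_le_sqrt.2 hn1) ht)
  · exact h.norm_outVel_sub_le.trans K.outVel_bound
  · exact hbb.trans (K.position_bound hA1)
  · exact (h.norm_deriv_hFun_le hzp hzp0 hb hfix ht).trans (K.outgoing_decay_bound hA4 ht)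
  · rw [hsq]
    have hz0 : zp 0 0 = K.x := by rw [hzp0 0 h0, add_zero]
    -- The potential yields the orthogonality of the line integral to v required by `outVel_error`.
    rw [Real.sqrt_sq K.s_pos.le]
    exact (h.outVel_error (Ctx.inner_integral_lineForce (K := K) hs hKs) (hzp 0 h0) hz0).trans
      (K.outVel_error_bound hA2)
  · rw [hsq, Real.sqrt_sq K.s_pos.le]
    have e := h.position_error hzp hzp0 hb hfix
    rw [Ctx.dg_double_integral (K := K) hs hKs] at e
    exact e.trans (K.position_error_bound hA2)
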